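/- **Setting.** Let $\mathbb T=\mathbb R/\mathbb Z$ and $\mathbb A=\mathbb T\times[-\frac\pi2,\frac\pi2]$. Let $\gamma:\mathbb T\to\mathbb R^2$ be a $\mathcal C^k$ embedding, $k\ge 2$ (possibly $k=\infty$ or $k=\omega$), parametrized counterclockwise, whose image is the boundary of a convex domain $\Omega$ and whose curvature vanishes nowhere. Let $f:\mathbb A\to\mathbb A$ be the billiard map of $\Omega$: $f(\theta,\varphi)=(\theta',\varphi')$, where $\varphi$ is the oriented angle from the outgoing velocity at $\gamma(\theta)$ to the inward normal, $\gamma(\theta')$ is the next bouncing point and $\varphi'$ the angle after reflection there; $f$ is the identity on $\mathbb T\times\{\pm\frac\pi2\}$. A sequence $(X_i)_{i\in\mathbb Z}$ of reals with $X_i\le X_{i+1}\le X_i+1$ is *minimal* if for all $j<k$ the segment $(X_j,\dots,X_k)$ maximizes the length $\sum_{i=j}^{k-1}\|\gamma(Y_i)-\gamma(Y_{i+1})\|$ among all $(Y_j,\dots,Y_k)$ with $Y_i\le Y_{i+1}\le Y_i+1$, $Y_j=X_j$, $Y_k=X_k$. The *Aubry–Mather set* $\mathcal M_\alpha(\Omega)\subset\mathbb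 A$ is the set of points $x$ for which there is a minimal sequence $(X_i)$ with $\lim_{n\to+\infty}(X_n-X_0)/n=\alpha$ such that $X_i$ is, modulo $1$, the first coordinate of $f^i(x)$ for every $i\in\mathbb Z$. Let $0<p<q$ be coprime integers, and suppose that $\mathcal M_{p/q}(\Omega)$ contains a unique periodic orbit $\mathcal P$ of $f$, and that $\mathcal P$ is hyperbolic of period $q$: $q$ is its least period, and for $P\in\mathcal P$ the eigenvalues of $Df^q(P)$ lie off the unit circle. For $P\in\mathcal P$ let $W^{\mathrm s}(P)$, resp. $W^{\mathrm u}(P)$, be its stable, resp. unstable, manifold, i.e. the set of $x\in\mathbb A$ with $\operatorname{dist}(f^m(x),f^m(P))\to0$ as $m\to+\infty$, resp. $m\to-\infty$. For $\rho>0$ let $W^{\mathrm s}_\rho(P)$, resp. $W^{\mathrm u}_\rho(P)$, be the local manifold consisting of those of its points whose distance from $P$ along the immersed manifold, for the metric $d\theta^2+d\varphi^2$, is less than $\rho$. A point $Q$ is *homoclinic* to $\mathcal P$ if $Q\notin\mathcal P$ and $Q\in W^{\mathrm s}(P)\cap W^{\mathrm u}(P')$ for some $P,P'\in\mathcal P$.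 A point $x\in\mathbb A$ is *one-fibered* if its first coordinate has a closed neighbourhood $U\subset\mathbb T$ that contains the first coordinate of $f^j(x)$ for no $j\in\mathbb Z\setminus\{0\}$. **Proposition.** Let $Q$ be a homoclinic point to $\mathcal P$. Suppose that the orbit of $Q$ is not localised one-fibered: for some $\rho>0$ (however small), no iterate $f^\ell(Q)$, $\ell\in\mathbb Z$, that lies in $\bigcup_{P\in\mathcal P}\big(W^{\mathrm s}_\rho(P)\cup W^{\mathrm u}_\rho(P)\big)\setminus\mathcal P$ is one-fibered. Then $q=2$, and $\mathcal P\subset\mathcal M_{1/2}(\Omega)$. -/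

import Mathlib

open Set Filter Topology

noncomputable section

namespace Billiard

/-- The Euclidean plane. -/
abbrev Plane := EuclideanSpace ℝ (Fin 2)

/-- The closed annulus `𝕋 × [-π/2, π/2]` with `𝕋 = ℝ/ℤ`. -/
abbrev Annulus := UnitAddCircle × Icc (-(Real.pi / 2)) (Real.pi / 2)

/-! ### Billiard tables -/

/-- The determinant of two plane vectors. -/
def det (a b : Plane) : ℝ := a 0 * b 1 - a 1 * b 0

/-- Rotation by `+π/2`. -/
def rot (a : Plane) : Plane := !₂[-a 1, a 0]

/-- The derivative of the closed curve `γ : 𝕋 → ℝ²` at `θ`. -/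
def velocity (γ : UnitAddCircle → Plane) (θ : UnitAddCircle) : Plane :=
  deriv (fun t : ℝ => γ (θ + (t : UnitAddCircle))) 0

/-- The second derivative of the closed curve `γ : 𝕋 → ℝ²` at `θ`. -/
def acceleration (γ : UnitAddCircle → Plane) (θ : UnitAddCircle) : Plane :=
  deriv (deriv (fun t : ℝ => γ (θ + (t : UnitAddCircle)))) 0

/-- The unit tangent vector of `γ` at `θ`. -/
def unitTangent (γ : UnitAddCircle → Plane) (θ : UnitAddCircle) : Plane :=
  ‖velocity γ θ‖⁻¹ • velocity γ θ

/-- The unit inward normal vector at `γ θ` (for a counterclockwise parametrization). -/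
def inwardNormal (γ : UnitAddCircle → Plane) (θ : UnitAddCircle) : Plane :=
  rot (unitTangent γ θ)

/-- The table `Ω(γ)`: the interior of the convex hull of the curve. If the curve bounds a convex
open set, then this is that set. -/
def table (γ : UnitAddCircle → Plane) : Set Plane :=
  interior (convexHull ℝ (range γ))

/-- `γ` is a `C²` embedded closed curve, parametrized counterclockwise, which is the boundary of a
convex table and whose curvature vanishes nowhere. (Immersivity is implied by the last field.) -/
structure IsStronglyConvexTable (γ : UnitAddCircle → Plane) : Prop where
  contDiff : ContDiff ℝ 2 (fun x : ℝ => γ (x : UnitAddCircle))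
  injective : Function.Injective γ
  frontier_eq : frontier (table γ) = range γ
  curvature_ne_zero : ∀ θ, 0 < det (velocity γ θ) (acceleration γ θ)

/-! ### The billiard map -/

/-- The outgoing unit velocity at the phase point `(θ, φ)`: the oriented angle from it to the
inward normal is `φ`. -/
def direction (γ : UnitAddCircle → Plane) (x : Annulus) : Plane :=
  Real.sin x.2 • unitTangent γ x.1 + Real.cos x.2 • inwardNormal γ x.1

/-- The ray which leaves `γ θ` in the outgoing direction of `x = (θ, φ)` hits the boundary at
`γ θ'`, with `θ' ≠ θ`. -/
def Hits (γ : UnitAddCircle → Plane) (x : Annulus) (θ' : UnitAddCircle) : Prop :=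
  θ' ≠ x.1 ∧ ∃ t : ℝ, 0 < t ∧ γ θ' = γ x.1 + t • direction γ x

open Classical in
/-- The billiard map. The ray of `x = (θ, φ)` hits the boundary at exactly one further point
`γ θ'` when `|φ| < π/2`; there it is reflected, so that its tangential component `sin φ'` is kept.
If `φ = ± π/2` then the ray is tangent, there is no further point, and `x` is fixed. -/
def billiardMap (γ : UnitAddCircle → Plane) (x : Annulus) : Annulus :=
  if h : ∃ θ', Hits γ x θ' then
    (h.choose,
      ⟨Real.arcsin (inner ℝ (direction γ x) (unitTangent γ h.choose)), Real.arcsin_mem_Icc _⟩)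
  else x

instance : Nonempty (Icc (-(Real.pi / 2)) (Real.pi / 2)) :=
  ⟨⟨Real.arcsin 0, Real.arcsin_mem_Icc 0⟩⟩

/-- The iterates `f ^ n`, `n ∈ ℤ`, of the billiard map `f`, which is a bijection of the annulus. -/
def iter (γ : UnitAddCircle → Plane) : ℤ → Annulus → Annulus
  | Int.ofNat n => (billiardMap γ)^[n]
  | Int.negSucc n => (Function.invFun (billiardMap γ))^[n + 1]

/-- The full orbit of a point. -/
def orbit (γ : UnitAddCircle → Plane) (x : Annulus) : Set Annulus :=
  range fun n : ℤ => iter γ n x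

/-! ### Aubry-Mather sets -/

/-- The length of the chord between the boundary points with parameters `x` and `y`. Its negative
is a generating function of the billiard map. -/
def chord (γ : UnitAddCircle → Plane) (x y : ℝ) : ℝ :=
  ‖γ (x : UnitAddCircle) - γ (y : UnitAddCircle)‖

/-- The length of the segment `(X j, …, X k)` of a sequence of bounces. -/
def segmentLength (γ : UnitAddCircle → Plane) (X : ℤ → ℝ) (j k : ℤ) : ℝ :=
  ∑ i ∈ Finset.Ico j k, chord γ (X i) (X (i + 1))

/-- `(x, y)` lies in the domain of the generating function of the lift of the billiard map with
`x ≤ y ≤ x + 1`. -/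
def Admissible (x y : ℝ) : Prop := x ≤ y ∧ y ≤ x + 1

/-- A bi-infinite sequence each of whose finite segments minimizes the action (the negative of the
length) among the segments with the same endpoints. -/
def IsMinimal (γ : UnitAddCircle → Plane) (X : ℤ → ℝ) : Prop :=
  (∀ i, Admissible (X i) (X (i + 1))) ∧
  ∀ j k : ℤ, j < k → ∀ Y : ℤ → ℝ, (∀ i ∈ Finset.Ico j k, Admissible (Y i) (Y (i + 1))) →
    Y j = X j → Y k = X k → segmentLength γ Y j k ≤ segmentLength γ X j k

/-- The Aubry-Mather set of rotation number `α`: the phase points whose orbit projects to a minimal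
sequence of rotation number `α`. -/
def aubryMatherSet (γ : UnitAddCircle → Plane) (α : ℝ) : Set Annulus :=
  {x | ∃ X : ℤ → ℝ, (∀ i : ℤ, (X i : UnitAddCircle) = (iter γ i x).1) ∧ IsMinimal γ X ∧
    Tendsto (fun n : ℕ => (X (n : ℤ) - X 0) / (n : ℝ)) atTop (𝓝 α)}

/-! ### Hyperbolic periodic points and their invariant manifolds -/

/-- The covering of the annulus by the strip, used at interior points `|φ| < π/2` only. -/
def cover (z : ℝ × ℝ) : Annulus :=
  ((z.1 : UnitAddCircle),
    projIcc (-(Real.pi / 2)) (Real.pi / 2) (by linarith [Real.pi_pos]) z.2)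

/-- `L` is the differential of `g` at the interior point `x` of the annulus, in the coordinates
`(s, φ)`: it is the derivative of a local lift `G` of `g`. -/
def HasDifferential (g : Annulus → Annulus) (x : Annulus) (L : (ℝ × ℝ) →L[ℝ] (ℝ × ℝ)) : Prop :=
  |(x.2 : ℝ)| < Real.pi / 2 ∧ ∃ (s : ℝ) (G : ℝ × ℝ → ℝ × ℝ), (s : UnitAddCircle) = x.1 ∧
    (∀ᶠ z in 𝓝 (s, (x.2 : ℝ)), ((G z).1 : UnitAddCircle) = (g (cover z)).1 ∧
      (G z).2 = (g (cover z)).2) ∧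
    HasFDerivAt G L (s, (x.2 : ℝ))

/-- `P` is a hyperbolic `q`-periodic point: its minimal period is `q`, and no complex eigenvalue of
the differential of `f ^ q` at `P` lies on the unit circle. -/
def IsHyperbolicPeriodicPoint (γ : UnitAddCircle → Plane) (q : ℕ) (P : Annulus) : Prop :=
  0 < q ∧ Function.minimalPeriod (billiardMap γ) P = q ∧
  ∃ L : (ℝ × ℝ) →L[ℝ] (ℝ × ℝ), HasDifferential (billiardMap γ)^[q] P L ∧
    ∀ μ : ℂ, Polynomial.aeval μ (L : (ℝ × ℝ) →ₗ[ℝ] (ℝ × ℝ)).charpoly = 0 → ‖μ‖ ≠ 1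

/-- The points `x` with `dist (F m x) (F m P) → 0` as `m → ∞`. -/
def asymptoticSet (F : ℕ → Annulus → Annulus) (P : Annulus) : Set Annulus :=
  {x | Tendsto (fun m => dist (F m x) (F m P)) atTop (𝓝 0)}

/-- The length of a curve `c : [0, 1] → 𝕋 × [-π/2, π/2]` for the metric `ds² + dφ²`. -/
def curveLength (c : ℝ → Annulus) : ENNReal :=
  eVariationOn (fun t => WithLp.toLp 2 (c t)) (Icc 0 1)

/-- `c : [0, 1] → asymptoticSet F P` is a curve which is continuous for the topology of the immersed
manifold `asymptoticSet F P`, that is, it is a continuous curve which stays in a compact piece of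
this manifold: the convergence `dist (F m (c t)) (F m P) → 0` is uniform in `t`. -/
def IsLeafCurve (F : ℕ → Annulus → Annulus) (P : Annulus) (c : ℝ → Annulus) : Prop :=
  ContinuousOn c (Icc 0 1) ∧
  TendstoUniformlyOn (fun m t => dist (F m (c t)) (F m P)) (fun _ => 0) atTop (Icc 0 1)

/-- The distance from `P` to `x` along the immersed manifold `asymptoticSet F P`: the infimum of the
lengths of the curves in it from `P` to `x`. -/
def leafDist (F : ℕ → Annulus → Annulus) (P x : Annulus) : ENNReal :=
  ⨅ (c : ℝ → Annulus) (_ : IsLeafCurve F P c ∧ c 0 = P ∧ c 1 = x), curveLength c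

/-- The points of the immersed manifold `asymptoticSet F P` at distance less than `ρ` from `P`
along it. -/
def localAsymptoticSet (F : ℕ → Annulus → Annulus) (P : Annulus) (ρ : ℝ) : Set Annulus :=
  {x ∈ asymptoticSet F P | leafDist F P x < ENNReal.ofReal ρ}

/-- The stable manifold of `P`. -/
def stableManifold (γ : UnitAddCircle → Plane) (P : Annulus) : Set Annulus :=
  asymptoticSet (fun m => iter γ (m : ℤ)) P

/-- The unstable manifold of `P`. -/
def unstableManifold (γ : UnitAddCircle → Plane) (P : Annulus) : Set Annulus :=
  asymptoticSet (fun m => iter γ (-(m : ℤ))) P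

/-- The local stable manifold of `P`, of size `ρ`. -/
def localStableManifold (γ : UnitAddCircle → Plane) (P : Annulus) (ρ : ℝ) : Set Annulus :=
  localAsymptoticSet (fun m => iter γ (m : ℤ)) P ρ

/-- The local unstable manifold of `P`, of size `ρ`. -/
def localUnstableManifold (γ : UnitAddCircle → Plane) (P : Annulus) (ρ : ℝ) : Set Annulus :=
  localAsymptoticSet (fun m => iter γ (-(m : ℤ))) P ρ

/-- `Q` is a homoclinic point to the orbit of `P`: it is not on this orbit, and it lies on the stable
manifold of a point and on the unstable manifold of a point of this orbit. -/
def IsHomoclinic (γ : UnitAddCircle → Plane) (P Q : Annulus) : Prop :=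
  Q ∉ orbit γ P ∧ (∃ P₁ ∈ orbit γ P, Q ∈ stableManifold γ P₁) ∧
    ∃ P₂ ∈ orbit γ P, Q ∈ unstableManifold γ P₂

/-! ### One-fibered points -/

/-- `x` is one-fibered: its first coordinate has a closed neighbourhood which contains the first
coordinate of no other iterate of `x`. -/
def IsOneFibered (γ : UnitAddCircle → Plane) (x : Annulus) : Prop :=
  ∃ U : Set UnitAddCircle, IsClosed U ∧ U ∈ 𝓝 x.1 ∧ ∀ j : ℤ, j ≠ 0 → (iter γ j x).1 ∉ U

/-- The orbit of `Q` is localised one-fibered, for local invariant manifolds of size `ρ` of the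
orbit of `P`: some iterate of `Q` is one-fibered and lies on the local stable or on the local
unstable manifold of some point of the orbit of `P`, but not on the orbit of `P`. -/
def IsLocalisedOneFibered (γ : UnitAddCircle → Plane) (P Q : Annulus) (ρ : ℝ) : Prop :=
  ∃ l : ℤ, IsOneFibered γ (iter γ l Q) ∧ iter γ l Q ∉ orbit γ P ∧
    ∃ P' ∈ orbit γ P,
      iter γ l Q ∈ localStableManifold γ P' ρ ∪ localUnstableManifold γ P' ρ

end Billiard

end

/-! Let X be a minimal sequence carrying the orbit of P. Minimality makes the Jacobi operator along
X (minus the second variation of length) nonnegative, so its lowest periodic eigenvector w, which is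
positive, has an eigenvalue μ ≥ 0 (`exists_ground_state`, `ground_state_nonneg`). If μ were 0, then
w would be a periodic Jacobi field and Df^q would fix a nonzero vector, against hyperbolicity
(`not_hyperbolic_of_isJacobiField`). Hence μ > 0, and w is a strict positive supersolution
(`exists_hyperbolicConfig`).

Measure displacements from X in units of w. The Euler-Lagrange recurrence is then strictly
diagonally dominant: each displacement is at most a factor below one times the larger of its two
neighbours. So the displacements of an orbit that stays near X in forward time decay geometrically
and are determined by the first one, and every small first displacement occurs. The local stable
manifold is thus a graph over the first coordinate. The forward tail of Q eventually lies on such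
manifolds of size ρ, with nonzero displacements of strictly decreasing size (`exists_track`); time
reversal gives the same for the backward tail.

An exchange argument shows that distinct points of the orbit of P have distinct first coordinates
(`minimal_inj`), so near these coordinates a point of the circle determines the bounce modulo q and
the displacement (`exists_separation`). By hypothesis the far iterates of Q are not one-fibered.
First coordinates of iterates of Q accumulate only at bounces of P, so such a far iterate shares its
first coordinate exactly with another iterate. Strict decrease excludes the same tail, and the
finitely many middle iterates are avoided far out; the partner lies on the opposite tail
(`eventually_exists_match`).

Two strictly decreasing sequences whose far values coincide match consecutive terms with consecutive
terms (`dvd_two_of_match`). But the bounce index rises by one along the forward tail and falls by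
one along the backward tail: a + m ≡ b - n and a + m + 1 ≡ b - n - 1 modulo q. Therefore q divides
2. -/

open Set Filter Topology

noncomputable section

namespace Billiard

/-! ### Plane vectors -/

lemma inner_eq (a b : Plane) : inner ℝ a b = a 0 * b 0 + a 1 * b 1 := by
  simp [PiLp.inner_apply, Fin.sum_univ_two, mul_comm]

lemma norm_sq_eq (a : Plane) : ‖a‖ ^ 2 = a 0 ^ 2 + a 1 ^ 2 := by
  simp [EuclideanSpace.norm_sq_eq, Fin.sum_univ_two]

lemma rot_zero (a : Plane) : rot a 0 = -a 1 := by simp [rot]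

lemma rot_one (a : Plane) : rot a 1 = a 0 := by simp [rot]

lemma plane_ext {a b : Plane} (h0 : a 0 = b 0) (h1 : a 1 = b 1) : a = b := by
  ext i; fin_cases i <;> assumption

/-- The determinant with a fixed first vector, as a continuous linear form. -/
def detL (a : Plane) : Plane →L[ℝ] ℝ := innerSL ℝ (rot a)

lemma detL_apply (a b : Plane) : detL a b = det a b := by
  simp only [detL, innerSL_apply_apply, inner_eq, rot_zero, rot_one, det]; ring

/-- A linear form that vanishes on `v ≠ 0` is a multiple of `det v`. -/
lemma exists_eq_mul_det {v : Plane} (hv : v ≠ 0) (f : Plane →L[ℝ] ℝ) (hf : f v = 0) :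
    ∃ k : ℝ, ∀ w, f w = k * det v w := by
  have hn : v 0 ^ 2 + v 1 ^ 2 ≠ 0 := by
    rw [← norm_sq_eq]; exact pow_ne_zero 2 (norm_ne_zero_iff.2 hv)
  refine ⟨f (rot v) / (v 0 ^ 2 + v 1 ^ 2), fun w => ?_⟩
  have hw : w = (inner ℝ v w / (v 0 ^ 2 + v 1 ^ 2)) • v
      + (det v w / (v 0 ^ 2 + v 1 ^ 2)) • rot v := by
    apply plane_ext <;>
      simp only [PiLp.add_apply, PiLp.smul_apply, smul_eq_mul, inner_eq, det, rot_zero, rot_one] <;>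
      field_simp <;> ring
  calc f w = f ((inner ℝ v w / (v 0 ^ 2 + v 1 ^ 2)) • v
      + (det v w / (v 0 ^ 2 + v 1 ^ 2)) • rot v) := by rw [← hw]
    _ = _ := by rw [map_add, map_smul, map_smul, hf]; simp; ring

/-- The second derivative at a local maximum is nonpositive. -/
lemma deriv2_nonpos_of_isLocalMax {g g' : ℝ → ℝ} {x d : ℝ} (hm : IsLocalMax g x)
    (hg : ∀ᶠ t in 𝓝 x, HasDerivAt g (g' t) t) (hg' : HasDerivAt g' d x) : d ≤ 0 := by
  by_contra! hd
  have h1 : deriv g =ᶠ[𝓝 x] g' := hg.mono fun t ht => ht.deriv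
  have h2 : HasDerivAt (deriv g) d x := hg'.congr_of_eventuallyEq h1
  -- With a positive second derivative the point would also be a local minimum, so g would be
  -- locally constant and the second derivative would vanish.
  have h3 : IsLocalMin g x := isLocalMin_of_deriv_deriv_pos (by rw [h2.deriv]; exact hd)
    hm.deriv_eq_zero hg.self_of_nhds.continuousAt
  have h4 : g =ᶠ[𝓝 x] fun _ => g x := by
    filter_upwards [hm, h3] with t ht ht' using le_antisymm ht ht'
  have h5 : deriv g =ᶠ[𝓝 x] fun _ => 0 := by
    filter_upwards [h4.eventually_nhds] with t ht
    rw [Filter.EventuallyEq.deriv_eq ht]; simp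
  have h6 := h2.unique ((hasDerivAt_const x (0 : ℝ)).congr_of_eventuallyEq h5)
  linarith

/-! ### The lifted curve -/

variable {γ : UnitAddCircle → Plane}

/-- The lift `ℝ → ℝ²` of the curve. -/
def lift (γ : UnitAddCircle → Plane) (x : ℝ) : Plane := γ (x : UnitAddCircle)

lemma velocity_coe (γ : UnitAddCircle → Plane) (x : ℝ) :
    velocity γ (x : UnitAddCircle) = deriv (lift γ) x := by
  have : (fun t : ℝ => γ ((x : UnitAddCircle) + (t : UnitAddCircle)))
      = fun t => lift γ (x + t) := by
    funext t; simp [lift]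
  rw [velocity, this, deriv_comp_const_add]; simp

lemma acceleration_coe (γ : UnitAddCircle → Plane) (x : ℝ) :
    acceleration γ (x : UnitAddCircle) = deriv (deriv (lift γ)) x := by
  have : (fun t : ℝ => γ ((x : UnitAddCircle) + (t : UnitAddCircle)))
      = fun t => lift γ (x + t) := by
    funext t; simp [lift]
  have h2 : deriv (fun t => lift γ (x + t)) = fun t => deriv (lift γ) (x + t) := by
    funext t; rw [deriv_comp_const_add]
  rw [acceleration, this, h2, deriv_comp_const_add]; simp

/-! ### Support lines and strict convexity. -/

namespace IsStronglyConvexTable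

variable (hγ : IsStronglyConvexTable γ)
include hγ

lemma contDiff_lift : ContDiff ℝ 2 (lift γ) := hγ.contDiff

lemma contDiff_deriv_lift : ContDiff ℝ 1 (deriv (lift γ)) := by
  have := (contDiff_succ_iff_deriv (n := 1)).1 (by simpa [one_add_one_eq_two] using hγ.contDiff_lift)
  exact this.2.2

lemma hasDerivAt_lift (x : ℝ) : HasDerivAt (lift γ) (velocity γ x) x := by
  rw [velocity_coe]
  exact (hγ.contDiff_lift.differentiable (by norm_num)).differentiableAt.hasDerivAt

lemma hasDerivAt_deriv_lift (x : ℝ) :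
    HasDerivAt (deriv (lift γ)) (acceleration γ x) x := by
  rw [acceleration_coe]
  exact (hγ.contDiff_deriv_lift.differentiable (by norm_num)).differentiableAt.hasDerivAt

lemma continuous : Continuous γ := by
  refine (QuotientAddGroup.isOpenQuotientMap_mk.isQuotientMap).continuous_iff.2 ?_
  exact hγ.contDiff.continuous

lemma velocity_ne_zero (θ : UnitAddCircle) : velocity γ θ ≠ 0 := by
  intro h
  have := hγ.curvature_ne_zero θ
  simp [h, det] at this

lemma norm_velocity_pos (θ : UnitAddCircle) : 0 < ‖velocity γ θ‖ :=
  norm_pos_iff.2 (hγ.velocity_ne_zero θ)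

lemma norm_unitTangent (θ : UnitAddCircle) : ‖unitTangent γ θ‖ = 1 := by
  rw [unitTangent, norm_smul, norm_inv, norm_norm,
    inv_mul_cancel₀ (hγ.norm_velocity_pos θ).ne']

/-- The tangent line at a boundary point supports the table, which lies on its left. -/
lemma exists_support (x : ℝ) : ∃ f : Plane →L[ℝ] ℝ, (∀ a ∈ table γ, f a < f (lift γ x)) ∧
    (∀ θ, f (γ θ) ≤ f (lift γ x)) ∧ ∃ k < 0, ∀ w, f w = k * det (velocity γ x) w := by
  have hmem : γ x ∈ frontier (table γ) := by rw [hγ.frontier_eq]; exact mem_range_self _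
  have hopen : IsOpen (table γ) := isOpen_interior
  have hne : (table γ).Nonempty := by
    by_contra h
    rw [not_nonempty_iff_eq_empty] at h
    rw [h] at hmem; simp at hmem
  have hnot : lift γ x ∉ table γ := fun h => by
    rw [hopen.frontier_eq] at hmem; exact hmem.2 h
  have hconv : Convex ℝ (table γ) := (convex_convexHull ℝ _).interior
  -- Along the curve f is maximal at x. The first-order condition puts the tangent in the kernel of
  -- f, so f is a multiple k of `det`; the second-order condition and the positive curvature give k
  -- ≤ 0.
  obtain ⟨f, hf⟩ := geometric_hahn_banach_open_point hconv hopen hnot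
  have hle : ∀ θ, f (γ θ) ≤ f (lift γ x) := by
    intro θ
    have h1 : γ θ ∈ closure (table γ) := by
      rw [table, (convex_convexHull ℝ _).closure_interior_eq_closure_of_nonempty_interior hne]
      exact subset_closure (subset_convexHull ℝ _ (mem_range_self θ))
    have h2 : closure (table γ) ⊆ {a | f a ≤ f (lift γ x)} :=
      closure_minimal (fun a ha => (hf a ha).le) (isClosed_le f.continuous continuous_const)
    exact h2 h1
  have hmax : IsLocalMax (fun t => f (lift γ t)) x :=
    Eventually.of_forall fun t => hle (t : UnitAddCircle)
  have hd : ∀ t : ℝ, HasDerivAt (fun t => f (lift γ t)) (f (deriv (lift γ) t)) t := fun t => by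
    rw [← velocity_coe]
    exact f.hasFDerivAt.comp_hasDerivAt t (hγ.hasDerivAt_lift t)
  have hd2 : HasDerivAt (fun t => f (deriv (lift γ) t)) (f (acceleration γ x)) x :=
    f.hasFDerivAt.comp_hasDerivAt x (hγ.hasDerivAt_deriv_lift x)
  have h0 : f (velocity γ x) = 0 := by
    rw [velocity_coe]; exact hmax.hasDerivAt_eq_zero (hd x)
  obtain ⟨k, hk⟩ := exists_eq_mul_det (hγ.velocity_ne_zero x) f h0
  refine ⟨f, hf, hle, k, lt_of_le_of_ne ?_ ?_, hk⟩
  · have h2 := deriv2_nonpos_of_isLocalMax hmax (Eventually.of_forall hd) hd2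
    rw [hk] at h2
    by_contra! h3
    have := mul_pos h3 (hγ.curvature_ne_zero x)
    linarith
  · rintro rfl
    obtain ⟨a, ha⟩ := hne
    have := hf a ha
    rw [hk, hk (lift γ x)] at this; simp at this

/-- Strict convexity: the curve lies strictly to the left of each of its tangent lines. -/
lemma det_velocity_pos {θ θ' : UnitAddCircle} (hne : θ' ≠ θ) :
    0 < det (velocity γ θ) (γ θ' - γ θ) := by
  induction θ using QuotientAddGroup.induction_on with | H x => ?_
  change 0 < det (velocity γ (x : UnitAddCircle)) (γ θ' - lift γ x)
  obtain ⟨f, hf, hle, k, hk, hfk⟩ := hγ.exists_support x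
  have hpos : ∀ θ'', 0 ≤ det (velocity γ (x : UnitAddCircle)) (γ θ'' - lift γ x) := fun θ'' => by
    have h1 := hle θ''
    have h2 := hfk (γ θ'' - lift γ x)
    rw [map_sub] at h2
    by_contra! h3
    have := mul_pos_of_neg_of_neg hk h3
    linarith
  refine lt_of_le_of_ne (hpos θ') fun h0 => ?_
  -- near `θ` there are no further zeros
  set h : ℝ → ℝ := fun t => detL (velocity γ (x : UnitAddCircle)) (lift γ t - lift γ x) with hh
  have hd : ∀ t : ℝ, HasDerivAt h (detL (velocity γ x) (deriv (lift γ) t)) t := fun t => by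
    rw [← velocity_coe]
    exact (detL _).hasFDerivAt.comp_hasDerivAt t ((hγ.hasDerivAt_lift t).sub_const _)
  have hd2 : HasDerivAt (fun t => detL (velocity γ x) (deriv (lift γ) t))
      (detL (velocity γ x) (acceleration γ x)) x :=
    (detL _).hasFDerivAt.comp_hasDerivAt x (hγ.hasDerivAt_deriv_lift x)
  -- As h is nonnegative, each of its zeros is critical. By the curvature, h' has a nonzero
  -- derivative at x, so the zeros of h cannot accumulate there.
  have hzero : ∀ t, h t = 0 → detL (velocity γ x) (deriv (lift γ) t) = 0 := fun t ht => by
    have hmin : IsLocalMin h t := Eventually.of_forall fun s => by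
      rw [ht, hh]; simp only [detL_apply]; exact hpos s
    exact hmin.hasDerivAt_eq_zero (hd t)
  have hev : ∀ᶠ t in 𝓝 x, t ≠ x → h t ≠ 0 := by
    have := hd2.eventually_ne (c := 0) (by
      rw [detL_apply]; exact (hγ.curvature_ne_zero x).ne')
    rw [eventually_nhdsWithin_iff] at this
    exact this.mono fun t ht htx h0 => ht htx (hzero t h0)
  have hev' : ∀ᶠ θ'' in 𝓝 (x : UnitAddCircle), θ'' ≠ (x : UnitAddCircle) →
      det (velocity γ (x : UnitAddCircle)) (γ θ'' - lift γ x) ≠ 0 := by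
    have h1 : 𝓝 (x : UnitAddCircle) = map (fun t : ℝ => (t : UnitAddCircle)) (𝓝 x) :=
      QuotientAddGroup.nhds_eq _ x
    rw [h1, eventually_map]
    refine hev.mono fun t ht htx => ?_
    have := ht (fun h => htx (by rw [h]))
    rw [hh] at this
    simp only [detL_apply] at this
    exact this
  -- the segment from `γ θ` to `γ θ'` lies on the boundary
  have hemb := hγ.continuous.isClosedEmbedding hγ.injective
  have hseg : ∀ s ∈ Icc (0 : ℝ) 1, lift γ x + s • (γ θ' - lift γ x) ∈ range γ := fun s hs => by
    rw [← hγ.frontier_eq, table, frontier, interior_interior]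
    have hC : lift γ x + s • (γ θ' - lift γ x) ∈ convexHull ℝ (range γ) :=
      (convex_convexHull ℝ _).add_smul_sub_mem (subset_convexHull ℝ _ (mem_range_self _))
        (subset_convexHull ℝ _ (mem_range_self _)) hs
    have hint : (interior (convexHull ℝ (range γ))).Nonempty := by
      by_contra h
      rw [not_nonempty_iff_eq_empty] at h
      have := hγ.frontier_eq
      rw [table, h, frontier_empty] at this
      exact (range_nonempty γ).ne_empty this.symm
    refine ⟨?_, fun hin => ?_⟩
    · rw [(convex_convexHull ℝ _).closure_interior_eq_closure_of_nonempty_interior hint]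
      exact subset_closure hC
    · have := hf _ hin
      rw [map_add, map_smul, hfk (γ θ' - lift γ x), ← h0] at this
      simp at this
  -- The point at proportion s of the segment has parameter g s. Since γ is an embedding, g s tends
  -- to θ as s decreases to 0, which yields zeros of h accumulating at θ.
  choose! g hg using hseg
  have hpt : Tendsto (fun s : ℝ => lift γ x + s • (γ θ' - lift γ x)) (𝓝[Ioo 0 1] 0)
      (𝓝 (γ (x : UnitAddCircle))) := by
    have : Continuous fun s : ℝ => lift γ x + s • (γ θ' - lift γ x) := by fun_prop
    have h2 := this.tendsto 0
    simp only [zero_smul, add_zero] at h2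
    exact h2.mono_left nhdsWithin_le_nhds
  have hgt : Tendsto g (𝓝[Ioo 0 1] 0) (𝓝 (x : UnitAddCircle)) := by
    rw [hemb.isInducing.tendsto_nhds_iff]
    refine hpt.congr' ?_
    filter_upwards [self_mem_nhdsWithin] with s hs
    exact (hg s ⟨hs.1.le, hs.2.le⟩).symm
  have : (𝓝[Ioo (0 : ℝ) 1] 0).NeBot := by
    rw [nhdsWithin_Ioo_eq_nhdsGT one_pos]; infer_instance
  obtain ⟨s, hs1, hs2⟩ := ((hgt.eventually hev').and self_mem_nhdsWithin).exists
  have hgs := hg s ⟨hs2.1.le, hs2.2.le⟩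
  have hne' : γ θ' - lift γ x ≠ 0 := sub_ne_zero.2 fun h => hne (hγ.injective h)
  refine hs1 (fun h => ?_) ?_
  · rw [h] at hgs
    have : s • (γ θ' - lift γ x) = 0 := by
      have h3 : lift γ x + 0 = lift γ x + s • (γ θ' - lift γ x) := by rw [add_zero]; exact hgs
      exact (add_left_cancel h3).symm
    exact (smul_ne_zero hs2.1.ne' hne') this
  · rw [hgs, add_sub_cancel_left, ← detL_apply, map_smul, detL_apply, ← h0, smul_zero]

end IsStronglyConvexTable

end Billiard

namespace Billiard

variable {γ : UnitAddCircle → Plane}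

/-! ### Phase points given by chords -/

/-- The unit vector from `γ θ` towards `γ θ'`. -/
def unitChord (γ : UnitAddCircle → Plane) (θ θ' : UnitAddCircle) : Plane :=
  ‖γ θ' - γ θ‖⁻¹ • (γ θ' - γ θ)

lemma unitChord_symm (θ θ' : UnitAddCircle) : unitChord γ θ' θ = -unitChord γ θ θ' := by
  rw [unitChord, unitChord, norm_sub_rev, ← smul_neg, neg_sub]

/-- The phase point at `θ` whose ray passes through `γ θ'`. -/
def phase (γ : UnitAddCircle → Plane) (θ θ' : UnitAddCircle) : Annulus :=
  (θ, ⟨Real.arcsin (inner ℝ (unitChord γ θ θ') (unitTangent γ θ)), Real.arcsin_mem_Icc _⟩)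

/-- The reflection `(θ, φ) ↦ (θ, -φ)`, which reverses time. -/
def flip (x : Annulus) : Annulus :=
  (x.1, ⟨-x.2, by have := x.2.2; constructor <;> linarith [this.1, this.2]⟩)

@[simp] lemma flip_flip (x : Annulus) : flip (flip x) = x := by
  ext <;> simp [flip]

@[simp] lemma flip_fst (x : Annulus) : (flip x).1 = x.1 := rfl

@[simp] lemma flip_snd (x : Annulus) : ((flip x).2 : ℝ) = -x.2 := rfl

lemma flip_injective : Function.Injective flip :=
  Function.LeftInverse.injective (g := flip) flip_flip

@[simp] lemma phase_fst (θ θ' : UnitAddCircle) : (phase γ θ θ').1 = θ := rfl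

lemma annulus_ext {x y : Annulus} (h1 : x.1 = y.1) (h2 : (x.2 : ℝ) = y.2) : x = y :=
  Prod.ext h1 (Subtype.ext h2)

lemma det_sq_add_inner_sq (a b : Plane) : det a b ^ 2 + inner ℝ a b ^ 2 = ‖a‖ ^ 2 * ‖b‖ ^ 2 := by
  rw [norm_sq_eq, norm_sq_eq, inner_eq, det]; ring

lemma det_smul_smul (s t : ℝ) (a b : Plane) : det (s • a) (t • b) = s * t * det a b := by
  simp [det]; ring

lemma det_smul_right (t : ℝ) (a b : Plane) : det a (t • b) = t * det a b := by
  simp [det]; ring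

lemma inner_direction_unitTangent_aux {τ : Plane} (hτ : ‖τ‖ = 1) (s c : ℝ) :
    inner ℝ (s • τ + c • rot τ) τ = s ∧ det τ (s • τ + c • rot τ) = c := by
  have h := norm_sq_eq τ
  rw [hτ] at h
  constructor
  · simp only [inner_eq, PiLp.add_apply, PiLp.smul_apply, smul_eq_mul, rot_zero, rot_one]
    linear_combination (-s) * h
  · simp only [det, PiLp.add_apply, PiLp.smul_apply, smul_eq_mul, rot_zero, rot_one]
    linear_combination (-c) * h

lemma eq_inner_smul_add_det_smul {τ : Plane} (hτ : ‖τ‖ = 1) (u : Plane) :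
    u = (inner ℝ u τ : ℝ) • τ + det τ u • rot τ := by
  have h := norm_sq_eq τ
  rw [hτ] at h
  apply plane_ext <;>
    simp only [inner_eq, det, PiLp.add_apply, PiLp.smul_apply, smul_eq_mul, rot_zero, rot_one]
  · linear_combination (u 0) * h
  · linear_combination (u 1) * h

lemma iter_zero (x : Annulus) : iter γ 0 x = x := rfl

lemma iter_one (x : Annulus) : iter γ 1 x = billiardMap γ x := rfl

/-! ### The billiard map as a reversible bijection acting on chords. -/

namespace IsStronglyConvexTable

variable (hγ : IsStronglyConvexTable γ)
include hγ

lemma norm_sub_pos {θ θ' : UnitAddCircle} (hne : θ' ≠ θ) : 0 < ‖γ θ' - γ θ‖ :=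
  norm_pos_iff.2 (sub_ne_zero.2 fun h => hne (hγ.injective h))

lemma norm_unitChord {θ θ' : UnitAddCircle} (hne : θ' ≠ θ) : ‖unitChord γ θ θ'‖ = 1 := by
  rw [unitChord, norm_smul, norm_inv, norm_norm, inv_mul_cancel₀ (hγ.norm_sub_pos hne).ne']

lemma det_unitTangent_unitChord_pos {θ θ' : UnitAddCircle} (hne : θ' ≠ θ) :
    0 < det (unitTangent γ θ) (unitChord γ θ θ') := by
  rw [unitTangent, unitChord, det_smul_smul]
  have := hγ.norm_velocity_pos θ
  have := hγ.norm_sub_pos hne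
  have := hγ.det_velocity_pos hne
  positivity

lemma det_sq_eq {θ θ' : UnitAddCircle} (hne : θ' ≠ θ) :
    det (unitTangent γ θ) (unitChord γ θ θ') ^ 2
      = 1 - inner ℝ (unitChord γ θ θ') (unitTangent γ θ) ^ 2 := by
  have := det_sq_add_inner_sq (unitTangent γ θ) (unitChord γ θ θ')
  rw [hγ.norm_unitTangent, hγ.norm_unitChord hne, real_inner_comm] at this
  linarith

lemma inner_sq_lt_one {θ θ' : UnitAddCircle} (hne : θ' ≠ θ) :
    (inner ℝ (unitChord γ θ θ') (unitTangent γ θ) : ℝ) ^ 2 < 1 := by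
  have := hγ.det_sq_eq hne
  have := pow_pos (hγ.det_unitTangent_unitChord_pos hne) 2
  linarith

lemma inner_mem_Ioo {θ θ' : UnitAddCircle} (hne : θ' ≠ θ) :
    (inner ℝ (unitChord γ θ θ') (unitTangent γ θ) : ℝ) ∈ Ioo (-1) 1 := by
  exact abs_lt.1 ((sq_lt_one_iff_abs_lt_one _).1 (hγ.inner_sq_lt_one hne))

lemma sin_phase {θ θ' : UnitAddCircle} (hne : θ' ≠ θ) :
    Real.sin (phase γ θ θ').2 = inner ℝ (unitChord γ θ θ') (unitTangent γ θ) :=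
  Real.sin_arcsin (hγ.inner_mem_Ioo hne).1.le (hγ.inner_mem_Ioo hne).2.le

lemma direction_phase {θ θ' : UnitAddCircle} (hne : θ' ≠ θ) :
    direction γ (phase γ θ θ') = unitChord γ θ θ' := by
  have hcos : Real.cos (phase γ θ θ').2 = det (unitTangent γ θ) (unitChord γ θ θ') := by
    change Real.cos (Real.arcsin _) = _
    rw [Real.cos_arcsin, ← hγ.det_sq_eq hne, Real.sqrt_sq (hγ.det_unitTangent_unitChord_pos hne).le]
  rw [direction, hγ.sin_phase hne, hcos]
  exact (eq_inner_smul_add_det_smul (hγ.norm_unitTangent θ) _).symm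

lemma abs_phase_lt {θ θ' : UnitAddCircle} (hne : θ' ≠ θ) :
    |((phase γ θ θ').2 : ℝ)| < Real.pi / 2 := by
  have h := hγ.inner_mem_Ioo hne
  exact abs_lt.2 ⟨Real.neg_pi_div_two_lt_arcsin.2 h.1, Real.arcsin_lt_pi_div_two.2 h.2⟩

lemma hits_phase {θ θ' : UnitAddCircle} (hne : θ' ≠ θ) : Hits γ (phase γ θ θ') θ' := by
  refine ⟨hne, ‖γ θ' - γ θ‖, hγ.norm_sub_pos hne, ?_⟩
  rw [hγ.direction_phase hne, unitChord, smul_smul, mul_inv_cancel₀ (hγ.norm_sub_pos hne).ne',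
    one_smul, phase_fst, add_sub_cancel]

lemma norm_direction (x : Annulus) : ‖direction γ x‖ = 1 := by
  have h := norm_sq_eq (unitTangent γ x.1)
  rw [hγ.norm_unitTangent] at h
  have : ‖direction γ x‖ ^ 2 = 1 := by
    rw [norm_sq_eq, direction, inwardNormal]
    simp only [PiLp.add_apply, PiLp.smul_apply, smul_eq_mul, rot_zero, rot_one]
    have h2 := Real.sin_sq_add_cos_sq (x.2 : ℝ)
    linear_combination h2 - (Real.sin x.2 ^ 2 + Real.cos x.2 ^ 2) * h
  have h0 := norm_nonneg (direction γ x)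
  nlinarith

lemma eq_phase_of_hits {x : Annulus} {θ' : UnitAddCircle} (h : Hits γ x θ') :
    x = phase γ x.1 θ' := by
  obtain ⟨hne, t, ht, hx⟩ := h
  have hsub : γ θ' - γ x.1 = t • direction γ x := by rw [hx, add_sub_cancel_left]
  have hu : unitChord γ x.1 θ' = direction γ x := by
    rw [unitChord, hsub, norm_smul, hγ.norm_direction, mul_one, Real.norm_of_nonneg ht.le, smul_smul,
      inv_mul_cancel₀ ht.ne', one_smul]
  refine annulus_ext rfl ?_
  change (x.2 : ℝ) = Real.arcsin _
  rw [hu, direction, inwardNormal, (inner_direction_unitTangent_aux (hγ.norm_unitTangent _) _ _).1,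
    Real.arcsin_sin x.2.2.1 x.2.2.2]

/-- Two hits would give three collinear points of the curve. Seen from the middle one, the other two
lie in opposite directions, whereas strict convexity puts both strictly to the left of its tangent.
-/
lemma hits_unique {x : Annulus} {θ₁ θ₂ : UnitAddCircle} (h₁ : Hits γ x θ₁) (h₂ : Hits γ x θ₂) :
    θ₁ = θ₂ := by
  have key : ∀ {θ₁ θ₂ : UnitAddCircle} {t₁ t₂ : ℝ}, θ₁ ≠ x.1 → 0 < t₁ → t₁ < t₂ →
      γ θ₁ = γ x.1 + t₁ • direction γ x → γ θ₂ = γ x.1 + t₂ • direction γ x → False := by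
    intro θ₁ θ₂ t₁ t₂ hne ht₁ hlt e₁ e₂
    have hne' : θ₂ ≠ θ₁ := by
      rintro rfl
      have h3 : (t₂ - t₁) • direction γ x = 0 := by
        rw [sub_smul, sub_eq_zero]; exact add_left_cancel (e₂.symm.trans e₁)
      have h4 : ‖direction γ x‖ = 0 := by
        rcases smul_eq_zero.1 h3 with h | h
        · linarith
        · rw [h, norm_zero]
      rw [hγ.norm_direction] at h4
      exact one_ne_zero h4
    have h1 := hγ.det_velocity_pos hne.symm
    have h2 := hγ.det_velocity_pos hne'
    have e3 : γ x.1 - γ θ₁ = (-t₁) • direction γ x := by rw [e₁]; module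
    have e4 : γ θ₂ - γ θ₁ = (t₂ - t₁) • direction γ x := by rw [e₁, e₂]; module
    rw [e3, det_smul_right] at h1
    rw [e4, det_smul_right] at h2
    have : 0 < det (velocity γ θ₁) (direction γ x) := by
      by_contra! h
      nlinarith
    nlinarith
  obtain ⟨n₁, t₁, p₁, e₁⟩ := h₁
  obtain ⟨n₂, t₂, p₂, e₂⟩ := h₂
  rcases lt_trichotomy t₁ t₂ with h | h | h
  · exact (key n₁ p₁ h e₁ e₂).elim
  · subst h; exact hγ.injective (e₁.trans e₂.symm)
  · exact (key n₂ p₂ h e₂ e₁).elim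

lemma billiardMap_of_hits {x : Annulus} {θ' : UnitAddCircle} (h : Hits γ x θ') :
    billiardMap γ x = (θ', ⟨Real.arcsin (inner ℝ (direction γ x) (unitTangent γ θ')),
      Real.arcsin_mem_Icc _⟩) := by
  have hex : ∃ θ', Hits γ x θ' := ⟨θ', h⟩
  have : hex.choose = θ' := hγ.hits_unique hex.choose_spec h
  rw [billiardMap, dif_pos hex]
  refine annulus_ext this ?_
  simp only [this]

lemma billiardMap_phase {θ θ' : UnitAddCircle} (hne : θ' ≠ θ) :
    billiardMap γ (phase γ θ θ') = flip (phase γ θ' θ) := by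
  rw [hγ.billiardMap_of_hits (hγ.hits_phase hne), hγ.direction_phase hne]
  refine annulus_ext rfl ?_
  change Real.arcsin _ = -Real.arcsin _
  rw [← Real.arcsin_neg, unitChord_symm θ' θ, inner_neg_left]

lemma not_hits_of_abs_eq {x : Annulus} (hx : |(x.2 : ℝ)| = Real.pi / 2) (θ' : UnitAddCircle) :
    ¬ Hits γ x θ' := fun h => by
  have h2 := hγ.abs_phase_lt h.1
  rw [← hγ.eq_phase_of_hits h] at h2
  exact h2.ne hx

/-- Intermediate value theorem: while the far end of the chord runs once around the curve, the
tangential component F of the unit chord passes continuously from 1 to -1, and so takes the value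
sin φ. -/
lemma exists_hits {x : Annulus} (hx : |(x.2 : ℝ)| < Real.pi / 2) : ∃ θ', Hits γ x θ' := by
  obtain ⟨θ, φ, hφ⟩ := x
  induction θ using QuotientAddGroup.induction_on with | H s => ?_
  change |φ| < _ at hx
  rw [abs_lt] at hx
  set τ := unitTangent γ (s : UnitAddCircle) with hτ
  have hcoe : ∀ t ∈ Ioo (0 : ℝ) 1, ((s + t : ℝ) : UnitAddCircle) ≠ (s : UnitAddCircle) := by
    intro t ht h
    have := (AddCircle.coe_eq_coe_iff_of_mem_Ico (p := (1 : ℝ)) (a := s) (x := s + t) (y := s)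
      ⟨by linarith [ht.1], by linarith [ht.2]⟩ ⟨le_rfl, by linarith⟩).1 h
    linarith [ht.1]
  set F : ℝ → ℝ := fun t => inner ℝ (unitChord γ s ((s + t : ℝ) : UnitAddCircle)) τ with hF
  have hlift : Continuous (lift γ) := hγ.contDiff_lift.continuous
  have hFc : ContinuousOn F (Ioo 0 1) := by
    have h1 : ContinuousOn (fun t => ‖lift γ (s + t) - lift γ s‖⁻¹ • (lift γ (s + t) - lift γ s))
        (Ioo 0 1) := by
      have h2 : Continuous fun t => lift γ (s + t) - lift γ s := by fun_prop
      refine (h2.norm.continuousOn.inv₀ fun t ht => ?_).smul h2.continuousOn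
      exact (hγ.norm_sub_pos (hcoe t ht)).ne'
    exact h1.inner continuousOn_const
  -- the chords tend to the tangent line at both ends
  have hslope : Tendsto (fun t => t⁻¹ • (lift γ (s + t) - lift γ s)) (𝓝[≠] 0)
      (𝓝 (velocity γ s)) := hasDerivAt_iff_tendsto_slope_zero.1 (hγ.hasDerivAt_lift s)
  have hunit : Tendsto (fun t => ‖t⁻¹ • (lift γ (s + t) - lift γ s)‖⁻¹ •
      (t⁻¹ • (lift γ (s + t) - lift γ s))) (𝓝[≠] 0) (𝓝 τ) :=
    ((hslope.norm).inv₀ (hγ.norm_velocity_pos _).ne').smul hslope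
  have hinner : Tendsto (fun t => inner ℝ (‖t⁻¹ • (lift γ (s + t) - lift γ s)‖⁻¹ •
      (t⁻¹ • (lift γ (s + t) - lift γ s))) τ) (𝓝[≠] 0) (𝓝 1) := by
    have := Filter.Tendsto.inner (𝕜 := ℝ) hunit (tendsto_const_nhds (x := τ))
    rwa [real_inner_self_eq_norm_sq, hγ.norm_unitTangent, one_pow] at this
  have h0 : Tendsto F (𝓝[>] 0) (𝓝 1) := by
    refine (hinner.mono_left (nhdsWithin_mono _ fun t ht => ne_of_gt ht)).congr' ?_
    filter_upwards [self_mem_nhdsWithin] with t ht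
    have ht : (0 : ℝ) < t := ht
    simp only [hF, unitChord, norm_smul, norm_inv, Real.norm_of_nonneg ht.le, mul_inv, inv_inv,
      smul_smul]
    rw [mul_right_comm, mul_inv_cancel₀ ht.ne', one_mul]; rfl
  -- By periodicity the chord at t is the one at t - 1 < 0; its difference quotient tends to the
  -- velocity, and the negative sign of t - 1 reverses the direction.
  have h1 : Tendsto F (𝓝[<] 1) (𝓝 (-1)) := by
    have hsub : Tendsto (fun t : ℝ => t - 1) (𝓝[<] 1) (𝓝[≠] 0) := by
      refine tendsto_nhdsWithin_iff.2 ⟨?_, ?_⟩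
      · have : Tendsto (fun t : ℝ => t - 1) (𝓝 1) (𝓝 (1 - 1)) := by
          exact (continuous_id.sub continuous_const).tendsto 1
        rw [sub_self] at this
        exact this.mono_left nhdsWithin_le_nhds
      · filter_upwards [self_mem_nhdsWithin] with t ht
        exact sub_ne_zero.2 (ne_of_lt ht)
    refine (hinner.comp hsub).neg.congr' ?_
    filter_upwards [self_mem_nhdsWithin] with t ht
    have ht : t - 1 < (0 : ℝ) := sub_neg.2 ht
    have hper : lift γ (s + (t - 1)) = lift γ (s + t) := by
      have : s + t = s + (t - 1) + 1 := by ring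
      rw [lift, lift, this, AddCircle.coe_add_period]
    simp only [Function.comp, hF, unitChord, norm_smul, norm_inv, Real.norm_of_nonpos ht.le,
      mul_inv, inv_inv, smul_smul, hper]
    rw [mul_right_comm, neg_mul, mul_inv_cancel₀ ht.ne, neg_one_mul, neg_smul, inner_neg_left,
      neg_neg]; rfl
  have hlo : -1 < Real.sin φ := by
    rw [← Real.sin_pi_div_two, ← Real.sin_neg]
    exact Real.sin_lt_sin_of_lt_of_le_pi_div_two le_rfl hx.2.le hx.1
  have hhi : Real.sin φ < 1 := by
    rw [← Real.sin_pi_div_two]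
    exact Real.sin_lt_sin_of_lt_of_le_pi_div_two hx.1.le le_rfl hx.2
  have e0 := (h0.eventually (lt_mem_nhds hhi)).and (Ioo_mem_nhdsGT (zero_lt_one' ℝ))
  have e1 := (h1.eventually (gt_mem_nhds hlo)).and (Ioo_mem_nhdsLT (zero_lt_one' ℝ))
  obtain ⟨a, ha, ha'⟩ := e0.exists
  obtain ⟨b, hb, hb'⟩ := e1.exists
  obtain ⟨t, ht, htφ⟩ : Real.sin φ ∈ F '' Ioo 0 1 :=
    (isPreconnected_Ioo (a := (0 : ℝ)) (b := 1)).intermediate_value hb' ha' hFc ⟨hb.le, ha.le⟩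
  refine ⟨((s + t : ℝ) : UnitAddCircle), ?_⟩
  have hph : ((s : UnitAddCircle), (⟨φ, hφ⟩ : Icc (-(Real.pi / 2)) (Real.pi / 2)))
      = phase γ s ((s + t : ℝ) : UnitAddCircle) := by
    refine annulus_ext rfl ?_
    change φ = Real.arcsin (F t)
    rw [htφ, Real.arcsin_sin hx.1.le hx.2.le]
  have := hγ.hits_phase (hcoe t ht)
  rwa [← hph] at this

/-- Every phase point is either a fixed boundary point or given by a chord. -/
lemma boundary_or_phase (x : Annulus) : |(x.2 : ℝ)| = Real.pi / 2 ∨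
    ∃ θ', θ' ≠ x.1 ∧ x = phase γ x.1 θ' := by
  have hx : |(x.2 : ℝ)| ≤ Real.pi / 2 := abs_le.2 x.2.2
  rcases hx.eq_or_lt with h | h
  · exact Or.inl h
  · obtain ⟨θ', h'⟩ := hγ.exists_hits h
    exact Or.inr ⟨θ', h'.1, hγ.eq_phase_of_hits h'⟩

lemma billiardMap_of_abs_eq {x : Annulus} (hx : |(x.2 : ℝ)| = Real.pi / 2) :
    billiardMap γ x = x := by
  rw [billiardMap, dif_neg]
  rintro ⟨θ', h⟩
  exact hγ.not_hits_of_abs_eq hx θ' h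

/-- A chord run backwards is again a chord: the map followed by `flip` exchanges the two ends of a
chord, hence is an involution. This provides the inverse of the billiard map. -/
lemma flip_billiardMap_flip_billiardMap (x : Annulus) :
    flip (billiardMap γ (flip (billiardMap γ x))) = x := by
  rcases hγ.boundary_or_phase x with h | ⟨θ', hne, h⟩
  · rw [hγ.billiardMap_of_abs_eq h, hγ.billiardMap_of_abs_eq (x := flip x) (by simpa using h),
      flip_flip]
  · rw [h, hγ.billiardMap_phase hne, flip_flip, hγ.billiardMap_phase hne.symm, flip_flip]

/-- The billiard map as a permutation of the annulus. -/
def perm : Equiv.Perm Annulus where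
  toFun := billiardMap γ
  invFun x := flip (billiardMap γ (flip x))
  left_inv := hγ.flip_billiardMap_flip_billiardMap
  right_inv x := flip_injective (hγ.flip_billiardMap_flip_billiardMap (flip x))

lemma iter_eq (n : ℤ) (x : Annulus) : iter γ n x = (hγ.perm ^ n) x := by
  -- `invFun` is only a chosen left inverse; bijectivity identifies it with the true one, after
  -- which `iter` obeys the laws of integer powers.
  have hinv : Function.invFun (billiardMap γ) = hγ.perm.symm := by
    have h := Function.leftInverse_invFun hγ.perm.injective
    funext y
    obtain ⟨z, rfl⟩ := hγ.perm.surjective y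
    rw [Equiv.symm_apply_apply]
    exact h z
  cases n with
  | ofNat n =>
    change (billiardMap γ)^[n] x = _
    rw [Int.ofNat_eq_natCast, zpow_natCast, Equiv.Perm.coe_pow]; rfl
  | negSucc n =>
    change (Function.invFun (billiardMap γ))^[n + 1] x = _
    rw [zpow_negSucc, hinv, ← inv_pow, Equiv.Perm.coe_pow]; rfl

lemma iter_add (m n : ℤ) (x : Annulus) : iter γ (m + n) x = iter γ m (iter γ n x) := by
  rw [hγ.iter_eq, hγ.iter_eq, hγ.iter_eq, zpow_add, Equiv.Perm.mul_apply]

lemma iter_succ (n : ℤ) (x : Annulus) : iter γ (n + 1) x = billiardMap γ (iter γ n x) := by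
  rw [add_comm, hγ.iter_add, iter_one]

lemma iter_injective (n : ℤ) : Function.Injective (iter γ n) := fun x y h => by
  rw [hγ.iter_eq, hγ.iter_eq] at h
  exact (hγ.perm ^ n).injective h

/-- The reflection `flip` conjugates the billiard map to its inverse. -/
lemma iter_flip (n : ℤ) (x : Annulus) : iter γ n (flip x) = flip (iter γ (-n) x) := by
  have hinv : ∀ x, iter γ (-1) x = flip (billiardMap γ (flip x)) := fun x => by
    rw [hγ.iter_eq]; rfl
  induction n using Int.induction_on with
  | zero => simp [iter_zero]
  | succ n ih =>
    rw [hγ.iter_succ, ih, neg_add_rev, hγ.iter_add (-1), hinv, flip_flip]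
  | pred n ih =>
    rw [sub_eq_neg_add, hγ.iter_add (-1), ih, hinv, flip_flip, neg_add, neg_neg, neg_neg, add_comm,
      hγ.iter_succ]

end IsStronglyConvexTable

end Billiard

namespace Billiard

variable {γ : UnitAddCircle → Plane}

/-! ### The generating function -/

/-- The derivative of `chord γ x y` with respect to `x`. -/
def chordDeriv (γ : UnitAddCircle → Plane) (x y : ℝ) : ℝ :=
  inner ℝ (deriv (lift γ) x) (lift γ x - lift γ y) / ‖lift γ x - lift γ y‖

/-- The derivative of `chordDeriv γ x y` with respect to `x`. -/
def chordDeriv₁ (γ : UnitAddCircle → Plane) (x y : ℝ) : ℝ := deriv (fun s => chordDeriv γ s y) x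

/-- The derivative of `chordDeriv γ x y` with respect to `y`. -/
def chordDeriv₂ (γ : UnitAddCircle → Plane) (x y : ℝ) : ℝ := deriv (fun s => chordDeriv γ x s) y

/-- The second coordinate of the phase point at `x` whose ray passes through `γ y`. -/
def angle (γ : UnitAddCircle → Plane) (x y : ℝ) : ℝ :=
  Real.arcsin (-chordDeriv γ x y / ‖deriv (lift γ) x‖)

lemma coe_add_intCast (x : ℝ) (m : ℤ) : ((x + m : ℝ) : UnitAddCircle) = x := by
  rw [AddCircle.coe_add, add_eq_left, AddCircle.coe_eq_zero_iff]
  exact ⟨m, by simp⟩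

lemma coe_eq_coe_iff (x y : ℝ) : (x : UnitAddCircle) = y ↔ ∃ m : ℤ, x = y + m := by
  rw [← sub_eq_zero, ← AddCircle.coe_sub, AddCircle.coe_eq_zero_iff]
  simp only [zsmul_eq_mul, mul_one]
  exact exists_congr fun m => ⟨fun h => by linarith, fun h => by linarith⟩

lemma lift_add_intCast (x : ℝ) (m : ℤ) : lift γ (x + m) = lift γ x := by
  rw [lift, lift, coe_add_intCast]

lemma deriv_lift_add_intCast (x : ℝ) (m : ℤ) : deriv (lift γ) (x + m) = deriv (lift γ) x := by
  rw [← velocity_coe, ← velocity_coe, coe_add_intCast]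

lemma chordDeriv_add_intCast (x y : ℝ) (m n : ℤ) :
    chordDeriv γ (x + m) (y + n) = chordDeriv γ x y := by
  simp only [chordDeriv, lift_add_intCast, deriv_lift_add_intCast]

lemma angle_add_intCast (x y : ℝ) (m n : ℤ) : angle γ (x + m) (y + n) = angle γ x y := by
  simp only [angle, chordDeriv_add_intCast, deriv_lift_add_intCast]

lemma hasDerivAt_norm {f : ℝ → Plane} {f' : Plane} {x : ℝ} (hf : HasDerivAt f f' x)
    (h0 : f x ≠ 0) : HasDerivAt (fun t => ‖f t‖) (inner ℝ (f x) f' / ‖f x‖) x := by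
  have h1 := hf.norm_sq.sqrt (pow_ne_zero 2 (norm_ne_zero_iff.2 h0))
  simp only [Real.sqrt_sq (norm_nonneg _)] at h1
  convert h1 using 1
  rw [mul_div_mul_left _ _ two_ne_zero]

/-- The linear form `(x, y) ↦ a x + b y`. -/
def linForm (a b : ℝ) : ℝ × ℝ →L[ℝ] ℝ :=
  a • ContinuousLinearMap.fst ℝ ℝ ℝ + b • ContinuousLinearMap.snd ℝ ℝ ℝ

@[simp] lemma linForm_apply (a b : ℝ) (z : ℝ × ℝ) : linForm a b z = a * z.1 + b * z.2 := by
  simp [linForm]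

/-- Strictness is what later gives two-point estimates on boxes, Lipschitz bounds and the inverse
function theorem. -/
lemma hasStrictFDerivAt_of_contDiffAt {f : ℝ × ℝ → ℝ} {x y a b : ℝ}
    (hf : ContDiffAt ℝ 1 f (x, y)) (ha : HasDerivAt (fun s => f (s, y)) a x)
    (hb : HasDerivAt (fun s => f (x, s)) b y) : HasStrictFDerivAt f (linForm a b) (x, y) := by
  have h := hf.hasStrictFDerivAt one_ne_zero
  set L := fderiv ℝ f (x, y)
  have h1 : HasDerivAt (fun s => f (s, y)) (L (1, 0)) x :=
    HasFDerivAt.comp_hasDerivAt x (l := f) h.hasFDerivAt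
      ((hasDerivAt_id x).prodMk (hasDerivAt_const x y))
  have h2 : HasDerivAt (fun s => f (x, s)) (L (0, 1)) y :=
    HasFDerivAt.comp_hasDerivAt y (l := f) h.hasFDerivAt
      ((hasDerivAt_const y x).prodMk (hasDerivAt_id y))
  have hL : linForm a b = L := by
    rw [ha.unique h1, hb.unique h2]
    ext <;> simp
  rw [hL]; exact h

namespace IsStronglyConvexTable

variable (hγ : IsStronglyConvexTable γ)
include hγ

lemma lift_sub_ne_zero {x y : ℝ} (hne : (y : UnitAddCircle) ≠ x) : lift γ x - lift γ y ≠ 0 :=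
  sub_ne_zero.2 fun h => hne (hγ.injective h).symm

lemma hasDerivAt_lift' (x : ℝ) : HasDerivAt (lift γ) (deriv (lift γ) x) x := by
  rw [← velocity_coe]; exact hγ.hasDerivAt_lift x

lemma deriv_lift_ne_zero (x : ℝ) : deriv (lift γ) x ≠ 0 := by
  rw [← velocity_coe]; exact hγ.velocity_ne_zero _

omit hγ in
lemma inner_unitChord_unitTangent (x y : ℝ) :
    inner ℝ (unitChord γ x y) (unitTangent γ x) = -chordDeriv γ x y / ‖deriv (lift γ) x‖ := by
  rw [unitChord, unitTangent, real_inner_smul_left, real_inner_smul_right, velocity_coe, chordDeriv,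
    real_inner_comm, ← neg_sub (γ (x : UnitAddCircle)), inner_neg_right, norm_neg]
  simp only [lift]
  ring

omit hγ in
lemma phase_snd (x y : ℝ) : ((phase γ x y).2 : ℝ) = angle γ x y := by
  rw [angle, ← inner_unitChord_unitTangent]; rfl

omit hγ in
lemma cover_angle (x y : ℝ) : cover (x, angle γ x y) = phase γ x y := by
  refine annulus_ext rfl ?_
  simp only [cover]
  rw [← phase_snd]
  simp

/-- The reflection law is the Euler-Lagrange equation. -/
lemma phase_eq_flip_iff {x y z : ℝ} (hx : (x : UnitAddCircle) ≠ y) (hz : (z : UnitAddCircle) ≠ y) :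
    flip (phase γ y x) = phase γ y z ↔ chordDeriv γ y x + chordDeriv γ y z = 0 := by
  have hn : ‖deriv (lift γ) y‖ ≠ 0 := norm_ne_zero_iff.2 (hγ.deriv_lift_ne_zero y)
  have h1 := hγ.inner_mem_Ioo hx
  have h2 := hγ.inner_mem_Ioo hz
  rw [inner_unitChord_unitTangent] at h1 h2
  have key : flip (phase γ y x) = phase γ y z ↔
      Real.arcsin (-(-chordDeriv γ y x / ‖deriv (lift γ) y‖))
        = Real.arcsin (-chordDeriv γ y z / ‖deriv (lift γ) y‖) := by
    rw [Real.arcsin_neg]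
    change _ ↔ -angle γ y x = angle γ y z
    rw [← phase_snd, ← phase_snd]
    exact ⟨fun h => by rw [← h]; rfl, fun h => annulus_ext rfl h⟩
  rw [key, Real.arcsin_inj (by linarith [h1.2]) (by linarith [h1.1]) h2.1.le h2.2.le]
  field_simp
  constructor <;> intro h <;> linarith

lemma billiardMap_phase_iff {x y z : ℝ} (hx : (x : UnitAddCircle) ≠ y)
    (hz : (z : UnitAddCircle) ≠ y) :
    billiardMap γ (phase γ x y) = phase γ y z ↔ chordDeriv γ y x + chordDeriv γ y z = 0 := by
  rw [hγ.billiardMap_phase hx.symm, hγ.phase_eq_flip_iff hx hz]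

lemma contDiffAt_chordDeriv {x y : ℝ} (hne : (y : UnitAddCircle) ≠ x) :
    ContDiffAt ℝ 1 (fun z : ℝ × ℝ => chordDeriv γ z.1 z.2) (x, y) := by
  have h1 : ContDiff ℝ 1 (lift γ) := hγ.contDiff_lift.of_le (by norm_num)
  have h2 : ContDiff ℝ 1 (fun z : ℝ × ℝ => lift γ z.1 - lift γ z.2) :=
    (h1.comp contDiff_fst).sub (h1.comp contDiff_snd)
  have h3 : ContDiff ℝ 1 (fun z : ℝ × ℝ => deriv (lift γ) z.1) :=
    hγ.contDiff_deriv_lift.comp contDiff_fst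
  have h0 := hγ.lift_sub_ne_zero hne
  exact (ContDiffAt.inner ℝ h3.contDiffAt h2.contDiffAt).div
    (ContDiffAt.norm ℝ h2.contDiffAt h0) (norm_ne_zero_iff.2 h0)

lemma hasDerivAt_chordDeriv₁ {x y : ℝ} (hne : (y : UnitAddCircle) ≠ x) :
    HasDerivAt (fun s => chordDeriv γ s y) (chordDeriv₁ γ x y) x := by
  have h := (hγ.contDiffAt_chordDeriv hne).differentiableAt one_ne_zero
  exact (DifferentiableAt.comp (f := fun s : ℝ => (s, y)) x h (by fun_prop)).hasDerivAt

lemma hasDerivAt_chordDeriv₂ {x y : ℝ} (hne : (y : UnitAddCircle) ≠ x) :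
    HasDerivAt (fun s => chordDeriv γ x s) (chordDeriv₂ γ x y) y := by
  have h := (hγ.contDiffAt_chordDeriv hne).differentiableAt one_ne_zero
  exact (DifferentiableAt.comp (f := fun s : ℝ => (x, s)) y h (by fun_prop)).hasDerivAt

lemma hasStrictFDerivAt_chordDeriv {x y : ℝ} (hne : (y : UnitAddCircle) ≠ x) :
    HasStrictFDerivAt (fun z : ℝ × ℝ => chordDeriv γ z.1 z.2)
      (linForm (chordDeriv₁ γ x y) (chordDeriv₂ γ x y)) (x, y) :=
  hasStrictFDerivAt_of_contDiffAt (hγ.contDiffAt_chordDeriv hne) (hγ.hasDerivAt_chordDeriv₁ hne)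
    (hγ.hasDerivAt_chordDeriv₂ hne)

/-- Written as a product of two determinants, the mixed derivative is visibly symmetric, and
positive by strict convexity. -/
lemma chordDeriv₂_eq {x y : ℝ} (hne : (y : UnitAddCircle) ≠ x) :
    chordDeriv₂ γ x y = det (deriv (lift γ) x) (lift γ y - lift γ x)
      * det (deriv (lift γ) y) (lift γ x - lift γ y) / ‖lift γ x - lift γ y‖ ^ 3 := by
  have h0 := hγ.lift_sub_ne_zero hne
  have hN : ‖lift γ x - lift γ y‖ ≠ 0 := norm_ne_zero_iff.2 h0
  have hd : HasDerivAt (fun s => lift γ x - lift γ s) (-deriv (lift γ) y) y :=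
    (hγ.hasDerivAt_lift' y).const_sub _
  have h1 : HasDerivAt (fun s => inner ℝ (deriv (lift γ) x) (lift γ x - lift γ s))
      (inner ℝ (deriv (lift γ) x) (-deriv (lift γ) y)) y := by
    have := HasDerivAt.inner ℝ (hasDerivAt_const y (deriv (lift γ) x)) hd
    simpa using this
  have h2 := (h1.div (hasDerivAt_norm hd h0) hN).unique (hγ.hasDerivAt_chordDeriv₂ hne)
  rw [← h2, div_eq_div_iff (pow_ne_zero 2 hN) (pow_ne_zero 3 hN)]
  have h3 := norm_sq_eq (lift γ x - lift γ y)
  generalize ‖lift γ x - lift γ y‖ = N at *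
  simp only [inner_eq, det, PiLp.sub_apply, PiLp.neg_apply] at *
  field_simp
  rw [h3]
  ring

lemma chordDeriv₂_symm {x y : ℝ} (hne : (y : UnitAddCircle) ≠ x) :
    chordDeriv₂ γ y x = chordDeriv₂ γ x y := by
  rw [hγ.chordDeriv₂_eq hne, hγ.chordDeriv₂_eq hne.symm, norm_sub_rev, mul_comm]

/-- The twist condition. -/
lemma chordDeriv₂_pos {x y : ℝ} (hne : (y : UnitAddCircle) ≠ x) : 0 < chordDeriv₂ γ x y := by
  rw [hγ.chordDeriv₂_eq hne, ← velocity_coe, ← velocity_coe]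
  exact div_pos (mul_pos (hγ.det_velocity_pos hne) (hγ.det_velocity_pos hne.symm))
    (pow_pos (norm_pos_iff.2 (hγ.lift_sub_ne_zero hne)) 3)

lemma hasDerivAt_chord {x y : ℝ → ℝ} {ξ η t : ℝ} (hx : HasDerivAt x ξ t) (hy : HasDerivAt y η t)
    (hne : (y t : UnitAddCircle) ≠ x t) : HasDerivAt (fun s => chord γ (x s) (y s))
      (chordDeriv γ (x t) (y t) * ξ + chordDeriv γ (y t) (x t) * η) t := by
  have h1 := ((hγ.hasDerivAt_lift' (x t)).scomp t hx).sub ((hγ.hasDerivAt_lift' (y t)).scomp t hy)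
  have h2 := hasDerivAt_norm h1 (hγ.lift_sub_ne_zero hne)
  refine HasDerivAt.congr_deriv (f := fun s => chord γ (x s) (y s)) h2 ?_
  simp only [chordDeriv, Pi.sub_apply, Function.comp]
  rw [norm_sub_rev (lift γ (y t))]
  simp only [inner_eq, PiLp.sub_apply, PiLp.smul_apply, smul_eq_mul]
  ring

omit hγ in
lemma chordDeriv₁_add_intCast (x y : ℝ) (m n : ℤ) :
    chordDeriv₁ γ (x + m) (y + n) = chordDeriv₁ γ x y := by
  have : (fun s => chordDeriv γ s (y + n)) = fun s => chordDeriv γ (s - m) y := by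
    funext s
    conv_lhs => rw [show s = s - m + m by ring, chordDeriv_add_intCast]
  rw [chordDeriv₁, this, deriv_comp_sub_const (f := fun s => chordDeriv γ s y), add_sub_cancel_right]
  rfl

omit hγ in
lemma chordDeriv₂_add_intCast (x y : ℝ) (m n : ℤ) :
    chordDeriv₂ γ (x + m) (y + n) = chordDeriv₂ γ x y := by
  have : (fun s => chordDeriv γ (x + m) s) = fun s => chordDeriv γ x (s - n) := by
    funext s
    conv_lhs => rw [show s = s - n + n by ring, chordDeriv_add_intCast]
  rw [chordDeriv₂, this, deriv_comp_sub_const (f := fun s => chordDeriv γ x s), add_sub_cancel_right]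
  rfl

/-- The angle of a chord is a `C¹` function of its end points. -/
lemma exists_hasStrictFDerivAt_angle {x y : ℝ} (hne : (y : UnitAddCircle) ≠ x) :
    ∃ a b : ℝ,
      HasStrictFDerivAt (fun z : ℝ × ℝ => angle γ z.1 z.2) (linForm a b) (x, y) := by
  have hn : ‖deriv (lift γ) x‖ ≠ 0 := norm_ne_zero_iff.2 (hγ.deriv_lift_ne_zero x)
  have hI := hγ.inner_mem_Ioo hne
  rw [inner_unitChord_unitTangent] at hI
  have h3 : ContDiff ℝ 1 (fun z : ℝ × ℝ => deriv (lift γ) z.1) :=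
    hγ.contDiff_deriv_lift.comp contDiff_fst
  have h4 : ContDiffAt ℝ 1 (fun z : ℝ × ℝ => -chordDeriv γ z.1 z.2 / ‖deriv (lift γ) z.1‖) (x, y) :=
    (hγ.contDiffAt_chordDeriv hne).neg.div
      (ContDiffAt.norm ℝ h3.contDiffAt (hγ.deriv_lift_ne_zero x)) hn
  have h5 : ContDiffAt ℝ 1 (fun z : ℝ × ℝ => angle γ z.1 z.2) (x, y) :=
    ContDiffAt.comp (x, y) (g := Real.arcsin)
      (Real.contDiffAt_arcsin hI.1.ne' hI.2.ne) h4
  have hb : DifferentiableAt ℝ (fun s => angle γ x s) y :=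
    DifferentiableAt.comp (f := fun s : ℝ => (x, s)) y (h5.differentiableAt one_ne_zero)
      (by fun_prop)
  have ha : DifferentiableAt ℝ (fun s => angle γ s y) x :=
    DifferentiableAt.comp (f := fun s : ℝ => (s, y)) x (h5.differentiableAt one_ne_zero)
      (by fun_prop)
  exact ⟨_, _, hasStrictFDerivAt_of_contDiffAt h5 ha.hasDerivAt hb.hasDerivAt⟩

end IsStronglyConvexTable

end Billiard

namespace Billiard

/-! ### Contracting second order recurrences -/

/-- The equation `g u v w = 0` determines `v` as a contracting monotone function of `u` and `w`, in
the box of size `s`. -/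
structure Contracts (g : ℝ → ℝ → ℝ → ℝ) (s : ℝ) : Prop where
  contract : ∀ u v w u' v' w', |u| ≤ s → |v| ≤ s → |w| ≤ s → |u'| ≤ s → |v'| ≤ s → |w'| ≤ s →
    g u v w = 0 → g u' v' w' = 0 → |v - v'| ≤ (1 - s) * max |u - u'| |w - w'|
  mono : ∀ u v w u' v' w', |u| ≤ s → |v| ≤ s → |w| ≤ s → |u'| ≤ s → |v'| ≤ s → |w'| ≤ s →
    u ≤ u' → v ≤ v' → w ≤ w' → v + s * g u v w ≤ v' + s * g u' v' w'
  top : ∀ r ∈ Icc 0 s, g r r r ≤ 0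
  bot : ∀ r ∈ Icc 0 s, 0 ≤ g (-r) (-r) (-r)

lemma Contracts.anti {g : ℝ → ℝ → ℝ → ℝ} {s s' : ℝ} (h : Contracts g s) (h0 : 0 < s')
    (hs : s' ≤ s) : Contracts g s' where
  contract u v w u' v' w' h1 h2 h3 h4 h5 h6 e e' := by
    refine (h.contract u v w u' v' w' (h1.trans hs) (h2.trans hs) (h3.trans hs) (h4.trans hs)
      (h5.trans hs) (h6.trans hs) e e').trans ?_
    exact mul_le_mul_of_nonneg_right (by linarith) (le_max_of_le_left (abs_nonneg _))
  mono u v w u' v' w' h1 h2 h3 h4 h5 h6 hu hv hw := by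
    have := h.mono u v w u' v' w' (h1.trans hs) (h2.trans hs) (h3.trans hs) (h4.trans hs)
      (h5.trans hs) (h6.trans hs) hu hv hw
    have hs0 : 0 < s := h0.trans_le hs
    -- If g increases there is nothing to compensate. If it decreases, a smaller multiple of g loses
    -- less than the multiple s, which the increase of v already outweighs.
    rcases le_total (g u v w) (g u' v' w') with hg | hg
    · have := mul_le_mul_of_nonneg_left hg h0.le
      linarith
    · have := mul_le_mul_of_nonneg_right hs (sub_nonneg.2 hg)
      linarith
  top r hr := h.top r ⟨hr.1, hr.2.trans hs⟩
  bot r hr := h.bot r ⟨hr.1, hr.2.trans hs⟩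

/-- A function with strictly diagonally dominant derivative contracts. -/
lemma exists_contracts {g : ℝ → ℝ → ℝ → ℝ} {A B C : ℝ} (hB : 0 < B) (hC : 0 < C)
    (hA : B + C < A) (h0 : g 0 0 0 = 0)
    (hg : ∀ ε > 0, ∃ δ > 0, ∀ u v w u' v' w', |u| ≤ δ → |v| ≤ δ → |w| ≤ δ → |u'| ≤ δ → |v'| ≤ δ →
      |w'| ≤ δ → |g u v w - g u' v' w' - (B * (u - u') - A * (v - v') + C * (w - w'))|
        ≤ ε * max |u - u'| (max |v - v'| |w - w'|)) :
    ∃ s > 0, s < 1 ∧ Contracts g s := by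
  -- ε ≤ B and ε ≤ C keep g increasing in its outer variables; ε ≤ (A - B - C) / 4 makes κ < 1 and
  -- fixes the sign of g on the diagonal.
  set ε := min (min B C) ((A - B - C) / 4) with hε
  have hεB : ε ≤ B := (min_le_left _ _).trans (min_le_left _ _)
  have hεC : ε ≤ C := (min_le_left _ _).trans (min_le_right _ _)
  have hεA : ε ≤ (A - B - C) / 4 := min_le_right _ _
  have hε0 : 0 < ε := lt_min (lt_min hB hC) (by linarith)
  obtain ⟨δ, hδ, hg⟩ := hg ε hε0
  set κ := (B + C + ε) / (A - ε)
  have hAε : 0 < A - ε := by linarith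
  have hκ : κ < 1 := (div_lt_one hAε).2 (by linarith)
  -- s ≤ 1 - κ allows 1 - s as contraction factor, and s (A + ε) ≤ 1 makes v + s g nondecreasing in
  -- v.
  set s := min (min δ (1 - κ)) (min (1 / 2) (1 / (A + ε))) with hs
  have hAε' : 0 < A + ε := by linarith
  have hs0 : 0 < s := lt_min (lt_min hδ (by linarith)) (lt_min (by norm_num) (by positivity))
  have hsδ : s ≤ δ := (min_le_left _ _).trans (min_le_left _ _)
  have hsκ : s ≤ 1 - κ := (min_le_left _ _).trans (min_le_right _ _)
  have hs2 : s ≤ 1 / 2 := (min_le_right _ _).trans (min_le_left _ _)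
  have hsA : s * (A + ε) ≤ 1 := by
    rw [← le_div_iff₀ hAε']; exact (min_le_right _ _).trans (min_le_right _ _)
  refine ⟨s, hs0, by linarith, ?_, ?_, ?_, ?_⟩
  · intro u v w u' v' w' h1 h2 h3 h4 h5 h6 e e'
    have h := hg u v w u' v' w' (h1.trans hsδ) (h2.trans hsδ) (h3.trans hsδ) (h4.trans hsδ)
      (h5.trans hsδ) (h6.trans hsδ)
    rw [e, e'] at h
    set M := max |u - u'| |w - w'|
    have hM0 : 0 ≤ M := le_max_of_le_left (abs_nonneg _)
    have hu : |u - u'| ≤ M := le_max_left _ _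
    have hw : |w - w'| ≤ M := le_max_right _ _
    have hm : max |u - u'| (max |v - v'| |w - w'|) ≤ M + |v - v'| :=
      max_le (by linarith [abs_nonneg (v - v')])
        (max_le (by linarith) (by linarith [abs_nonneg (v - v')]))
    have h' := abs_le.1 (h.trans (mul_le_mul_of_nonneg_left hm hε0.le))
    have hu' := abs_le.1 hu
    have hw' := abs_le.1 hw
    have key : (A - ε) * |v - v'| ≤ (B + C + ε) * M := by
      have b1 := mul_le_mul_of_nonneg_left hu'.1 hB.le
      have b2 := mul_le_mul_of_nonneg_left hu'.2 hB.le
      have c1 := mul_le_mul_of_nonneg_left hw'.1 hC.le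
      have c2 := mul_le_mul_of_nonneg_left hw'.2 hC.le
      rcases abs_cases (v - v') with ⟨hv, _⟩ | ⟨hv, _⟩
      · rw [hv] at h' ⊢; linarith [h'.1, h'.2]
      · rw [hv] at h' ⊢; linarith [h'.1, h'.2]
    have : |v - v'| ≤ κ * M := by
      rw [div_mul_eq_mul_div, le_div_iff₀ hAε]; linarith
    exact this.trans (mul_le_mul_of_nonneg_right (by linarith) hM0)
  · intro u v w u' v' w' h1 h2 h3 h4 h5 h6 hu hv hw
    have h := hg u' v' w' u v w (h4.trans hsδ) (h5.trans hsδ) (h6.trans hsδ) (h1.trans hsδ)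
      (h2.trans hsδ) (h3.trans hsδ)
    have hm : max |u' - u| (max |v' - v| |w' - w|) ≤ (u' - u) + (v' - v) + (w' - w) := by
      rw [abs_of_nonneg (sub_nonneg.2 hu), abs_of_nonneg (sub_nonneg.2 hv),
        abs_of_nonneg (sub_nonneg.2 hw)]
      exact max_le (by linarith) (max_le (by linarith) (by linarith))
    have h' := (abs_le.1 (h.trans (mul_le_mul_of_nonneg_left hm hε0.le))).1
    have b := mul_le_mul_of_nonneg_right hεB (sub_nonneg.2 hu)
    have c := mul_le_mul_of_nonneg_right hεC (sub_nonneg.2 hw)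
    have d : -((A + ε) * (v' - v)) ≤ g u' v' w' - g u v w := by linarith
    have e := mul_le_mul_of_nonneg_left d hs0.le
    have f := mul_le_mul_of_nonneg_right hsA (sub_nonneg.2 hv)
    linarith
  · intro r hr
    have hr' : |r| ≤ δ := by rw [abs_of_nonneg hr.1]; exact hr.2.trans hsδ
    have h00 : |(0 : ℝ)| ≤ δ := by simpa using hδ.le
    have h := hg r r r 0 0 0 hr' hr' hr' h00 h00 h00
    simp only [sub_zero, max_self, h0, abs_of_nonneg hr.1] at h
    have h1 := (abs_le.1 h).2
    have h2 := mul_le_mul_of_nonneg_right hεA hr.1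
    have h3 := mul_nonneg (by linarith : 0 ≤ A - B - C) hr.1
    linarith
  · intro r hr
    have hr' : |-r| ≤ δ := by rw [abs_neg, abs_of_nonneg hr.1]; exact hr.2.trans hsδ
    have h00 : |(0 : ℝ)| ≤ δ := by simpa using hδ.le
    have h := hg (-r) (-r) (-r) 0 0 0 hr' hr' hr' h00 h00 h00
    simp only [sub_zero, max_self, h0, abs_neg, abs_of_nonneg hr.1] at h
    have h1 := (abs_le.1 h).1
    have h2 := mul_le_mul_of_nonneg_right hεA hr.1
    have h3 := mul_nonneg (by linarith : 0 ≤ A - B - C) hr.1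
    linarith

/-- A bounded sequence which is dominated by its neighbours decays geometrically. -/
lemma decay_of_le_mul_max {κ B : ℝ} (hκ0 : 0 < κ) (hκ : κ < 1) {d : ℕ → ℝ} (h0 : ∀ m, 0 ≤ d m)
    (hB : ∀ m, d m ≤ B) (h : ∀ m, d (m + 1) ≤ κ * max (d m) (d (m + 2))) (m : ℕ) :
    d (m + 1) ≤ κ * d m := by
  -- If the decay fails once, the neighbour that dominates is always the next one, so the sequence
  -- grows geometrically from there on and cannot be bounded.
  by_contra! hlt
  have hpos : 0 < d (m + 1) := (mul_nonneg hκ0.le (h0 m)).trans_lt hlt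
  have step : ∀ n, κ * d n < d (n + 1) → d (n + 1) ≤ κ * d (n + 2) := fun n hn => by
    have := h n
    rcases le_total (d n) (d (n + 2)) with h' | h'
    · rwa [max_eq_right h'] at this
    · rw [max_eq_left h'] at this; linarith
  have key : ∀ k, d (m + 1) ≤ κ ^ k * d (m + k + 1) ∧ κ * d (m + k) < d (m + k + 1) := by
    intro k
    induction k with
    | zero => simpa using hlt
    | succ k ih =>
      have h1 := step _ ih.2
      have hk : 0 < κ ^ k := pow_pos hκ0 k
      have h2 : 0 < d (m + k + 1) := by
        by_contra! h3
        have := mul_le_mul_of_nonneg_left h3 hk.le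
        linarith [ih.1]
      refine ⟨?_, ?_⟩
      · have := mul_le_mul_of_nonneg_left h1 hk.le
        have e : m + (k + 1) + 1 = m + k + 2 := by ring
        rw [e, pow_succ]; linarith [ih.1]
      · have e : m + (k + 1) = m + k + 1 := by ring
        have e' : m + (k + 1) + 1 = m + k + 2 := by ring
        rw [e', e]
        have h3 : d (m + k + 1) < d (m + k + 2) := by
          have h4 : 0 < d (m + k + 2) := by
            by_contra! h5
            have := mul_le_mul_of_nonneg_left h5 hκ0.le
            linarith
          nlinarith
        nlinarith
  have hlim : Tendsto (fun k => κ ^ k * B) atTop (𝓝 (0 * B)) :=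
    (tendsto_pow_atTop_nhds_zero_of_lt_one hκ0.le hκ).mul_const B
  have : d (m + 1) ≤ 0 * B := ge_of_tendsto' hlim fun k =>
    (key k).1.trans (mul_le_mul_of_nonneg_left (hB _) (pow_pos hκ0 k).le)
  linarith

/-- A forward solution of the recurrence `G` in the box of size `s`. -/
structure IsForwardSol (G : ℕ → ℝ → ℝ → ℝ → ℝ) (s : ℝ) (η : ℕ → ℝ) : Prop where
  abs_le : ∀ m, |η m| ≤ s
  eq_zero : ∀ m, G m (η m) (η (m + 1)) (η (m + 2)) = 0

section

variable {G : ℕ → ℝ → ℝ → ℝ → ℝ} {s : ℝ} {η η' : ℕ → ℝ}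

/-- The difference of two solutions in the box is bounded and dominated by its neighbours.
Consequently a solution is determined by its first term, which is why the stable manifold is a graph
over the first coordinate. -/
lemma IsForwardSol.decay (hs0 : 0 < s) (hs1 : s < 1) (hG : ∀ m, Contracts (G m) s)
    (h : IsForwardSol G s η) (h' : IsForwardSol G s η') (m : ℕ) :
    |η (m + 1) - η' (m + 1)| ≤ (1 - s) * |η m - η' m| := by
  refine decay_of_le_mul_max (B := s + s) (by linarith) (by linarith)
    (d := fun m => |η m - η' m|) (fun m => abs_nonneg _) (fun m => ?_) (fun m => ?_) m
  · exact (abs_sub _ _).trans (add_le_add (h.abs_le m) (h'.abs_le m))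
  · exact (hG m).contract _ _ _ _ _ _ (h.abs_le _) (h.abs_le _) (h.abs_le _) (h'.abs_le _)
      (h'.abs_le _) (h'.abs_le _) (h.eq_zero m) (h'.eq_zero m)

lemma IsForwardSol.decay_pow (hs0 : 0 < s) (hs1 : s < 1) (hG : ∀ m, Contracts (G m) s)
    (h : IsForwardSol G s η) (h' : IsForwardSol G s η') (m : ℕ) :
    |η m - η' m| ≤ (1 - s) ^ m * |η 0 - η' 0| := by
  induction m with
  | zero => simp
  | succ m ih =>
    refine (h.decay hs0 hs1 hG h' m).trans ?_
    rw [pow_succ', mul_assoc]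
    exact mul_le_mul_of_nonneg_left ih (by linarith)

lemma IsForwardSol.eq_of_zero (hs0 : 0 < s) (hs1 : s < 1) (hG : ∀ m, Contracts (G m) s)
    (h : IsForwardSol G s η) (h' : IsForwardSol G s η') (h0 : η 0 = η' 0) : η = η' := by
  funext m
  have := h.decay_pow hs0 hs1 hG h' m
  rw [h0, sub_self, abs_zero, mul_zero] at this
  exact sub_eq_zero.1 (abs_nonpos_iff.1 this)

lemma isForwardSol_zero (hs0 : 0 < s) (hG : ∀ m, Contracts (G m) s) :
    IsForwardSol G s (fun _ => 0) where
  abs_le _ := by simpa using hs0.le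
  eq_zero m := le_antisymm ((hG m).top 0 ⟨le_rfl, hs0.le⟩)
    (by simpa using (hG m).bot 0 ⟨le_rfl, hs0.le⟩)

/-- Forward solutions exist, by the Knaster-Tarski theorem. -/
lemma exists_isForwardSol (hs0 : 0 < s) (hG : ∀ m, Contracts (G m) s) {t : ℝ}
    (ht : |t| ≤ s) : ∃ η, IsForwardSol G s η ∧ η 0 = t := by
  have : Fact (-s ≤ s) := ⟨by linarith⟩
  let : CompleteLattice (Icc (-s) s) := Set.Icc.completeLattice
  have habs : ∀ x : Icc (-s) s, |(x : ℝ)| ≤ s := fun x => abs_le.2 x.2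
  have hss : |s| ≤ s := (abs_of_pos hs0).le
  have hss' : |-s| ≤ s := by rw [abs_neg]; exact hss
  have hmem : ∀ (m : ℕ) (x y z : Icc (-s) s), (y : ℝ) + s * G m x y z ∈ Icc (-s) s := by
    intro m x y z
    constructor
    · have h1 := (hG m).mono _ _ _ _ _ _ hss' hss' hss' (habs x) (habs y) (habs z) x.2.1 y.2.1 z.2.1
      have h2 := mul_nonneg hs0.le ((hG m).bot s ⟨hs0.le, le_rfl⟩)
      linarith
    · have h1 := (hG m).mono _ _ _ _ _ _ (habs x) (habs y) (habs z) hss hss hss x.2.2 y.2.2 z.2.2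
      have h2 := mul_nonneg hs0.le (neg_nonneg.2 ((hG m).top s ⟨hs0.le, le_rfl⟩))
      linarith
  -- A relaxation whose fixed points are the solutions with first term t. The fields `top` and `bot`
  -- keep it in the box and `mono` makes it order preserving.
  let T : (ℕ → Icc (-s) s) → ℕ → Icc (-s) s := fun η m =>
    match m with
    | 0 => ⟨t, abs_le.1 ht⟩
    | m + 1 => ⟨η (m + 1) + s * G m (η m) (η (m + 1)) (η (m + 2)), hmem m _ _ _⟩
  have hT : Monotone T := fun η η' h m => by
    cases m with
    | zero => exact le_rfl
    | succ m =>
      exact (hG m).mono _ _ _ _ _ _ (habs _) (habs _) (habs _) (habs _) (habs _) (habs _)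
        (h m) (h (m + 1)) (h (m + 2))
  let T' : (ℕ → Icc (-s) s) →o (ℕ → Icc (-s) s) := ⟨T, hT⟩
  set η := OrderHom.lfp T'
  have hfix : T η = η := T'.map_lfp
  refine ⟨fun m => η m, ⟨fun m => habs _, fun m => ?_⟩, ?_⟩
  · have h1 : (T η (m + 1) : ℝ) = η (m + 1) := by rw [hfix]
    change (η (m + 1) : ℝ) + s * G m (η m) (η (m + 1)) (η (m + 2)) = η (m + 1) at h1
    have h2 : s * G m (η m) (η (m + 1)) (η (m + 2)) = 0 := by linarith
    exact (mul_eq_zero.1 h2).resolve_left hs0.ne'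
  · change (η 0 : ℝ) = t
    rw [← hfix]

end

/-- A periodic family of conditions on a size, each of which holds for all small sizes, holds for
a uniform small size. -/
lemma exists_uniform_size {q : ℕ} (hq : 0 < q) {R : ℤ → ℝ → Prop}
    (hper : ∀ i s, R (i + q) s ↔ R i s) (hanti : ∀ i s s', 0 < s' → s' ≤ s → R i s → R i s')
    (hex : ∀ i, ∃ s > 0, R i s) : ∃ s > 0, s < 1 ∧ ∀ i, R i s := by
  choose r hr0 hr using hex
  have key : ∀ n : ℕ, ∃ s > 0, s < 1 ∧ ∀ k : ℕ, k < n → R k s := by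
    intro n
    induction n with
    | zero => exact ⟨1 / 2, by norm_num, by norm_num, fun k hk => (Nat.not_lt_zero k hk).elim⟩
    | succ n ih =>
      obtain ⟨s, hs0, hs1, hs⟩ := ih
      refine ⟨min s (r n), lt_min hs0 (hr0 _), (min_le_left _ _).trans_lt hs1, fun k hk => ?_⟩
      rcases Nat.lt_succ_iff_lt_or_eq.1 hk with h | rfl
      · exact hanti _ _ _ (lt_min hs0 (hr0 _)) (min_le_left _ _) (hs k h)
      · exact hanti _ _ _ (lt_min hs0 (hr0 _)) (min_le_right _ _) (hr _)
  -- A size that serves the residues 0, ..., q - 1 serves all indices by periodicity.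
  obtain ⟨s, hs0, hs1, hs⟩ := key q
  have hmul : ∀ (n : ℤ) (i : ℤ), R (i + n * q) s ↔ R i s := by
    intro n i
    induction n using Int.induction_on with
    | zero => simp
    | succ n ih => rw [← ih, ← hper (i + n * q)]; ring_nf
    | pred n ih => rw [← ih, ← hper (i + (-(n : ℤ) - 1) * q)]; ring_nf
  refine ⟨s, hs0, hs1, fun i => ?_⟩
  have hq' : (0 : ℤ) < q := by exact_mod_cast hq
  have h1 := Int.emod_nonneg i hq'.ne'
  have h2 := Int.emod_lt_of_pos i hq'
  have h3 : i = i % q + i / q * q := by rw [mul_comm]; exact (Int.emod_add_mul_ediv i q).symm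
  rw [h3, hmul]
  have h4 := hs (i % q).toNat (by omega)
  rwa [Int.toNat_of_nonneg h1] at h4

end Billiard

namespace Billiard

variable {γ : UnitAddCircle → Plane} {X w : ℤ → ℝ} {q : ℕ}

/-! ### Hyperbolic configurations -/

/-- A periodic billiard configuration `X` with a periodic positive strict supersolution `w` of its
Jacobi equation, whose bounces within a period are distinct. -/
structure HyperbolicConfig (γ : UnitAddCircle → Plane) (X w : ℤ → ℝ) (q : ℕ) : Prop where
  pos : 0 < q
  ne : ∀ i, (X (i + 1) : UnitAddCircle) ≠ X i
  el : ∀ i, chordDeriv γ (X i) (X (i - 1)) + chordDeriv γ (X i) (X (i + 1)) = 0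
  period : ∃ p : ℤ, ∀ i, X (i + q) = X i + p
  weight_pos : ∀ i, 0 < w i
  weight_period : ∀ i, w (i + q) = w i
  super : ∀ i, (chordDeriv₁ γ (X i) (X (i - 1)) + chordDeriv₁ γ (X i) (X (i + 1))) * w i
    + chordDeriv₂ γ (X i) (X (i - 1)) * w (i - 1) + chordDeriv₂ γ (X i) (X (i + 1)) * w (i + 1) < 0
  inj : ∀ i j, (X i : UnitAddCircle) = X j → (q : ℤ) ∣ i - j

/-- The bounce at weighted displacement `u` from the configuration. -/
def displaced (X w : ℤ → ℝ) (i : ℤ) (u : ℝ) : ℝ := X i + w i * u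

/-- The Euler-Lagrange equation in weighted displacements. -/
def localEq (γ : UnitAddCircle → Plane) (X w : ℤ → ℝ) (i : ℤ) (u v z : ℝ) : ℝ :=
  chordDeriv γ (displaced X w i v) (displaced X w (i - 1) u)
    + chordDeriv γ (displaced X w i v) (displaced X w (i + 1) z)

/-- The estimates which hold at bounce `i` for displacements of size `s`. -/
structure GoodSize (γ : UnitAddCircle → Plane) (X w : ℤ → ℝ) (i : ℤ) (s : ℝ) : Prop where
  contracts : Contracts (localEq γ X w i) s
  weight_le : w i ≤ 1 / s
  ne : ∀ u v, |u| ≤ s → |v| ≤ s →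
    (displaced X w (i + 1) v : UnitAddCircle) ≠ displaced X w i u
  angle_le : ∀ u v u' v', |u| ≤ s → |v| ≤ s → |u'| ≤ s → |v'| ≤ s →
    |angle γ (displaced X w i u) (displaced X w (i + 1) v)
      - angle γ (displaced X w i u') (displaced X w (i + 1) v')| ≤ 1 / s * max |u - u'| |v - v'|

lemma GoodSize.anti {i : ℤ} {s s' : ℝ} (h0 : 0 < s') (hs : s' ≤ s) (h : GoodSize γ X w i s) :
    GoodSize γ X w i s' where
  contracts := h.contracts.anti h0 hs
  weight_le := h.weight_le.trans (one_div_le_one_div_of_le h0 hs)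
  ne u v hu hv := h.ne u v (hu.trans hs) (hv.trans hs)
  angle_le u v u' v' h1 h2 h3 h4 :=
    (h.angle_le u v u' v' (h1.trans hs) (h2.trans hs) (h3.trans hs) (h4.trans hs)).trans
      (mul_le_mul_of_nonneg_right (one_div_le_one_div_of_le h0 hs)
        (le_max_of_le_left (abs_nonneg _)))

/-- Strict differentiability at the origin, as an estimate on a box. -/
lemma exists_strict_estimate {g : ℝ × ℝ × ℝ → ℝ} {L : ℝ × ℝ × ℝ →L[ℝ] ℝ}
    (hg : HasStrictFDerivAt g L 0) {ε : ℝ} (hε : 0 < ε) : ∃ δ > 0, ∀ u v w u' v' w', |u| ≤ δ →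
      |v| ≤ δ → |w| ≤ δ → |u'| ≤ δ → |v'| ≤ δ → |w'| ≤ δ →
      |g (u, v, w) - g (u', v', w') - L (u - u', v - v', w - w')|
        ≤ ε * max |u - u'| (max |v - v'| |w - w'|) := by
  obtain ⟨S, hS, happ⟩ := hg.approximates_deriv_on_nhds (c := ⟨ε, hε.le⟩) (Or.inr hε)
  obtain ⟨δ, hδ, hball⟩ := Metric.nhds_basis_closedBall.mem_iff.1 hS
  have hmem : ∀ u v w : ℝ, |u| ≤ δ → |v| ≤ δ → |w| ≤ δ → (u, v, w) ∈ S := fun u v w hu hv hw => by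
    apply hball
    rw [mem_closedBall_zero_iff]
    exact max_le hu (max_le hv hw)
  refine ⟨δ, hδ, fun u v w u' v' w' h1 h2 h3 h4 h5 h6 => ?_⟩
  exact happ _ (hmem u v w h1 h2 h3) _ (hmem u' v' w' h4 h5 h6)

namespace IsStronglyConvexTable

variable (hγ : IsStronglyConvexTable γ)
include hγ

/-- In weighted displacements the coefficients of the linearized equation are B and C for the
neighbours and -A for the middle bounce. The supersolution inequality `super` says exactly B + C <
A. -/
lemma exists_contracts_localEq (hX : HyperbolicConfig γ X w q) (i : ℤ) :
    ∃ s > 0, s < 1 ∧ Contracts (localEq γ X w i) s := by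
  have hne1 : (X (i - 1) : UnitAddCircle) ≠ X i := by
    have := hX.ne (i - 1); rw [sub_add_cancel] at this; exact this.symm
  have hne2 : (X (i + 1) : UnitAddCircle) ≠ X i := hX.ne i
  let A₁ : ℝ × ℝ × ℝ →L[ℝ] ℝ × ℝ :=
    (w i • (ContinuousLinearMap.fst ℝ ℝ ℝ).comp (ContinuousLinearMap.snd ℝ ℝ (ℝ × ℝ))).prod
      (w (i - 1) • ContinuousLinearMap.fst ℝ ℝ (ℝ × ℝ))
  let A₂ : ℝ × ℝ × ℝ →L[ℝ] ℝ × ℝ :=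
    (w i • (ContinuousLinearMap.fst ℝ ℝ ℝ).comp (ContinuousLinearMap.snd ℝ ℝ (ℝ × ℝ))).prod
      (w (i + 1) • (ContinuousLinearMap.snd ℝ ℝ ℝ).comp (ContinuousLinearMap.snd ℝ ℝ (ℝ × ℝ)))
  have h1 := hγ.hasStrictFDerivAt_chordDeriv hne1
  have h2 := hγ.hasStrictFDerivAt_chordDeriv hne2
  have e1 : (X i, X (i - 1)) + A₁ 0 = (X i, X (i - 1)) := by rw [map_zero, add_zero]
  have e2 : (X i, X (i + 1)) + A₂ 0 = (X i, X (i + 1)) := by rw [map_zero, add_zero]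
  rw [← e1] at h1
  rw [← e2] at h2
  have g1 := HasStrictFDerivAt.comp (f := fun z => (X i, X (i - 1)) + A₁ z) 0 h1
    (A₁.hasStrictFDerivAt.const_add _)
  have g2 := HasStrictFDerivAt.comp (f := fun z => (X i, X (i + 1)) + A₂ z) 0 h2
    (A₂.hasStrictFDerivAt.const_add _)
  have g := g1.add g2
  refine exists_contracts (A := -((chordDeriv₁ γ (X i) (X (i - 1)) + chordDeriv₁ γ (X i) (X (i + 1)))
    * w i)) (B := chordDeriv₂ γ (X i) (X (i - 1)) * w (i - 1))
    (C := chordDeriv₂ γ (X i) (X (i + 1)) * w (i + 1))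
    (mul_pos (hγ.chordDeriv₂_pos hne1) (hX.weight_pos _))
    (mul_pos (hγ.chordDeriv₂_pos hne2) (hX.weight_pos _)) ?_ ?_ ?_
  · linarith [hX.super i]
  · simpa [localEq, displaced] using hX.el i
  · intro ε hε
    obtain ⟨δ, hδ, h⟩ := exists_strict_estimate g hε
    refine ⟨δ, hδ, fun u v z u' v' z' h1 h2 h3 h4 h5 h6 => ?_⟩
    refine le_trans (le_of_eq ?_) (h u v z u' v' z' h1 h2 h3 h4 h5 h6)
    congr 1
    simp [localEq, displaced, A₁, A₂]
    ring

lemma exists_goodSize (hX : HyperbolicConfig γ X w q) (i : ℤ) : ∃ s > 0, GoodSize γ X w i s := by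
  obtain ⟨s₁, hs₁, -, hc⟩ := hγ.exists_contracts_localEq hX i
  -- distinct neighbours
  have hcont : Continuous fun z : ℝ × ℝ =>
      ((displaced X w (i + 1) z.2 : UnitAddCircle), (displaced X w i z.1 : UnitAddCircle)) := by
    have h : Continuous fun x : ℝ => (x : UnitAddCircle) := AddCircle.continuous_mk' 1
    refine (h.comp ?_).prodMk (h.comp ?_) <;> unfold displaced <;> fun_prop
  have hopen : IsOpen {z : ℝ × ℝ | (displaced X w (i + 1) z.2 : UnitAddCircle)
      ≠ displaced X w i z.1} := isClosed_diagonal.isOpen_compl.preimage hcont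
  have h0 : (0 : ℝ × ℝ) ∈ {z : ℝ × ℝ | (displaced X w (i + 1) z.2 : UnitAddCircle)
      ≠ displaced X w i z.1} := by
    simpa [displaced] using hX.ne i
  obtain ⟨s₂, hs₂, hball⟩ := Metric.nhds_basis_closedBall.mem_iff.1 (hopen.mem_nhds h0)
  -- the Lipschitz bound
  let A : ℝ × ℝ →L[ℝ] ℝ × ℝ := (w i • ContinuousLinearMap.fst ℝ ℝ ℝ).prod
    (w (i + 1) • ContinuousLinearMap.snd ℝ ℝ ℝ)
  obtain ⟨a, b, hab⟩ := hγ.exists_hasStrictFDerivAt_angle (hX.ne i)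
  have e : (X i, X (i + 1)) + A 0 = (X i, X (i + 1)) := by rw [map_zero, add_zero]
  rw [← e] at hab
  obtain ⟨K, S, hS, hLip⟩ := (HasStrictFDerivAt.comp (f := fun z => (X i, X (i + 1)) + A z) 0 hab
    (A.hasStrictFDerivAt.const_add _)).exists_lipschitzOnWith
  obtain ⟨s₃, hs₃, hball'⟩ := Metric.nhds_basis_closedBall.mem_iff.1 hS
  have hw := hX.weight_pos i
  have hK : (0 : ℝ) < K + 1 := by positivity
  -- The last two bounds let the single constant 1 / s dominate both the weight and the Lipschitz
  -- constant K of the angle.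
  set s := min (min s₁ s₂) (min s₃ (min (1 / w i) (1 / (K + 1))))
  have hs : 0 < s := lt_min (lt_min hs₁ hs₂) (lt_min hs₃ (lt_min (by positivity) (by positivity)))
  have k2 : s ≤ s₂ := (min_le_left _ _).trans (min_le_right _ _)
  have k3 : s ≤ s₃ := (min_le_right _ _).trans (min_le_left _ _)
  have k4 : s ≤ 1 / w i := (min_le_right _ _).trans ((min_le_right _ _).trans (min_le_left _ _))
  have k5 : s ≤ 1 / (K + 1) := (min_le_right _ _).trans ((min_le_right _ _).trans (min_le_right _ _))
  refine ⟨s, hs, hc.anti hs ((min_le_left _ _).trans (min_le_left _ _)), ?_, ?_, ?_⟩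
  · rw [le_div_comm₀ hw hs]; exact k4
  · intro u v hu hv
    refine hball (a := (u, v)) ?_
    rw [mem_closedBall_zero_iff]
    exact max_le (hu.trans k2) (hv.trans k2)
  · intro u v u' v' h1 h2 h3 h4
    have m1 : (u, v) ∈ S := hball' (by
      rw [mem_closedBall_zero_iff]; exact max_le (h1.trans k3) (h2.trans k3))
    have m2 : (u', v') ∈ S := hball' (by
      rw [mem_closedBall_zero_iff]; exact max_le (h3.trans k3) (h4.trans k3))
    have h := hLip.dist_le_mul _ m1 _ m2
    have h' : K ≤ 1 / s := by
      rw [le_div_comm₀ hs hK] at k5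
      linarith
    refine le_trans ?_ (mul_le_mul_of_nonneg_right h' (le_max_of_le_left (abs_nonneg _)))
    exact h

omit hγ in
lemma _root_.Billiard.HyperbolicConfig.localEq_add_period (hX : HyperbolicConfig γ X w q) (i : ℤ) :
    localEq γ X w (i + q) = localEq γ X w i := by
  obtain ⟨p, hp⟩ := hX.period
  funext u v z
  have h : ∀ j u, displaced X w (j + q) u = displaced X w j u + p := fun j u => by
    rw [displaced, displaced, hp, hX.weight_period]; ring
  rw [localEq, localEq, h, show i + q - 1 = i - 1 + q by ring, h, show i + q + 1 = i + 1 + q by ring,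
    h, chordDeriv_add_intCast, chordDeriv_add_intCast]

omit hγ in
lemma _root_.Billiard.HyperbolicConfig.goodSize_add_period (hX : HyperbolicConfig γ X w q) (i : ℤ)
    (s : ℝ) : GoodSize γ X w (i + q) s ↔ GoodSize γ X w i s := by
  obtain ⟨p, hp⟩ := hX.period
  have h : ∀ j u, displaced X w (j + q) u = displaced X w j u + p := fun j u => by
    rw [displaced, displaced, hp, hX.weight_period]; ring
  have e : i + q + 1 = i + 1 + q := by ring
  constructor
  · rintro ⟨h1, h2, h3, h4⟩
    rw [hX.localEq_add_period] at h1
    rw [hX.weight_period] at h2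
    simp only [e, h, coe_add_intCast, angle_add_intCast] at h3 h4
    exact ⟨h1, h2, h3, h4⟩
  · rintro ⟨h1, h2, h3, h4⟩
    refine ⟨?_, ?_, ?_, ?_⟩
    · rwa [hX.localEq_add_period]
    · rwa [hX.weight_period]
    · simpa only [e, h, coe_add_intCast, angle_add_intCast] using h3
    · simpa only [e, h, coe_add_intCast, angle_add_intCast] using h4

lemma exists_uniform_goodSize (hX : HyperbolicConfig γ X w q) :
    ∃ s > 0, s < 1 ∧ ∀ i, GoodSize γ X w i s :=
  exists_uniform_size hX.pos hX.goodSize_add_period (fun _ _ _ h0 hs h => h.anti h0 hs)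
    (hγ.exists_goodSize hX)

/-! ### Local stable manifolds -/

omit hγ in
/-- The Euler-Lagrange recurrence for the forward orbit from bounce `i`. -/
abbrev _root_.Billiard.forwardEq (γ : UnitAddCircle → Plane) (X w : ℤ → ℝ) (i : ℤ) (m : ℕ) :
    ℝ → ℝ → ℝ → ℝ := localEq γ X w (i + m + 1)

omit hγ in
/-- The phase points of a forward orbit near a configuration. -/
def _root_.Billiard.solPhase (γ : UnitAddCircle → Plane) (X w : ℤ → ℝ) (i : ℤ) (η : ℕ → ℝ) (m : ℕ) :
    Annulus := phase γ (displaced X w (i + m) (η m)) (displaced X w (i + m + 1) (η (m + 1)))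

/-- The recurrence is the reflection law. The shift in `forwardEq` centres equation m at bounce i +
m + 1, between the displacements η m and η (m + 2). -/
lemma iter_solPhase {s : ℝ} (hs : ∀ i, GoodSize γ X w i s) {i : ℤ} {η : ℕ → ℝ}
    (hη : IsForwardSol (forwardEq γ X w i) s η) (m : ℕ) :
    iter γ m (solPhase γ X w i η 0) = solPhase γ X w i η m := by
  induction m with
  | zero => rfl
  | succ m ih =>
    rw [Nat.cast_succ, hγ.iter_succ, ih, solPhase, solPhase, Nat.cast_succ]
    have e : i + ((m : ℤ) + 1) = i + m + 1 := by ring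
    rw [e, hγ.billiardMap_phase_iff]
    · have h := hη.eq_zero m
      simp only [forwardEq, localEq, add_sub_cancel_right] at h
      exact h
    · exact ((hs (i + m)).ne _ _ (hη.abs_le _) (hη.abs_le _)).symm
    · exact (hs (i + m + 1)).ne _ _ (hη.abs_le _) (hη.abs_le _)

omit hγ in
lemma _root_.Billiard.dist_coe_le (a b : ℝ) : dist (a : UnitAddCircle) b ≤ |a - b| := by
  rw [dist_eq_norm, ← AddCircle.coe_sub, UnitAddCircle.norm_eq]
  simpa using round_le (a - b) 0

omit hγ in
lemma dist_solPhase_le {s : ℝ} (hs0 : 0 < s) (hs : ∀ i, GoodSize γ X w i s)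
    (hX : HyperbolicConfig γ X w q) (i : ℤ) {η η' : ℕ → ℝ} (hη : ∀ m, |η m| ≤ s)
    (hη' : ∀ m, |η' m| ≤ s) (m : ℕ) :
    dist (solPhase γ X w i η m) (solPhase γ X w i η' m)
      ≤ 1 / s * max |η m - η' m| |η (m + 1) - η' (m + 1)| := by
  refine max_le ?_ ?_
  · refine (dist_coe_le _ _).trans ?_
    rw [displaced, displaced, add_sub_add_left_eq_sub, ← mul_sub, abs_mul,
      abs_of_pos (hX.weight_pos _)]
    exact mul_le_mul (hs _).weight_le (le_max_left _ _) (abs_nonneg _) (by positivity)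
  · rw [Subtype.dist_eq, Real.dist_eq, solPhase, solPhase, phase_snd, phase_snd]
    exact (hs (i + m)).angle_le _ _ _ _ (hη _) (hη _) (hη' _) (hη' _)

/-- Forward orbits near the configuration lie on local stable manifolds. -/
lemma exists_solPhase_mem_localAsymptoticSet {s : ℝ} (hs0 : 0 < s) (hs1 : s < 1)
    (hs : ∀ i, GoodSize γ X w i s) (hX : HyperbolicConfig γ X w q) {ρ : ℝ} (hρ : 0 < ρ) :
    ∃ r > 0, ∀ (i : ℤ) (η : ℕ → ℝ), IsForwardSol (forwardEq γ X w i) s η → |η 0| < r →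
      solPhase γ X w i η 0 ∈
        localAsymptoticSet (fun m => iter γ (m : ℤ)) (phase γ (X i) (X (i + 1))) ρ := by
  -- The curve built below has length at most 2 |η 0| / s.
  refine ⟨ρ * s / 2, by positivity, fun i η hη hr => ?_⟩
  have hG : ∀ m, Contracts (forwardEq γ X w i m) s := fun m => (hs _).contracts
  have habs : ∀ t ∈ Icc (0 : ℝ) 1, |t * η 0| ≤ s := fun t ht => by
    rw [abs_mul, abs_of_nonneg ht.1]
    exact (mul_le_of_le_one_left (abs_nonneg _) ht.2).trans (hη.abs_le 0)
  have hex : ∀ t ∈ Icc (0 : ℝ) 1, ∃ ζ, IsForwardSol (forwardEq γ X w i) s ζ ∧ ζ 0 = t * η 0 :=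
    fun t ht => exists_isForwardSol hs0 hG (habs t ht)
  choose! Z hZ hZ0 using hex
  set c : ℝ → Annulus := fun t => solPhase γ X w i (Z t) 0 with hc
  have hz0 : Z 0 = fun _ => 0 := (hZ 0 (by simp)).eq_of_zero hs0 hs1 hG
    (isForwardSol_zero hs0 hG) (by rw [hZ0 0 (by simp)]; simp)
  have hz1 : Z 1 = η := (hZ 1 (by simp)).eq_of_zero hs0 hs1 hG hη (by rw [hZ0 1 (by simp)]; simp)
  have hc0 : c 0 = phase γ (X i) (X (i + 1)) := by
    simp [hc, hz0, solPhase, displaced]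
  have hc1 : c 1 = solPhase γ X w i η 0 := by simp only [hc, hz1]
  have hdist : ∀ t ∈ Icc (0 : ℝ) 1, ∀ t' ∈ Icc (0 : ℝ) 1, ∀ m : ℕ,
      dist (iter γ m (c t)) (iter γ m (c t')) ≤ 1 / s * ((1 - s) ^ m * (|t - t'| * |η 0|)) := by
    intro t ht t' ht' m
    rw [hγ.iter_solPhase hs (hZ t ht), hγ.iter_solPhase hs (hZ t' ht')]
    refine (dist_solPhase_le hs0 hs hX i (hZ t ht).abs_le (hZ t' ht').abs_le m).trans ?_
    have h1 := (hZ t ht).decay_pow hs0 hs1 hG (hZ t' ht') m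
    have h2 := (hZ t ht).decay hs0 hs1 hG (hZ t' ht') m
    rw [hZ0 t ht, hZ0 t' ht', ← sub_mul, abs_mul] at h1
    refine mul_le_mul_of_nonneg_left (max_le h1 ?_) (by positivity)
    exact (h2.trans (mul_le_of_le_one_left (abs_nonneg _) (by linarith))).trans h1
  have hlim : Tendsto (fun m : ℕ => 1 / s * ((1 - s) ^ m * |η 0|)) atTop (𝓝 0) := by
    have := ((tendsto_pow_atTop_nhds_zero_of_lt_one (r := 1 - s) (by linarith)
      (by linarith)).mul_const |η 0|).const_mul (1 / s)
    simpa using this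
  have hLip : LipschitzOnWith (Real.toNNReal (1 / s * |η 0|)) c (Icc 0 1) := by
    refine LipschitzOnWith.of_dist_le_mul fun t ht t' ht' => ?_
    have := hdist t ht t' ht' 0
    rw [Real.coe_toNNReal _ (by positivity), Real.dist_eq]
    simp only [Nat.cast_zero, iter_zero, pow_zero, one_mul] at this
    linarith
  have hunif : ∀ t ∈ Icc (0 : ℝ) 1, ∀ m : ℕ,
      dist (iter γ m (c t)) (iter γ m (phase γ (X i) (X (i + 1)))) ≤
        1 / s * ((1 - s) ^ m * |η 0|) := fun t ht m => by
    rw [← hc0]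
    refine (hdist t ht 0 (by simp) m).trans ?_
    have h1 : |t - 0| ≤ 1 := by rw [sub_zero, abs_of_nonneg ht.1]; exact ht.2
    have h3 : 0 ≤ (1 - s) ^ m := pow_nonneg (by linarith) m
    have h4 := mul_le_of_le_one_left (abs_nonneg (η 0)) h1
    gcongr
  have hleaf : IsLeafCurve (fun m => iter γ (m : ℤ)) (phase γ (X i) (X (i + 1))) c := by
    refine ⟨hLip.continuousOn, ?_⟩
    rw [Metric.tendstoUniformlyOn_iff]
    intro ε hε
    filter_upwards [hlim.eventually (gt_mem_nhds hε)] with m hm t ht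
    rw [dist_comm, Real.dist_eq, sub_zero, abs_of_nonneg dist_nonneg]
    exact (hunif t ht m).trans_lt hm
  refine ⟨?_, ?_⟩
  · change Tendsto _ _ _
    refine squeeze_zero (fun m => dist_nonneg) (fun m => ?_) hlim
    have := hunif 1 (by simp) m
    rwa [hc1] at this
  · have hlen : curveLength c ≤ ENNReal.ofReal (2 * (1 / s * |η 0|)) := by
      -- Passing from the sup metric, in which c is Lipschitz, to the Euclidean one costs a factor
      -- √2, bounded below by 2.
      have h1 := ((WithLp.prod_lipschitzWith_toLp 2 UnitAddCircle
        (Icc (-(Real.pi / 2)) (Real.pi / 2))).lipschitzOnWith (s := univ)).comp hLip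
        (fun _ _ => mem_univ _)
      have h2 := h1.comp_eVariationOn_le (g := id) (s := Icc 0 1) (fun _ h => h)
      have h3 : eVariationOn (id : ℝ → ℝ) (Icc 0 1) = ENNReal.ofReal (1 - 0) := by
        have := (monotoneOn_id (s := Icc (0 : ℝ) 1)).eVariationOn_eq (a := 0) (b := 1)
          (by simp) (by simp)
        rwa [inter_self] at this
      rw [h3] at h2
      refine (show curveLength c ≤ _ from h2).trans ?_
      rw [sub_zero, ENNReal.ofReal_one, mul_one, ENNReal.ofReal_mul (by norm_num), ENNReal.coe_mul]
      refine mul_le_mul' ?_ le_rfl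
      have h4 : (2 : NNReal) ^ (1 / (2 : ENNReal)).toReal ≤ 2 := by
        conv_rhs => rw [← NNReal.rpow_one 2]
        refine NNReal.rpow_le_rpow_of_exponent_le (by norm_num) ?_
        simp; norm_num
      have h5 : ENNReal.ofReal 2 = ((2 : NNReal) : ENNReal) := by simp
      rw [h5]
      exact ENNReal.coe_le_coe.2 h4
    have hle : leafDist (fun m => iter γ (m : ℤ)) (phase γ (X i) (X (i + 1)))
        (solPhase γ X w i η 0) ≤ curveLength c := iInf₂_le c ⟨hleaf, hc0, hc1⟩
    refine (hle.trans hlen).trans_lt ((ENNReal.ofReal_lt_ofReal_iff hρ).2 ?_)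
    have : 2 * (1 / s * |η 0|) = |η 0| * 2 / s := by ring
    rw [this, div_lt_iff₀ hs0]
    linarith

end IsStronglyConvexTable

end Billiard

namespace Billiard

/-! ### The ground state of a periodic Jacobi operator -/

/-- For small t of sign opposite to c the linear term prevails; t = -c / (|K| + 1) is small enough.
-/
lemma eq_zero_of_forall_quadratic_nonneg {c K : ℝ} (h : ∀ t : ℝ, 0 ≤ 2 * t * c + t ^ 2 * K) :
    c = 0 := by
  have h1 := h 1
  have h2 := h (-c / (|K| + 1))
  have hK : 0 < |K| + 1 := by positivity
  have h3 : 2 * (-c / (|K| + 1)) * c + (-c / (|K| + 1)) ^ 2 * K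
      = c ^ 2 * (K - 2 * (|K| + 1)) / (|K| + 1) ^ 2 := by
    field_simp; ring
  rw [h3] at h2
  by_contra hc
  have h4 : c ^ 2 * (K - 2 * (|K| + 1)) < 0 :=
    mul_neg_of_pos_of_neg (by positivity) (by linarith [le_abs_self K, abs_nonneg K])
  have := div_neg_of_neg_of_pos h4 (pow_pos hK 2)
  linarith

/-- The lowest eigenvector of a periodic Jacobi matrix with negative off-diagonal entries is
positive. -/
lemma exists_ground_state {q : ℕ} [NeZero q] (a b : ZMod q → ℝ) (hb : ∀ z, 0 < b z) :
    ∃ (μ : ℝ) (v : ZMod q → ℝ), (∀ z, 0 < v z) ∧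
      ∀ z, a z * v z - b (z - 1) * v (z - 1) - b z * v (z + 1) = μ * v z := by
  -- Each edge z, z + 1 contributes once, so that q = 1 and q = 2, where neighbours coincide, need
  -- no separate treatment.
  let form : (ZMod q → ℝ) → ℝ := fun v => ∑ z, (a z * v z ^ 2 - 2 * b z * (v z * v (z + 1)))
  let nsq : (ZMod q → ℝ) → ℝ := fun v => ∑ z, v z ^ 2
  have hform : Continuous form := by fun_prop
  have hnsq : Continuous nsq := by fun_prop
  set S : Set (ZMod q → ℝ) := {v | nsq v = 1}
  have hcompact : IsCompact S := by
    refine Metric.isCompact_of_isClosed_isBounded (isClosed_eq hnsq continuous_const) ?_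
    refine (Metric.isBounded_closedBall (x := (0 : ZMod q → ℝ)) (r := 1)).subset fun v hv => ?_
    rw [mem_closedBall_zero_iff, pi_norm_le_iff_of_nonneg zero_le_one]
    intro z
    have h1 : v z ^ 2 ≤ nsq v :=
      Finset.single_le_sum (f := fun z => v z ^ 2) (fun _ _ => sq_nonneg _) (Finset.mem_univ z)
    rw [show nsq v = 1 from hv] at h1
    exact (sq_le_one_iff_abs_le_one _).1 h1
  have hne : S.Nonempty := ⟨Pi.single 0 1, by
    change ∑ z, (Pi.single 0 1 : ZMod q → ℝ) z ^ 2 = 1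
    rw [Finset.sum_eq_single 0] <;> simp +contextual⟩
  obtain ⟨v₀, hv₀, hmin⟩ := hcompact.exists_isMinOn hne hform.continuousOn
  set μ := form v₀
  have hlow : ∀ v, μ * nsq v ≤ form v := by
    intro v
    rcases (Finset.sum_nonneg fun z _ => sq_nonneg (v z) : 0 ≤ nsq v).eq_or_lt with h0 | h0
    · have hv : v = 0 := by
        funext z
        have := (Finset.sum_eq_zero_iff_of_nonneg fun z _ => sq_nonneg (v z)).1 h0.symm z
          (Finset.mem_univ z)
        simpa using this
      simp [hv, form, nsq]
    · have hs := Real.sqrt_pos.2 h0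
      have hsq := Real.sq_sqrt h0.le
      have hscale : ∀ r : ℝ, form (fun z => r * v z) = r ^ 2 * form v ∧
          nsq (fun z => r * v z) = r ^ 2 * nsq v := fun r => by
        simp only [form, nsq, Finset.mul_sum]
        exact ⟨Finset.sum_congr rfl fun z _ => by ring, Finset.sum_congr rfl fun z _ => by ring⟩
      have hmem : (fun z => (√(nsq v))⁻¹ * v z) ∈ S := by
        change nsq _ = 1
        rw [(hscale _).2, inv_pow, hsq, inv_mul_cancel₀ h0.ne']
      have h1 : μ ≤ form (fun z => (√(nsq v))⁻¹ * v z) := hmin hmem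
      rw [(hscale _).1, inv_pow, hsq, ← div_eq_inv_mul, le_div_iff₀ h0] at h1
      exact h1
  -- the absolute value of a minimizer is a minimizer
  set u : ZMod q → ℝ := fun z => |v₀ z| with hu
  have hu1 : nsq u = 1 := by
    rw [← show nsq v₀ = 1 from hv₀]
    simp only [nsq, hu, sq_abs]
  have huμ : form u = μ := by
    refine le_antisymm ?_ (by simpa [hu1] using hlow u)
    refine Finset.sum_le_sum fun z _ => ?_
    simp only [hu, sq_abs, ← abs_mul]
    have := mul_le_mul_of_nonneg_left (le_abs_self (v₀ z * v₀ (z + 1))) (hb z).le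
    linarith
  -- The residual of the eigenvalue equation is itself used as direction of variation: the
  -- first-order coefficient of `form` - μ `nsq` along e is twice the sum of e², which must vanish
  -- at the minimizer u.
  set e : ZMod q → ℝ := fun z => a z * u z - b (z - 1) * u (z - 1) - b z * u (z + 1) - μ * u z
    with he
  have hshift : ∀ g : ZMod q → ℝ, ∑ z, g (z + 1) = ∑ z, g z := fun g =>
    Equiv.sum_comp (Equiv.addRight (1 : ZMod q)) g
  have hquad : ∀ t : ℝ, 0 ≤ 2 * t * (∑ z, e z ^ 2) + t ^ 2 * (form e - μ * nsq e) := by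
    intro t
    have h1 := hlow (fun z => u z + t * e z)
    have h2 : form (fun z => u z + t * e z) = form u + 2 * t * (∑ z, (a z * (u z * e z)
        - b z * (u z * e (z + 1)) - b z * (u (z + 1) * e z))) + t ^ 2 * form e := by
      simp only [form, Finset.mul_sum, ← Finset.sum_add_distrib]
      exact Finset.sum_congr rfl fun z _ => by ring
    have h3 : nsq (fun z => u z + t * e z)
        = nsq u + 2 * t * (∑ z, u z * e z) + t ^ 2 * nsq e := by
      simp only [nsq, Finset.mul_sum, ← Finset.sum_add_distrib]
      exact Finset.sum_congr rfl fun z _ => by ring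
    have h4 : ∑ z, b z * (u z * e (z + 1)) = ∑ z, b (z - 1) * (u (z - 1) * e z) := by
      rw [← hshift (fun z => b (z - 1) * (u (z - 1) * e z))]
      simp
    have h5 : ∑ z, e z ^ 2 = ∑ z, (a z * (u z * e z)
        - b z * (u z * e (z + 1)) - b z * (u (z + 1) * e z)) - μ * ∑ z, u z * e z := by
      simp only [Finset.sum_sub_distrib]
      rw [h4, Finset.mul_sum]
      simp only [← Finset.sum_sub_distrib]
      refine Finset.sum_congr rfl fun z _ => ?_
      rw [sq]; nth_rewrite 1 [he]
      ring
    rw [h2, h3, huμ, hu1] at h1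
    rw [h5]
    linarith
  have he0 : ∀ z, e z = 0 := fun z => by
    have h1 := eq_zero_of_forall_quadratic_nonneg hquad
    have := (Finset.sum_eq_zero_iff_of_nonneg fun z _ => sq_nonneg (e z)).1 h1 z (Finset.mem_univ z)
    simpa using this
  have hnn : ∀ z, 0 ≤ u z := fun z => abs_nonneg _
  -- At a zero of u the equation says that two nonnegative terms add up to zero. One zero thus
  -- spreads over the whole cycle, against u having norm one.
  have hprop : ∀ z, u z = 0 → u (z + 1) = 0 := fun z hz => by
    have h1 := he0 z
    simp only [he, hz, mul_zero, zero_sub, sub_zero] at h1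
    have h2 := mul_nonneg (hb (z - 1)).le (hnn (z - 1))
    have h3 := mul_nonneg (hb z).le (hnn (z + 1))
    exact (mul_eq_zero.1 (by linarith : b z * u (z + 1) = 0)).resolve_left (hb z).ne'
  refine ⟨μ, u, fun z => (hnn z).lt_of_ne fun h0 => ?_, fun z => sub_eq_zero.1 (he0 z)⟩
  have hall : ∀ n : ℕ, u (z + n) = 0 := fun n => by
    induction n with
    | zero => simpa using h0.symm
    | succ n ih => rw [Nat.cast_succ, ← add_assoc]; exact hprop _ ih
  have hall' : ∀ y, u y = 0 := fun y => by
    have := hall (y - z).val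
    rwa [ZMod.natCast_val, ZMod.cast_id', id, add_sub_cancel] at this
  have : nsq u = 0 := by simp [nsq, hall']
  rw [hu1] at this
  exact one_ne_zero this

/-! ### Variations of maximal segments -/

variable {γ : UnitAddCircle → Plane}

/-- The segment `(Y j, …, Y k)` is longest among those with the same end points. -/
def IsLongest (γ : UnitAddCircle → Plane) (Y : ℤ → ℝ) (j k : ℤ) : Prop :=
  ∀ Z : ℤ → ℝ, (∀ i ∈ Finset.Ico j k, Admissible (Z i) (Z (i + 1))) →
    Z j = Y j → Z k = Y k → segmentLength γ Z j k ≤ segmentLength γ Y j k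

/-- Consecutive bounces are distinct. -/
def StrictlyAdmissible (Y : ℤ → ℝ) : Prop := ∀ i, Y i < Y (i + 1) ∧ Y (i + 1) < Y i + 1

lemma coe_ne_of_lt {x y : ℝ} (h : x < y) (h' : y < x + 1) : (y : UnitAddCircle) ≠ x := by
  rw [Ne, coe_eq_coe_iff]
  rintro ⟨m, hm⟩
  have h1 : (0 : ℝ) < m := by linarith
  have h2 : (m : ℝ) < 1 := by linarith
  have h3 : (0 : ℤ) < m := by exact_mod_cast h1
  have h4 : m < (1 : ℤ) := by exact_mod_cast h2
  omega

lemma eventually_strictlyAdmissible {Y ξ : ℤ → ℝ} (hY : StrictlyAdmissible Y) (j k : ℤ) :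
    ∀ᶠ t : ℝ in 𝓝 0, ∀ i ∈ Finset.Ico j k, Y i + t * ξ i < Y (i + 1) + t * ξ (i + 1) ∧
      Y (i + 1) + t * ξ (i + 1) < Y i + t * ξ i + 1 := by
  rw [Filter.eventually_all_finset]
  intro i _
  have c1 : Continuous fun t : ℝ => Y i + t * ξ i := by fun_prop
  have c2 : Continuous fun t : ℝ => Y (i + 1) + t * ξ (i + 1) := by fun_prop
  have c3 : Continuous fun t : ℝ => Y i + t * ξ i + 1 := by fun_prop
  refine (c1.continuousAt.eventually_lt c2.continuousAt ?_).and
    (c2.continuousAt.eventually_lt c3.continuousAt ?_)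
  · simpa using (hY i).1
  · simpa using (hY i).2

/-- Strict admissibility is an open condition on finitely many bounces, so small variations with
fixed ends are legitimate competitors. -/
lemma IsLongest.isLocalMax {Y ξ : ℤ → ℝ} {j k : ℤ} (h : IsLongest γ Y j k)
    (hY : StrictlyAdmissible Y) (hj : ξ j = 0) (hk : ξ k = 0) :
    IsLocalMax (fun t : ℝ => segmentLength γ (fun i => Y i + t * ξ i) j k) 0 := by
  filter_upwards [eventually_strictlyAdmissible (ξ := ξ) hY j k] with t ht
  have h0 : (fun i => Y i + 0 * ξ i) = Y := by funext i; ring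
  rw [h0]
  exact h _ (fun i hi => ⟨(ht i hi).1.le, (ht i hi).2.le⟩) (by simp [hj]) (by simp [hk])

namespace IsStronglyConvexTable

variable (hγ : IsStronglyConvexTable γ)
include hγ

lemma hasDerivAt_segmentLength {Y ξ : ℤ → ℝ} {j k : ℤ} {t : ℝ}
    (ht : ∀ i ∈ Finset.Ico j k, Y i + t * ξ i < Y (i + 1) + t * ξ (i + 1) ∧
      Y (i + 1) + t * ξ (i + 1) < Y i + t * ξ i + 1) :
    HasDerivAt (fun t : ℝ => segmentLength γ (fun i => Y i + t * ξ i) j k)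
      (∑ i ∈ Finset.Ico j k, (chordDeriv γ (Y i + t * ξ i) (Y (i + 1) + t * ξ (i + 1)) * ξ i
        + chordDeriv γ (Y (i + 1) + t * ξ (i + 1)) (Y i + t * ξ i) * ξ (i + 1))) t := by
  have hd : ∀ i, HasDerivAt (fun t : ℝ => Y i + t * ξ i) (ξ i) t := fun i => by
    simpa using ((hasDerivAt_id t).mul_const (ξ i)).const_add (Y i)
  exact HasDerivAt.fun_sum fun i hi => hγ.hasDerivAt_chord (hd i) (hd (i + 1))
    (coe_ne_of_lt (ht i hi).1 (ht i hi).2)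

lemma first_variation {Y ξ : ℤ → ℝ} {j k : ℤ} (h : IsLongest γ Y j k)
    (hY : StrictlyAdmissible Y) (hj : ξ j = 0) (hk : ξ k = 0) :
    ∑ i ∈ Finset.Ico j k, (chordDeriv γ (Y i) (Y (i + 1)) * ξ i
        + chordDeriv γ (Y (i + 1)) (Y i) * ξ (i + 1)) = 0 := by
  have := (h.isLocalMax hY hj hk).hasDerivAt_eq_zero
    (hγ.hasDerivAt_segmentLength (eventually_strictlyAdmissible hY j k).self_of_nhds)
  simpa using this

/-- The inner bounces of a longest segment satisfy the Euler-Lagrange equation. -/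
lemma euler_lagrange {Y : ℤ → ℝ} {i j k : ℤ} (h : IsLongest γ Y j k)
    (hY : StrictlyAdmissible Y) (hij : j < i) (hik : i < k) :
    chordDeriv γ (Y i) (Y (i - 1)) + chordDeriv γ (Y i) (Y (i + 1)) = 0 := by
  have h1 := hγ.first_variation (ξ := fun l => if l = i then 1 else 0) h hY
    (if_neg hij.ne) (if_neg hik.ne')
  simp only [Finset.sum_add_distrib, mul_ite, mul_one, mul_zero] at h1
  have e : ∀ l : ℤ, l + 1 = i ↔ l = i - 1 := fun l => by omega
  simp only [e] at h1
  rw [Finset.sum_ite_eq', Finset.sum_ite_eq', if_pos (by rw [Finset.mem_Ico]; omega),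
    if_pos (by rw [Finset.mem_Ico]; omega), sub_add_cancel] at h1
  linarith

lemma second_variation {Y ξ : ℤ → ℝ} {j k : ℤ} (h : IsLongest γ Y j k)
    (hY : StrictlyAdmissible Y) (hj : ξ j = 0) (hk : ξ k = 0) :
    ∑ i ∈ Finset.Ico j k, (chordDeriv₁ γ (Y i) (Y (i + 1)) * ξ i ^ 2
      + 2 * chordDeriv₂ γ (Y i) (Y (i + 1)) * (ξ i * ξ (i + 1))
      + chordDeriv₁ γ (Y (i + 1)) (Y i) * ξ (i + 1) ^ 2) ≤ 0 := by
  have hev := eventually_strictlyAdmissible (ξ := ξ) hY j k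
  refine deriv2_nonpos_of_isLocalMax (h.isLocalMax hY hj hk)
    (hev.mono fun t ht => hγ.hasDerivAt_segmentLength ht) (HasDerivAt.fun_sum fun i hi => ?_)
  have hd : ∀ i, HasDerivAt (fun t : ℝ => Y i + t * ξ i) (ξ i) 0 := fun i => by
    simpa using ((hasDerivAt_id (0 : ℝ)).mul_const (ξ i)).const_add (Y i)
  have hne : (Y (i + 1) : UnitAddCircle) ≠ Y i := coe_ne_of_lt (hY i).1 (hY i).2
  have key : ∀ a b : ℤ, (Y b : UnitAddCircle) ≠ Y a →
      HasDerivAt (fun t : ℝ => chordDeriv γ (Y a + t * ξ a) (Y b + t * ξ b))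
        (chordDeriv₁ γ (Y a) (Y b) * ξ a + chordDeriv₂ γ (Y a) (Y b) * ξ b) 0 := by
    intro a b hab
    have h1 := (hγ.hasStrictFDerivAt_chordDeriv hab).hasFDerivAt
    have e : (Y a, Y b) = (Y a + 0 * ξ a, Y b + 0 * ξ b) := by simp
    rw [e] at h1
    have h2 := HasFDerivAt.comp_hasDerivAt (f := fun t : ℝ => (Y a + t * ξ a, Y b + t * ξ b)) 0 h1
      ((hd a).prodMk (hd b))
    exact h2.congr_deriv (by simp)
  have h1 := ((key i (i + 1) hne).mul_const (ξ i)).add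
    ((key (i + 1) i hne.symm).mul_const (ξ (i + 1)))
  refine h1.congr_deriv ?_
  rw [hγ.chordDeriv₂_symm hne]
  ring

end IsStronglyConvexTable

end Billiard

namespace Billiard

variable {γ : UnitAddCircle → Plane}

/-! ### Periodic Jacobi fields give the eigenvalue one -/

/-- `ξ` solves the Jacobi equation along the configuration `X`. -/
def IsJacobiField (γ : UnitAddCircle → Plane) (X ξ : ℤ → ℝ) : Prop :=
  ∀ i, (chordDeriv₁ γ (X i) (X (i - 1)) + chordDeriv₁ γ (X i) (X (i + 1))) * ξ i
    + chordDeriv₂ γ (X i) (X (i - 1)) * ξ (i - 1) + chordDeriv₂ γ (X i) (X (i + 1)) * ξ (i + 1) = 0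

/-- The invertible linear map `(x, y) ↦ (x, a x + b y)`. -/
def shearEquiv (a b : ℝ) (hb : b ≠ 0) : (ℝ × ℝ) ≃L[ℝ] (ℝ × ℝ) :=
  ContinuousLinearEquiv.equivOfInverse
    ((ContinuousLinearMap.fst ℝ ℝ ℝ).prod (linForm a b))
    ((ContinuousLinearMap.fst ℝ ℝ ℝ).prod (linForm (-a / b) (1 / b)))
    (fun z => by ext <;> simp; field_simp; ring)
    (fun z => by ext <;> simp; field_simp; ring)

/-- Inverse function theorem for (y, z) ↦ (y, D (y, z)), invertible because b ≠ 0. It solves D (y t,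
z t) = g t for z; the linearized equation fixes the derivative of z. -/
lemma HasStrictFDerivAt.exists_solution {D : ℝ × ℝ → ℝ} {Y Z a b : ℝ}
    (hD : HasStrictFDerivAt D (linForm a b) (Y, Z)) (hb : b ≠ 0) {y g : ℝ → ℝ} {ξ β ζ : ℝ}
    (hy : HasDerivAt y ξ 0) (hy0 : y 0 = Y) (hg : HasDerivAt g β 0) (hg0 : g 0 = D (Y, Z))
    (hζ : a * ξ + b * ζ = β) :
    ∃ z : ℝ → ℝ, z 0 = Z ∧ HasDerivAt z ζ 0 ∧ ∀ᶠ t in 𝓝 0, D (y t, z t) = g t := by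
  let H : ℝ × ℝ → ℝ × ℝ := fun p => (p.1, D p)
  have hH : HasStrictFDerivAt H (shearEquiv a b hb : ℝ × ℝ →L[ℝ] ℝ × ℝ) (Y, Z) :=
    hasStrictFDerivAt_fst.prodMk hD
  set inv := hH.localInverse H (shearEquiv a b hb) (Y, Z)
  have hinv0 : inv (Y, D (Y, Z)) = (Y, Z) := hH.localInverse_apply_image
  have hinv : HasFDerivAt inv ((shearEquiv a b hb).symm : ℝ × ℝ →L[ℝ] ℝ × ℝ) (Y, D (Y, Z)) :=
    hH.to_localInverse.hasFDerivAt
  have hright : ∀ᶠ p in 𝓝 (Y, D (Y, Z)), H (inv p) = p := hH.eventually_right_inverse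
  have hyg : HasDerivAt (fun t => (y t, g t)) (ξ, β) 0 := hy.prodMk hg
  have e0 : (Y, D (Y, Z)) = (y 0, g 0) := by rw [hy0, hg0]
  refine ⟨fun t => (inv (y t, g t)).2, ?_, ?_, ?_⟩
  · simp only [← e0, hinv0]
  · rw [e0] at hinv
    have h1 := HasFDerivAt.comp_hasDerivAt (f := fun t => (y t, g t)) 0 hinv hyg
    have h2 := HasFDerivAt.comp_hasDerivAt (f := inv ∘ fun t => (y t, g t)) 0
      (ContinuousLinearMap.snd ℝ ℝ ℝ).hasFDerivAt h1
    refine h2.congr_deriv ?_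
    change (linForm (-a / b) (1 / b)) (ξ, β) = ζ
    rw [linForm_apply, ← hζ]
    field_simp; ring
  · have hc : Tendsto (fun t => (y t, g t)) (𝓝 0) (𝓝 (Y, D (Y, Z))) := by
      rw [e0]; exact hyg.continuousAt
    filter_upwards [hc.eventually hright] with t ht
    have h1 : (inv (y t, g t)).1 = y t := congrArg Prod.fst ht
    have h2 : D (inv (y t, g t)) = g t := congrArg Prod.snd ht
    have h3 : (y t, (inv (y t, g t)).2) = inv (y t, g t) := Prod.ext h1.symm rfl
    rw [h3, h2]

lemma eventually_coe_ne {x y : ℝ → ℝ} (hx : ContinuousAt x 0) (hy : ContinuousAt y 0)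
    (h : (y 0 : UnitAddCircle) ≠ x 0) : ∀ᶠ t in 𝓝 0, (y t : UnitAddCircle) ≠ x t := by
  have hc : Continuous fun x : ℝ => (x : UnitAddCircle) := AddCircle.continuous_mk' 1
  exact ((hc.continuousAt.comp hy).prodMk (hc.continuousAt.comp hx)).eventually
    (isClosed_diagonal.isOpen_compl.mem_nhds h)

namespace IsStronglyConvexTable

variable (hγ : IsStronglyConvexTable γ)
include hγ

/-- A Jacobi field is the derivative of a variation through billiard orbits. -/
lemma exists_variation {X ξ : ℤ → ℝ} (hne : ∀ i, (X (i + 1) : UnitAddCircle) ≠ X i)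
    (hel : ∀ i, chordDeriv γ (X i) (X (i - 1)) + chordDeriv γ (X i) (X (i + 1)) = 0)
    (hξ : IsJacobiField γ X ξ) (n : ℕ) : ∃ x y : ℝ → ℝ, x 0 = X n ∧ y 0 = X (n + 1) ∧
      HasDerivAt x (ξ n) 0 ∧ HasDerivAt y (ξ (n + 1)) 0 ∧
      ∀ᶠ t : ℝ in 𝓝 0, (billiardMap γ)^[n]
        (phase γ ((X 0 + t * ξ 0 : ℝ) : UnitAddCircle) ((X 1 + t * ξ 1 : ℝ) : UnitAddCircle))
          = phase γ (x t) (y t) := by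
  induction n with
  | zero =>
    refine ⟨fun t => X 0 + t * ξ 0, fun t => X 1 + t * ξ 1, by simp, by simp, ?_, ?_,
      Eventually.of_forall fun t => rfl⟩
    · simpa using ((hasDerivAt_id (0 : ℝ)).mul_const (ξ 0)).const_add (X 0)
    · simpa using ((hasDerivAt_id (0 : ℝ)).mul_const (ξ 1)).const_add (X 1)
  | succ n ih =>
    obtain ⟨x, y, hx0, hy0, hx, hy, hxy⟩ := ih
    have hne1 : (X n : UnitAddCircle) ≠ X (n + 1) := (hne n).symm
    have hne2 : (X (n + 1 + 1) : UnitAddCircle) ≠ X (n + 1) := hne (n + 1)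
    have hg : HasDerivAt (fun t => -chordDeriv γ (y t) (x t))
        (-(chordDeriv₁ γ (X (n + 1)) (X n) * ξ (n + 1) + chordDeriv₂ γ (X (n + 1)) (X n) * ξ n)) 0 := by
      have h1 := (hγ.hasStrictFDerivAt_chordDeriv hne1).hasFDerivAt
      rw [← hx0, ← hy0] at h1
      have h2 := HasFDerivAt.comp_hasDerivAt (f := fun t : ℝ => (y t, x t)) 0 h1 (hy.prodMk hx)
      refine h2.neg.congr_deriv ?_
      simp [hx0, hy0]
    have hE := hel (n + 1)
    have hJ := hξ (n + 1)
    rw [add_sub_cancel_right] at hE hJ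
    -- The next bounce z is found from the reflection law at y; the linearized law is the Jacobi
    -- equation, so its derivative is the next value of ξ.
    obtain ⟨z, hz0, hz, hyz⟩ := HasStrictFDerivAt.exists_solution
      (hγ.hasStrictFDerivAt_chordDeriv hne2) (hγ.chordDeriv₂_pos hne2).ne' hy hy0 hg
      (by simp only [hx0, hy0]; linarith) (ζ := ξ (n + 1 + 1)) (by linarith)
    refine ⟨y, z, by simpa using hy0, by simpa using hz0, by simpa using hy, by simpa using hz, ?_⟩
    filter_upwards [hxy, hyz, eventually_coe_ne hx.continuousAt hy.continuousAt
      (by rw [hx0, hy0]; exact hne1.symm), eventually_coe_ne hy.continuousAt hz.continuousAt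
      (by rw [hy0, hz0]; exact hne2)] with t h1 h2 h3 h4
    rw [Function.iterate_succ_apply', h1, hγ.billiardMap_phase_iff h3.symm h4]
    linarith

/-- A periodic Jacobi field that does not vanish at `0` is an eigenvector of the differential of the
return map, with eigenvalue one. -/
lemma not_hyperbolic_of_isJacobiField {X ξ : ℤ → ℝ} {q : ℕ} {p : ℤ}
    (hne : ∀ i, (X (i + 1) : UnitAddCircle) ≠ X i)
    (hel : ∀ i, chordDeriv γ (X i) (X (i - 1)) + chordDeriv γ (X i) (X (i + 1)) = 0)
    (hX : ∀ i, X (i + q) = X i + p) (hξ : IsJacobiField γ X ξ) (hξq : ∀ i, ξ (i + q) = ξ i)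
    (hξ0 : ξ 0 ≠ 0) : ¬ IsHyperbolicPeriodicPoint γ q (phase γ (X 0) (X 1)) := by
  rintro ⟨-, -, L, ⟨-, s, G, hs, hG, hGL⟩, hL⟩
  obtain ⟨x, y, hx0, hy0, hx, hy, hxy⟩ := hγ.exists_variation hne hel hξ q
  have eX0 : X q = X 0 + p := by have := hX 0; rwa [zero_add] at this
  have eX1 : X (q + 1) = X 1 + p := by have := hX 1; rwa [add_comm] at this
  have eξ0 : ξ q = ξ 0 := by have := hξq 0; rwa [zero_add] at this
  have eξ1 : ξ (q + 1) = ξ 1 := by have := hξq 1; rwa [add_comm] at this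
  rw [eX0] at hx0
  rw [eX1] at hy0
  rw [eξ0] at hx
  rw [eξ1] at hy
  rw [phase_fst, coe_eq_coe_iff] at hs
  obtain ⟨m, hm⟩ := hs
  have hne0 : (X 1 : UnitAddCircle) ≠ X 0 := by simpa using hne 0
  obtain ⟨a, b, hab⟩ := hγ.exists_hasStrictFDerivAt_angle hne0
  have hangle : ∀ {x y : ℝ → ℝ}, x 0 = X 0 → y 0 = X 1 → HasDerivAt x (ξ 0) 0 →
      HasDerivAt y (ξ 1) 0 →
      HasDerivAt (fun t => angle γ (x t) (y t)) (a * ξ 0 + b * ξ 1) 0 := by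
    intro x y hx0 hy0 hx hy
    have h1 := hab.hasFDerivAt
    rw [← hx0, ← hy0] at h1
    exact (HasFDerivAt.comp_hasDerivAt (f := fun t : ℝ => (x t, y t)) 0 h1
      (hx.prodMk hy)).congr_deriv (by simp)
  have hlin : ∀ i, HasDerivAt (fun t : ℝ => X i + t * ξ i) (ξ i) 0 := fun i => by
    simpa using ((hasDerivAt_id (0 : ℝ)).mul_const (ξ i)).const_add (X i)
  -- the curve of initial conditions
  let z : ℝ → ℝ × ℝ := fun t => (X 0 + t * ξ 0 + m, angle γ (X 0 + t * ξ 0) (X 1 + t * ξ 1))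
  have hz0 : z 0 = (s, ((phase γ (X 0) (X 1)).2 : ℝ)) := by
    simp [z, hm, phase_snd]
  have hz : HasDerivAt z (ξ 0, a * ξ 0 + b * ξ 1) 0 :=
    ((hlin 0).add_const _).prodMk (hangle (by simp) (by simp) (hlin 0) (hlin 1))
  have hcover : ∀ t, cover (z t) = phase γ ((X 0 + t * ξ 0 : ℝ) : UnitAddCircle)
      ((X 1 + t * ξ 1 : ℝ) : UnitAddCircle) := fun t => by
    rw [← cover_angle]
    refine Prod.ext ?_ rfl
    exact coe_add_intCast _ _
  rw [← hz0] at hG hGL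
  have hGz := HasFDerivAt.comp_hasDerivAt (f := z) 0 hGL hz
  set v : ℝ × ℝ := (ξ 0, a * ξ 0 + b * ξ 1)
  have hev : ∀ᶠ t in 𝓝 0, ((G (z t)).1 : UnitAddCircle) = x t ∧
      (G (z t)).2 = angle γ (x t) (y t) := by
    filter_upwards [hz.continuousAt.eventually hG, hxy] with t h1 h2
    rw [hcover, h2] at h1
    rw [h1.2, phase_snd]
    exact ⟨h1.1, rfl⟩
  have hv2 : (L v).2 = v.2 := by
    have h1 : HasDerivAt (fun t => (G (z t)).2) (L v).2 0 :=
      HasFDerivAt.comp_hasDerivAt (f := G ∘ z) 0 (ContinuousLinearMap.snd ℝ ℝ ℝ).hasFDerivAt hGz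
    have h2 : HasDerivAt (fun t => angle γ (x t) (y t)) v.2 0 := by
      have h3 := hangle (x := fun t => x t - p) (y := fun t => y t - p) (by rw [hx0]; ring)
        (by rw [hy0]; ring) (hx.sub_const _) (hy.sub_const _)
      refine h3.congr_of_eventuallyEq (Eventually.of_forall fun t => ?_)
      have := angle_add_intCast (γ := γ) (x t - p) (y t - p) p p
      rwa [sub_add_cancel, sub_add_cancel] at this
    exact h1.unique (h2.congr_of_eventuallyEq (hev.mono fun t ht => ht.2))
  have hv1 : (L v).1 = v.1 := by
    have h1 : HasDerivAt (fun t => (G (z t)).1 - x t) ((L v).1 - ξ 0) 0 :=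
      (HasFDerivAt.comp_hasDerivAt (f := G ∘ z) 0
        (ContinuousLinearMap.fst ℝ ℝ ℝ).hasFDerivAt hGz).sub hx
    -- The lift G and the bounce x agree only modulo one. Their difference is integer valued and
    -- continuous at 0, hence locally constant, so the derivatives agree.
    have hint : ∀ᶠ t in 𝓝 0, ∃ n : ℤ, (G (z t)).1 - x t = n := hev.mono fun t ht => by
      obtain ⟨n, hn⟩ := (coe_eq_coe_iff _ _).1 ht.1
      exact ⟨n, by linarith⟩
    obtain ⟨n₀, hn₀⟩ := hint.self_of_nhds
    have hconst : (fun t => (G (z t)).1 - x t) =ᶠ[𝓝 0] fun _ => (n₀ : ℝ) := by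
      have hball := h1.continuousAt.eventually (Metric.ball_mem_nhds _ one_pos)
      filter_upwards [hint, hball] with t ht hb
      obtain ⟨n, hn⟩ := ht
      have hb : dist ((G (z t)).1 - x t) ((G (z 0)).1 - x 0) < 1 := hb
      rw [hn, hn₀, Real.dist_eq] at hb
      have h3 : |n - n₀| < 1 := by exact_mod_cast hb
      rw [Int.abs_lt_one_iff, sub_eq_zero] at h3
      rw [hn, h3]
    have h2 := h1.unique ((hasDerivAt_const (0 : ℝ) (n₀ : ℝ)).congr_of_eventuallyEq hconst)
    exact sub_eq_zero.1 h2
  have hLv : L v = v := Prod.ext hv1 hv2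
  have hv : v ≠ 0 := fun h => hξ0 (congrArg Prod.fst h)
  have heig : Module.End.HasEigenvalue (L : (ℝ × ℝ) →ₗ[ℝ] (ℝ × ℝ)) 1 :=
    Module.End.hasEigenvalue_of_hasEigenvector (x := v)
      ⟨by rw [Module.End.mem_eigenspace_iff, one_smul]; exact hLv, hv⟩
  rw [Module.End.hasEigenvalue_iff_isRoot_charpoly] at heig
  refine hL 1 ?_ (by simp)
  have h1 := Polynomial.aeval_algebraMap_apply ℂ (1 : ℝ)
    (L : (ℝ × ℝ) →ₗ[ℝ] (ℝ × ℝ)).charpoly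
  rw [map_one] at h1
  rw [h1, Polynomial.coe_aeval_eq_eval, Polynomial.IsRoot.def.1 heig, map_zero]

end IsStronglyConvexTable

end Billiard

namespace Billiard

variable {γ : UnitAddCircle → Plane}

/-! ### Sums over integer segments -/

lemma sum_Ico_add_natCast (f : ℤ → ℝ) (j : ℤ) (n : ℕ) :
    ∑ i ∈ Finset.Ico j (j + n), f i = ∑ k ∈ Finset.range n, f (j + k) := by
  refine Finset.sum_nbij' (fun i => (i - j).toNat) (fun k => j + k) ?_ ?_ ?_ ?_ ?_
  · intro i hi; rw [Finset.mem_Ico] at hi; rw [Finset.mem_range]; omega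
  · intro k hk; rw [Finset.mem_range] at hk; rw [Finset.mem_Ico]; omega
  · intro i hi; rw [Finset.mem_Ico] at hi; omega
  · intro k _; omega
  · intro i hi; rw [Finset.mem_Ico] at hi; congr 1; omega

lemma sum_range_periodic {f : ℤ → ℝ} {q : ℕ} (hf : ∀ i, f (i + q) = f i) (i : ℤ) :
    ∑ k ∈ Finset.range q, f (i + k) = ∑ k ∈ Finset.range q, f k := by
  have step : ∀ i : ℤ, ∑ k ∈ Finset.range q, f (i + 1 + k) = ∑ k ∈ Finset.range q, f (i + k) := by
    intro i
    have h1 := Finset.sum_range_succ (fun k : ℕ => f (i + k)) q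
    have h2 := Finset.sum_range_succ' (fun k : ℕ => f (i + k)) q
    have h3 : ∀ k : ℕ, f (i + (k + 1 : ℕ)) = f (i + 1 + k) := fun k => by push_cast; ring_nf
    simp only [h3, hf, Nat.cast_zero, add_zero] at h1 h2
    linarith
  induction i using Int.induction_on with
  | zero => simp
  | succ n ih => rw [step, ih]
  | pred n ih => rw [← ih, ← step, sub_add_cancel]

/-! ### From minimality and hyperbolicity to a strict supersolution. -/

namespace IsStronglyConvexTable

variable (hγ : IsStronglyConvexTable γ)
include hγ

lemma dvd_of_iter_eq {P : Annulus} {n : ℤ} (h : iter γ n P = P) :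
    (Function.minimalPeriod (billiardMap γ) P : ℤ) ∣ n := by
  have hneg : iter γ (-n) P = P := by
    conv_lhs => rw [← h]
    rw [← hγ.iter_add, neg_add_cancel, iter_zero]
  have habs : iter γ (n.natAbs : ℤ) P = P := by
    rcases Int.natAbs_eq n with h' | h'
    · rwa [← h']
    · rwa [show (n.natAbs : ℤ) = -n by omega]
  rw [Int.natCast_dvd]
  exact Function.IsPeriodicPt.minimalPeriod_dvd (show (billiardMap γ)^[n.natAbs] P = P from habs)

/-- The orbit of an interior point is given by the chords between consecutive bounces. -/
lemma iter_eq_phase {P : Annulus} (hP : |(P.2 : ℝ)| < Real.pi / 2) (i : ℤ) :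
    (iter γ (i + 1) P).1 ≠ (iter γ i P).1 ∧
      iter γ i P = phase γ (iter γ i P).1 (iter γ (i + 1) P).1 := by
  rcases hγ.boundary_or_phase (iter γ i P) with h | ⟨θ', hne, h⟩
  · exfalso
    have h1 : hγ.perm (iter γ i P) = iter γ i P := hγ.billiardMap_of_abs_eq h
    have h2 := Equiv.Perm.zpow_apply_eq_self_of_apply_eq_self h1 (-i)
    rw [← hγ.iter_eq, ← hγ.iter_add, neg_add_cancel, iter_zero] at h2
    rw [← h2] at h
    exact hP.ne h
  · have h1 : (iter γ (i + 1) P).1 = θ' := by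
      rw [hγ.iter_succ, h, hγ.billiardMap_phase hne]; rfl
    rw [h1]
    exact ⟨hne, h⟩

/-- Distinct points of a minimal periodic orbit have distinct first coordinates. -/
lemma minimal_inj {X : ℤ → ℝ} {P : Annulus} {q : ℕ} {p : ℤ} (hq : 0 < q)
    (hX : ∀ i, iter γ i P = phase γ (X i) (X (i + 1))) (hadm : StrictlyAdmissible X)
    (hlong : ∀ j k, j < k → IsLongest γ X j k) (hper : ∀ i, X (i + q) = X i + p)
    (hPq : Function.minimalPeriod (billiardMap γ) P = q) {i j : ℤ}
    (hij : (X i : UnitAddCircle) = X j) : (q : ℤ) ∣ i - j := by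
  obtain ⟨m, hm⟩ := (coe_eq_coe_iff _ _).1 hij.symm
  obtain ⟨n, rfl⟩ : ∃ n, j = i + n := ⟨j - i, by ring⟩
  -- follow the orbit up to bounce `i` and its translate afterwards
  set Y : ℤ → ℝ := fun l => if l < i then X l else X (l + n) - m with hY
  have hYlt : ∀ l, l < i → Y l = X l := fun l hl => if_pos hl
  have hYge : ∀ l, i ≤ l → Y l = X (l + n) - m := fun l hl => if_neg (not_lt.2 hl)
  have hYi : Y i = X i := by rw [hYge i le_rfl, hm]; ring
  have hYadm : StrictlyAdmissible Y := by
    intro l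
    rcases lt_trichotomy (l + 1) i with h | h | h
    · rw [hYlt l (by omega), hYlt _ h]; exact hadm l
    · have h2 := hadm l
      rw [h] at h2
      rw [hYlt l (by omega), h, hYi]
      exact h2
    · have h2 := hadm (l + n)
      rw [hYge l (by omega), hYge (l + 1) (by omega), show l + 1 + n = l + n + 1 by ring]
      constructor <;> linarith [h2.1, h2.2]
  have hYend : Y (i + q) = X (i + q) := by
    rw [hYge _ (by omega), show i + q + n = i + n + q by ring, hper, hper, hm]; ring
  have hchord : ∀ k : ℤ, chord γ (X (k + q)) (X (k + q + 1)) = chord γ (X k) (X (k + 1)) := fun k => by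
    have e : k + q + 1 = k + 1 + q := by ring
    simp only [chord, e, hper, coe_add_intCast]
  -- Both segments consist of the chord that arrives at bounce i followed by one full period of
  -- chords.
  have hlen : segmentLength γ Y (i - 1) (i + q) = segmentLength γ X (i - 1) (i + q) := by
    have e : i + (q : ℤ) = i - 1 + (q + 1 : ℕ) := by push_cast; ring
    have e' : ∀ k : ℕ, i - 1 + ((k + 1 : ℕ) : ℤ) = i + k := fun k => by push_cast; ring
    rw [segmentLength, segmentLength, e, sum_Ico_add_natCast, sum_Ico_add_natCast,
      Finset.sum_range_succ', Finset.sum_range_succ']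
    simp only [e', Nat.cast_zero, add_zero, sub_add_cancel]
    rw [hYlt (i - 1) (by omega), hYi]
    congr 1
    have h1 : ∀ k : ℕ, chord γ (Y (i + k)) (Y (i + k + 1))
        = chord γ (X (i + n + k)) (X (i + n + k + 1)) := fun k => by
      rw [hYge _ (by omega), hYge _ (by omega), show i + k + n = i + n + k by ring,
        show i + k + 1 + n = i + n + k + 1 by ring]
      simp only [chord, sub_eq_add_neg, ← Int.cast_neg, coe_add_intCast]
    simp only [h1]
    rw [sum_range_periodic (f := fun k => chord γ (X k) (X (k + 1))) hchord,
      sum_range_periodic (f := fun k => chord γ (X k) (X (k + 1))) hchord]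
  have hYlong : IsLongest γ Y (i - 1) (i + q) := by
    intro Z hZ h1 h2
    rw [hlen]
    refine hlong _ _ (by omega) Z hZ ?_ ?_
    · rw [h1, hYlt _ (by omega)]
    · rw [h2, hYend]
  -- Being longest, Y obeys the reflection law at the junction: the ray arriving at bounce i leaves
  -- as the orbit does at time i + n. Hence the phase points at these two times coincide.
  have hEL := hγ.euler_lagrange hYlong hYadm (i := i) (by omega) (by omega)
  have n1 := coe_ne_of_lt (hYadm (i - 1)).1 (hYadm (i - 1)).2
  have n2 := coe_ne_of_lt (hYadm i).1 (hYadm i).2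
  rw [sub_add_cancel] at n1
  rw [← hγ.billiardMap_phase_iff n1.symm n2, hYi, hYlt (i - 1) (by omega), hYge (i + 1) (by omega)]
    at hEL
  have h3 := hX (i - 1)
  rw [sub_add_cancel] at h3
  rw [← h3, ← hγ.iter_succ, sub_add_cancel] at hEL
  have h4 : phase γ (X i) ((X (i + 1 + n) - m : ℝ) : UnitAddCircle) = iter γ (i + n) P := by
    rw [hX, hij, show i + 1 + n = i + n + 1 by ring, sub_eq_add_neg, ← Int.cast_neg,
      coe_add_intCast]
  rw [h4, hγ.iter_add] at hEL
  have h5 := hγ.dvd_of_iter_eq (hγ.iter_injective i hEL).symm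
  rw [hPq] at h5
  rw [show i - (i + n) = -n by ring]
  exact h5.neg_right

/-- The Jacobi operator of a minimal periodic configuration is nonnegative. -/
lemma ground_state_nonneg {X w : ℤ → ℝ} {q : ℕ} {p : ℤ} {μ c : ℝ} (hq : 0 < q)
    (hadm : StrictlyAdmissible X) (hlong : ∀ j k, j < k → IsLongest γ X j k)
    (hper : ∀ i, X (i + q) = X i + p) (hw : ∀ i, w (i + q) = w i) (hc : 0 < c)
    (hcw : ∀ i, c ≤ w i)
    (hμ : ∀ i, (chordDeriv₁ γ (X i) (X (i - 1)) + chordDeriv₁ γ (X i) (X (i + 1))) * w i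
      + chordDeriv₂ γ (X i) (X (i - 1)) * w (i - 1) + chordDeriv₂ γ (X i) (X (i + 1)) * w (i + 1)
        = -μ * w i) : 0 ≤ μ := by
  by_contra! hneg
  have hne : ∀ i, (X (i + 1) : UnitAddCircle) ≠ X i := fun i => coe_ne_of_lt (hadm i).1 (hadm i).2
  set C := chordDeriv₁ γ (X 0) (X (-1)) * w 0 ^ 2 + chordDeriv₁ γ (X 0) (X 1) * w 0 ^ 2 with hC
  -- `T` telescopes the second variation of the ground state
  set T : ℤ → ℝ := fun k => chordDeriv₁ γ (X k) (X (k - 1)) * w k ^ 2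
    + chordDeriv₂ γ (X k) (X (k - 1)) * (w (k - 1) * w k) with hT
  have hperN : ∀ (N : ℕ), X (N * q : ℕ) = X 0 + ((N * p : ℤ) : ℝ) ∧
      X ((N * q : ℕ) + 1) = X 1 + ((N * p : ℤ) : ℝ) ∧
      X ((N * q : ℕ) - 1) = X (-1) + ((N * p : ℤ) : ℝ) ∧ w (N * q : ℕ) = w 0 ∧
      w ((N * q : ℕ) - 1) = w (-1) := by
    have h1 : ∀ (N : ℕ) (i : ℤ), X (i + (N * q : ℕ)) = X i + ((N * p : ℤ) : ℝ) ∧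
        w (i + (N * q : ℕ)) = w i := by
      intro N i
      induction N with
      | zero => simp
      | succ N ih =>
        have e : i + ((N + 1) * q : ℕ) = i + (N * q : ℕ) + q := by push_cast; ring
        rw [e, hper, hw, ih.1, ih.2]
        push_cast
        exact ⟨by ring, rfl⟩
    intro N
    have a0 := h1 N 0
    have a1 := h1 N 1
    have a2 := h1 N (-1)
    rw [zero_add] at a0
    rw [add_comm] at a1
    rw [neg_add_eq_sub] at a2
    exact ⟨a0.1, a1.1, a2.1, a0.2, a2.2⟩
  -- The test variation is w cut off to N periods. Its second variation is -μ times the sum of w²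
  -- plus the boundary terms C, which do not depend on N; for μ < 0 it becomes positive for large N.
  have key : ∀ N : ℕ, C - μ * (N * q * c ^ 2) ≤ 0 := by
    intro N
    obtain ⟨x0, x1, x2, w0, w1⟩ := hperN N
    set n := N * q with hn
    set ξ : ℤ → ℝ := fun k => if 0 ≤ k ∧ k ≤ n then w k else 0 with hξ
    have hin : ∀ k : ℤ, 0 ≤ k → k ≤ n → ξ k = w k := fun k h1 h2 => if_pos ⟨h1, h2⟩
    have hout : ∀ k : ℤ, (k < 0 ∨ n < k) → ξ k = 0 := fun k h => if_neg (by omega)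
    have h := hγ.second_variation (ξ := ξ) (hlong (-1) (-1 + (n + 2 : ℕ)) (by omega)) hadm
      (hout _ (by omega)) (hout _ (by omega))
    rw [sum_Ico_add_natCast, Finset.sum_range_succ, Finset.sum_range_succ'] at h
    have e1 : ∀ k : ℕ, (-1 : ℤ) + (k + 1 : ℕ) = k := fun k => by push_cast; ring
    simp only [e1, Nat.cast_zero, add_zero, neg_add_cancel] at h
    rw [hout (-1) (by omega), hin 0 le_rfl (by omega), hin n (by omega) le_rfl,
      hout (n + 1) (by omega)] at h
    have hsum : ∑ k ∈ Finset.range n, (chordDeriv₁ γ (X (k : ℤ)) (X (k + 1)) * ξ k ^ 2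
        + 2 * chordDeriv₂ γ (X (k : ℤ)) (X (k + 1)) * (ξ k * ξ (k + 1))
        + chordDeriv₁ γ (X ((k : ℤ) + 1)) (X k) * ξ (k + 1) ^ 2)
        = ∑ k ∈ Finset.range n, (-μ * w k ^ 2) + (T n - T 0) := by
      have := Finset.sum_range_sub (fun k : ℕ => T k) n
      rw [Nat.cast_zero] at this
      rw [← this, ← Finset.sum_add_distrib]
      refine Finset.sum_congr rfl fun k hk => ?_
      rw [Finset.mem_range] at hk
      rw [hin k (by omega) (by omega), hin (k + 1) (by omega) (by omega)]
      have h1 := hμ k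
      have h2 := hγ.chordDeriv₂_symm (hne k)
      simp only [hT]
      push_cast
      rw [add_sub_cancel_right, h2]
      linear_combination w (k : ℤ) * h1
    have hTn : T n = T 0 := by
      simp only [hT]
      rw [x0, x2, w0, w1, chordDeriv₁_add_intCast, chordDeriv₂_add_intCast, zero_sub]
    have hlow : -μ * (n * c ^ 2) ≤ ∑ k ∈ Finset.range n, (-μ * w k ^ 2) := by
      rw [← Finset.mul_sum]
      refine mul_le_mul_of_nonneg_left ?_ (by linarith)
      have : ∑ k ∈ Finset.range n, c ^ 2 ≤ ∑ k ∈ Finset.range n, w k ^ 2 :=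
        Finset.sum_le_sum fun k _ => pow_le_pow_left₀ hc.le (hcw k) 2
      simpa using this
    have e2 : chordDeriv₁ γ (X (n : ℤ)) (X (n + 1)) * w n ^ 2
        = chordDeriv₁ γ (X 0) (X 1) * w 0 ^ 2 := by
      rw [x0, x1, w0, chordDeriv₁_add_intCast]
    rw [hsum, hTn, sub_self, add_zero] at h
    have e3 : (n : ℝ) = N * q := by rw [hn]; push_cast; rfl
    rw [e3] at hlow
    linarith
  have hK : 0 < -μ * (q * c ^ 2) := mul_pos (by linarith) (by positivity)
  obtain ⟨N, hN⟩ := exists_nat_gt (-C / (-μ * (q * c ^ 2)))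
  rw [div_lt_iff₀ hK] at hN
  have := key N
  linarith

/-- A hyperbolic minimal periodic orbit carries a strict supersolution. -/
lemma exists_hyperbolicConfig {P : Annulus} {q : ℕ} (hhyp : IsHyperbolicPeriodicPoint γ q P)
    {X : ℤ → ℝ} (hXP : ∀ i : ℤ, (X i : UnitAddCircle) = (iter γ i P).1) (hmin : IsMinimal γ X) :
    ∃ w, HyperbolicConfig γ X w q ∧ ∀ i, iter γ i P = phase γ (X i) (X (i + 1)) := by
  obtain ⟨hq, hPq, hdiff⟩ := id hhyp
  have hint : |(P.2 : ℝ)| < Real.pi / 2 := by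
    obtain ⟨L, hL, -⟩ := hdiff
    exact hL.1
  have hphase : ∀ i, iter γ i P = phase γ (X i) (X (i + 1)) := fun i => by
    rw [hXP, hXP]; exact (hγ.iter_eq_phase hint i).2
  have hne : ∀ i, (X (i + 1) : UnitAddCircle) ≠ X i := fun i => by
    rw [hXP, hXP]; exact (hγ.iter_eq_phase hint i).1
  have hadm : StrictlyAdmissible X := fun i => by
    refine ⟨(hmin.1 i).1.lt_of_ne fun h => hne i (by rw [h]),
      (hmin.1 i).2.lt_of_ne fun h => hne i ?_⟩
    rw [h]; exact_mod_cast coe_add_intCast (X i) 1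
  have hlong : ∀ j k, j < k → IsLongest γ X j k := hmin.2
  have hel : ∀ i, chordDeriv γ (X i) (X (i - 1)) + chordDeriv γ (X i) (X (i + 1)) = 0 := fun i =>
    hγ.euler_lagrange (hlong (i - 1) (i + 1) (by omega)) hadm (by omega) (by omega)
  have hPper : iter γ q P = P := by
    have := Function.iterate_minimalPeriod (f := billiardMap γ) (x := P)
    rwa [hPq] at this
  have hper : ∃ p : ℤ, ∀ i, X (i + q) = X i + p := by
    have h1 : ∀ i : ℤ, ∃ m : ℤ, X (i + q) = X i + m := fun i => by
      rw [← coe_eq_coe_iff, hXP, hXP, hγ.iter_add, hPper]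
    choose m hm using h1
    -- Successive bounces advance by an amount strictly between 0 and 1, both at i and at i + q, so
    -- the two integers differ by less than one.
    have hstep : ∀ i, m (i + 1) = m i := fun i => by
      have a1 := hm i
      have a2 := hm (i + 1)
      have b1 := hadm i
      have b2 := hadm (i + q)
      rw [show i + q + 1 = i + 1 + q by ring] at b2
      have c1 : ((m (i + 1) - m i : ℤ) : ℝ) < 1 := by push_cast; linarith [b1.1, b2.2]
      have c2 : (-1 : ℝ) < ((m (i + 1) - m i : ℤ) : ℝ) := by push_cast; linarith [b1.2, b2.1]
      have c3 : m (i + 1) - m i < 1 := by exact_mod_cast c1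
      have c4 : -1 < m (i + 1) - m i := by exact_mod_cast c2
      omega
    refine ⟨m 0, fun i => ?_⟩
    have : m i = m 0 := by
      induction i using Int.induction_on with
      | zero => rfl
      | succ n ih => rw [hstep, ih]
      | pred n ih => rw [← ih, ← hstep, sub_add_cancel]
    rw [hm, this]
  obtain ⟨p, hp⟩ := hper
  have : NeZero q := ⟨hq.ne'⟩
  -- the periodic Jacobi matrix
  have hcoef : ∀ i, chordDeriv₁ γ (X (i + q)) (X (i + q - 1)) = chordDeriv₁ γ (X i) (X (i - 1)) ∧
      chordDeriv₁ γ (X (i + q)) (X (i + q + 1)) = chordDeriv₁ γ (X i) (X (i + 1)) ∧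
      chordDeriv₂ γ (X (i + q)) (X (i + q + 1)) = chordDeriv₂ γ (X i) (X (i + 1)) := fun i => by
    rw [show i + q - 1 = i - 1 + q by ring, show i + q + 1 = i + 1 + q by ring, hp, hp, hp,
      chordDeriv₁_add_intCast, chordDeriv₁_add_intCast, chordDeriv₂_add_intCast]
    exact ⟨rfl, rfl, rfl⟩
  set A : ℤ → ℝ := fun i =>
    -(chordDeriv₁ γ (X i) (X (i - 1)) + chordDeriv₁ γ (X i) (X (i + 1))) with hA
  set B : ℤ → ℝ := fun i => chordDeriv₂ γ (X i) (X (i + 1)) with hB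
  have hfactor : ∀ F : ℤ → ℝ, (∀ i, F (i + q) = F i) → ∀ i : ℤ, F ((i : ZMod q).val : ℤ) = F i := by
    intro F hF i
    have h1 : Function.Periodic F (q : ℤ) := hF
    rw [ZMod.val_intCast]
    conv_rhs => rw [← Int.emod_add_mul_ediv i q, mul_comm]
    exact (h1.int_mul (i / q) (i % q)).symm
  have hAper : ∀ i, A (i + q) = A i := fun i => by
    simp only [hA, (hcoef i).1, (hcoef i).2.1]
  have hBper : ∀ i, B (i + q) = B i := fun i => (hcoef i).2.2
  obtain ⟨μ, v, hv, hμ⟩ := exists_ground_state (q := q) (fun z => A (z.val : ℤ))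
    (fun z => B (z.val : ℤ)) (fun z => hγ.chordDeriv₂_pos (hne _))
  set w : ℤ → ℝ := fun i => v (i : ZMod q) with hw
  have hwper : ∀ i, w (i + q) = w i := fun i => by simp [hw]
  have heq : ∀ i, (chordDeriv₁ γ (X i) (X (i - 1)) + chordDeriv₁ γ (X i) (X (i + 1))) * w i
      + chordDeriv₂ γ (X i) (X (i - 1)) * w (i - 1) + chordDeriv₂ γ (X i) (X (i + 1)) * w (i + 1)
        = -μ * w i := fun i => by
    have h1 := hμ (i : ZMod q)
    have e1 : (i : ZMod q) - 1 = ((i - 1 : ℤ) : ZMod q) := by push_cast; rfl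
    have e2 : (i : ZMod q) + 1 = ((i + 1 : ℤ) : ZMod q) := by push_cast; rfl
    rw [e1, e2, hfactor A hAper, hfactor B hBper, hfactor B hBper] at h1
    have h2 := hγ.chordDeriv₂_symm (hne (i - 1))
    rw [sub_add_cancel] at h2
    simp only [hA, hB, sub_add_cancel] at h1
    rw [h2]
    simp only [hw]
    linarith
  obtain ⟨z₀, hz₀⟩ := Finite.exists_min v
  have hμ0 : 0 ≤ μ := hγ.ground_state_nonneg hq hadm hlong hp hwper (hv z₀) (fun i => hz₀ _) heq
  -- For μ = 0 the positive vector w would be a periodic Jacobi field, giving the return map the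
  -- eigenvalue one.
  have hμ1 : μ ≠ 0 := by
    rintro rfl
    refine hγ.not_hyperbolic_of_isJacobiField hne hel hp (ξ := w) (fun i => ?_) hwper (hv _).ne' ?_
    · rw [heq]; simp
    · have := hphase 0
      rw [iter_zero, zero_add] at this
      rwa [← this]
  refine ⟨w, ⟨hq, hne, hel, ⟨p, hp⟩, fun i => hv _, hwper, fun i => ?_, fun i j hij =>
    hγ.minimal_inj hq hphase hadm hlong hp hPq hij⟩, hphase⟩
  rw [heq]
  have := mul_pos (hμ0.lt_of_ne' hμ1) (hv (i : ZMod q))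
  simp only [hw]
  linarith

end IsStronglyConvexTable

end Billiard

namespace Billiard

variable {γ : UnitAddCircle → Plane} {X w : ℤ → ℝ} {q : ℕ}

/-! ### Time reversal -/

lemma dist_flip (x y : Annulus) : dist (flip x) (flip y) = dist x y := by
  simp only [Prod.dist_eq, flip_fst, Subtype.dist_eq, flip_snd, dist_neg_neg]

lemma edist_toLp_flip (x y : Annulus) :
    edist (WithLp.toLp 2 (flip x)) (WithLp.toLp 2 (flip y))
      = edist (WithLp.toLp 2 x) (WithLp.toLp 2 y) := by
  have h : edist (flip x).2 (flip y).2 = edist x.2 y.2 := by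
    rw [edist_dist, edist_dist, Subtype.dist_eq, Subtype.dist_eq, flip_snd, flip_snd, dist_neg_neg]
  rw [WithLp.prod_edist_eq_add (by norm_num), WithLp.prod_edist_eq_add (by norm_num)]
  simp only [WithLp.toLp_fst, WithLp.toLp_snd, h, flip_fst]

lemma curveLength_flip (c : ℝ → Annulus) : curveLength (fun t => flip (c t)) = curveLength c := by
  simp only [curveLength, eVariationOn, edist_toLp_flip]

lemma continuous_flip : Continuous flip := by
  have : Isometry flip := Isometry.of_dist_eq dist_flip
  exact this.continuous

/-- Lets the results on forward tails and stable manifolds be applied to backward tails and unstable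
manifolds. -/
lemma HyperbolicConfig.reverse (h : HyperbolicConfig γ X w q) :
    HyperbolicConfig γ (fun i => X (-i)) (fun i => w (-i)) q where
  pos := h.pos
  ne i := by
    have := (h.ne (-(i + 1))).symm
    rwa [show -(i + 1) + 1 = -i by ring] at this
  el i := by
    have := h.el (-i)
    rw [show -i - 1 = -(i + 1) by ring, show -i + 1 = -(i - 1) by ring] at this
    linarith
  period := by
    obtain ⟨p, hp⟩ := h.period
    refine ⟨-p, fun i => ?_⟩
    have := hp (-(i + q))
    rw [show -(i + (q : ℤ)) + q = -i by ring] at this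
    rw [this]; push_cast; ring
  weight_pos i := h.weight_pos _
  weight_period i := by
    have := h.weight_period (-(i + q))
    rw [show -(i + (q : ℤ)) + q = -i by ring] at this
    exact this.symm
  super i := by
    have := h.super (-i)
    rw [show -i - 1 = -(i + 1) by ring, show -i + 1 = -(i - 1) by ring] at this
    linarith
  inj i j hij := by
    have := h.inj _ _ hij
    rw [show -i - -j = -(i - j) by ring] at this
    exact (dvd_neg.1 this)

/-! ### Separation of the bounces -/

namespace HyperbolicConfig

variable (hX : HyperbolicConfig γ X w q)
include hX

lemma weight_congr {i j : ℤ} (h : (q : ℤ) ∣ i - j) : w i = w j := by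
  obtain ⟨n, hn⟩ := h
  have h1 : Function.Periodic w (q : ℤ) := hX.weight_period
  have h2 := h1.int_mul n j
  rw [show i = j + n * q by linarith]
  exact h2

lemma displaced_add_period : ∃ p : ℤ, ∀ i u, displaced X w (i + q) u = displaced X w i u + p := by
  obtain ⟨p, hp⟩ := hX.period
  exact ⟨p, fun i u => by rw [displaced, displaced, hp, hX.weight_period]; ring⟩

lemma coe_displaced_add_period (i : ℤ) (u : ℝ) :
    (displaced X w (i + q) u : UnitAddCircle) = displaced X w i u := by
  obtain ⟨p, hp⟩ := hX.displaced_add_period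
  rw [hp, coe_add_intCast]

lemma exists_weight_lower : ∃ s > 0, ∀ i, s ≤ w i := by
  obtain ⟨s, hs0, -, hs⟩ := exists_uniform_size (R := fun i s => s ≤ w i) hX.pos
    (fun i s => by simp only [hX.weight_period]) (fun i s s' _ h h' => h.trans h')
    (fun i => ⟨w i, hX.weight_pos i, le_rfl⟩)
  exact ⟨s, hs0, hs⟩

/-- Small displacements of bounces coincide only if the bounces and the displacements do. -/
lemma exists_separation : ∃ r > 0, ∀ i j u v, |u| ≤ r → |v| ≤ r →
    (displaced X w i u : UnitAddCircle) = displaced X w j v → (q : ℤ) ∣ i - j ∧ u = v := by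
  have anti : ∀ {i j : ℤ} {s s' : ℝ}, s' ≤ s → (∀ u v, |u| ≤ s → |v| ≤ s →
      (displaced X w i u : UnitAddCircle) = displaced X w j v → (q : ℤ) ∣ i - j ∧ u = v) →
      ∀ u v, |u| ≤ s' → |v| ≤ s' →
      (displaced X w i u : UnitAddCircle) = displaced X w j v → (q : ℤ) ∣ i - j ∧ u = v :=
    fun h h' u v hu hv => h' u v (hu.trans h) (hv.trans h)
  have hcont : Continuous fun x : ℝ => (x : UnitAddCircle) := AddCircle.continuous_mk' 1
  have hpair : ∀ i j : ℤ, ∃ s > 0, ∀ u v, |u| ≤ s → |v| ≤ s →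
      (displaced X w i u : UnitAddCircle) = displaced X w j v → (q : ℤ) ∣ i - j ∧ u = v := by
    intro i j
    by_cases hij : (X i : UnitAddCircle) = X j
    · have hdvd := hX.inj i j hij
      obtain ⟨n, hn⟩ := (coe_eq_coe_iff _ _).1 hij
      have hwi := hX.weight_pos i
      -- With this bound w i |u - v| ≤ 1 / 2; since it is also the absolute value of an integer, it
      -- is zero.
      refine ⟨1 / (4 * w i), by positivity, fun u v hu hv h => ⟨hdvd, ?_⟩⟩
      obtain ⟨m, hm⟩ := (coe_eq_coe_iff _ _).1 h
      rw [displaced, displaced, ← hX.weight_congr hdvd, hn] at hm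
      have e : w i * (u - v) = ((m - n : ℤ) : ℝ) := by push_cast; linarith
      have h1 : |w i * (u - v)| < 1 := by
        rw [abs_mul, abs_of_pos hwi]
        have h2 : |u - v| ≤ 1 / (4 * w i) + 1 / (4 * w i) :=
          (abs_sub _ _).trans (add_le_add hu hv)
        calc w i * |u - v| ≤ w i * (1 / (4 * w i) + 1 / (4 * w i)) :=
              mul_le_mul_of_nonneg_left h2 hwi.le
          _ = 1 / 2 := by field_simp; norm_num
          _ < 1 := by norm_num
      rw [e] at h1
      have h3 : |m - n| < 1 := by exact_mod_cast h1
      rw [Int.abs_lt_one_iff] at h3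
      rw [h3, Int.cast_zero] at e
      exact sub_eq_zero.1 ((mul_eq_zero.1 e).resolve_left hwi.ne')
    · have hc : Continuous fun z : ℝ × ℝ =>
          ((displaced X w i z.1 : UnitAddCircle), (displaced X w j z.2 : UnitAddCircle)) := by
        refine (hcont.comp ?_).prodMk (hcont.comp ?_) <;> unfold displaced <;> fun_prop
      have h0 : (0 : ℝ × ℝ) ∈ {z : ℝ × ℝ | (displaced X w i z.1 : UnitAddCircle)
          ≠ displaced X w j z.2} := by simpa [displaced] using hij
      obtain ⟨s, hs, hball⟩ := Metric.nhds_basis_closedBall.mem_iff.1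
        ((isClosed_diagonal.isOpen_compl.preimage hc).mem_nhds h0)
      refine ⟨s, hs, fun u v hu hv h => ?_⟩
      have hmem : (u, v) ∈ Metric.closedBall (0 : ℝ × ℝ) s := by
        rw [mem_closedBall_zero_iff]; exact max_le hu hv
      exact (hball hmem h).elim
  have hdvd1 : ∀ i j : ℤ, (q : ℤ) ∣ i + q - j ↔ (q : ℤ) ∣ i - j := fun i j => by
    rw [show i + q - j = i - j + q by ring]; exact dvd_add_self_right
  have hdvd2 : ∀ i j : ℤ, (q : ℤ) ∣ i - (j + q) ↔ (q : ℤ) ∣ i - j := fun i j => by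
    rw [show i - (j + q) = i - j - q by ring]; exact dvd_sub_self_right
  have hone : ∀ i : ℤ, ∃ s > 0, ∀ j u v, |u| ≤ s → |v| ≤ s →
      (displaced X w i u : UnitAddCircle) = displaced X w j v → (q : ℤ) ∣ i - j ∧ u = v := by
    intro i
    obtain ⟨s, hs0, -, hs⟩ := exists_uniform_size (R := fun j s => ∀ u v, |u| ≤ s → |v| ≤ s →
      (displaced X w i u : UnitAddCircle) = displaced X w j v → (q : ℤ) ∣ i - j ∧ u = v) hX.pos
      (fun j s => by simp only [hX.coe_displaced_add_period, hdvd2]) (fun j s s' _ h => anti h)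
      (hpair i)
    exact ⟨s, hs0, hs⟩
  obtain ⟨s, hs0, -, hs⟩ := exists_uniform_size (R := fun i s => ∀ j u v, |u| ≤ s → |v| ≤ s →
      (displaced X w i u : UnitAddCircle) = displaced X w j v → (q : ℤ) ∣ i - j ∧ u = v) hX.pos
      (fun i s => by simp only [hX.coe_displaced_add_period, hdvd1])
      (fun i s s' _ h h' j => anti h (h' j)) hone
  exact ⟨s, hs0, hs⟩

end HyperbolicConfig

/-! ### Orbits asymptotic to the configuration -/

/-- The points `x m` of the circle approach the bounces `idx m` of the configuration, and are from
time `M` on displaced from them by nonzero weighted displacements `η m` of decreasing size. -/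
structure Track (X w : ℤ → ℝ) (idx : ℕ → ℤ) (x : ℕ → UnitAddCircle) (η : ℕ → ℝ) (M : ℕ) : Prop where
  coe : ∀ m, M ≤ m → x m = (displaced X w (idx m) (η m) : ℝ)
  tendsto_dist : Tendsto (fun m => dist (x m) (X (idx m) : UnitAddCircle)) atTop (𝓝 0)
  tendsto : Tendsto η atTop (𝓝 0)
  ne_zero : ∀ m, M ≤ m → η m ≠ 0
  lt : ∀ m, M ≤ m → |η (m + 1)| < |η m|

lemma Track.mono {idx : ℕ → ℤ} {x : ℕ → UnitAddCircle} {η : ℕ → ℝ} {M M' : ℕ}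
    (h : Track X w idx x η M) (hM : M ≤ M') : Track X w idx x η M' :=
  ⟨fun m hm => h.coe m (hM.trans hm), h.tendsto_dist, h.tendsto,
    fun m hm => h.ne_zero m (hM.trans hm), fun m hm => h.lt m (hM.trans hm)⟩

lemma Track.abs_lt_iff {idx : ℕ → ℤ} {x : ℕ → UnitAddCircle} {η : ℕ → ℝ} {M m n : ℕ}
    (h : Track X w idx x η M) (hm : M ≤ m) (hn : M ≤ n) : |η m| < |η n| ↔ n < m := by
  have hanti : StrictAntiOn (fun m => |η m|) (Ici M) :=
    strictAntiOn_of_succ_lt ordConnected_Ici fun m _ hm _ => by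
      rw [Nat.succ_eq_succ]; exact h.lt m hm
  exact hanti.lt_iff_gt hm hn

lemma eventually_abs_lt {η : ℕ → ℝ} (h : Tendsto η atTop (𝓝 0)) {c : ℝ} (hc : 0 < c) :
    ∀ᶠ m in atTop, |η m| < c :=
  h.abs.eventually_lt_const (by rwa [abs_zero])

lemma exists_close_lift (θ : UnitAddCircle) (x : ℝ) :
    ∃ δ : ℝ, θ = ((x + δ : ℝ) : UnitAddCircle) ∧ |δ| = dist θ x := by
  induction θ using QuotientAddGroup.induction_on with | H y => ?_
  refine ⟨y - x - round (y - x), ?_, ?_⟩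
  · rw [show x + (y - x - round (y - x)) = y + ((-round (y - x) : ℤ) : ℝ) by push_cast; ring,
      coe_add_intCast]
  · rw [← UnitAddCircle.norm_eq, dist_eq_norm, AddCircle.coe_sub]

/-! ### Tails of homoclinic orbits and the matching of the two tails. -/

namespace IsStronglyConvexTable

variable (hγ : IsStronglyConvexTable γ)
include hγ

/-- A point on the stable manifold of the configuration has a track, and is eventually on its local
stable manifold. -/
lemma exists_track (hX : HyperbolicConfig γ X w q) {a : ℤ} {Q : Annulus}
    (hQ : Tendsto (fun m : ℕ => dist (iter γ m Q) (phase γ (X (a + m)) (X (a + m + 1))))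
      atTop (𝓝 0))
    (hQne : ∀ m : ℕ, iter γ m Q ≠ phase γ (X (a + m)) (X (a + m + 1))) {ρ : ℝ} (hρ : 0 < ρ) :
    ∃ (η : ℕ → ℝ) (M : ℕ), Track X w (fun m => a + m) (fun m => (iter γ m Q).1) η M ∧
      ∀ m : ℕ, M ≤ m → iter γ m Q ∈ localAsymptoticSet (fun n => iter γ (n : ℤ))
        (phase γ (X (a + m)) (X (a + m + 1))) ρ := by
  obtain ⟨s, hs0, hs1, hs⟩ := hγ.exists_uniform_goodSize hX
  obtain ⟨r, hr0, hr⟩ := hγ.exists_solPhase_mem_localAsymptoticSet hs0 hs1 hs hX hρ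
  obtain ⟨c, hc0, hc⟩ := hX.exists_weight_lower
  choose δ hδ hδd using fun m : ℕ => exists_close_lift (iter γ m Q).1 (X (a + m))
  set η : ℕ → ℝ := fun m => δ m / w (a + m) with hη
  have hdist : Tendsto (fun m : ℕ => dist (iter γ m Q).1 (X (a + m) : UnitAddCircle))
      atTop (𝓝 0) :=
    squeeze_zero (fun _ => dist_nonneg) (fun m => le_max_left _ _) hQ
  have hcoe : ∀ m : ℕ, (iter γ m Q).1 = (displaced X w (a + m) (η m) : ℝ) := fun m => by
    rw [hδ m, displaced, hη, mul_div_cancel₀ _ (hX.weight_pos _).ne']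
  have hlim : Tendsto η atTop (𝓝 0) := by
    refine squeeze_zero_norm (a := fun m : ℕ => dist (iter γ m Q).1 (X (a + m) : UnitAddCircle) / c)
      (fun m => ?_) (by simpa using hdist.div_const c)
    rw [Real.norm_eq_abs, hη, abs_div, hδd, abs_of_pos (hX.weight_pos _)]
    exact div_le_div_of_nonneg_left dist_nonneg hc0 (hc _)
  have hev := eventually_abs_lt hlim (lt_min hs0 hr0)
  obtain ⟨M, hM⟩ := eventually_atTop.1 hev
  have hMs : ∀ m, M ≤ m → |η m| ≤ s := fun m hm => ((hM m hm).trans_le (min_le_left _ _)).le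
  have hphase : ∀ m : ℕ, M ≤ m → iter γ m Q = solPhase γ X w a η m := by
    intro m hm
    have hne := (hs (a + m)).ne (η m) (η (m + 1)) (hMs m hm) (hMs _ (by omega))
    have e := hcoe (m + 1)
    rw [Nat.cast_succ, ← add_assoc] at e
    rcases hγ.boundary_or_phase (iter γ m Q) with h | ⟨θ', hθ, h⟩
    -- A boundary point is fixed, while nearby displacements have distinct consecutive first
    -- coordinates.
    · have h1 := hγ.billiardMap_of_abs_eq h
      rw [← hγ.iter_succ] at h1
      rw [← e, ← hcoe, h1] at hne
      exact (hne rfl).elim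
    · have h1 : (iter γ (m + 1) Q).1 = θ' := by
        rw [hγ.iter_succ, h, hγ.billiardMap_phase hθ]; rfl
      rw [h, hcoe, ← h1, e]; rfl
  have hsol : ∀ m, M ≤ m → IsForwardSol (forwardEq γ X w (a + m)) s (fun k => η (m + k)) := by
    intro m hm
    refine ⟨fun k => hMs _ (by omega), fun k => ?_⟩
    have h1 := hphase (m + k) (by omega)
    have h2 := hphase (m + k + 1) (by omega)
    rw [Nat.cast_succ, hγ.iter_succ, h1, solPhase, solPhase, Nat.cast_succ] at h2
    have e : a + ((m + k : ℕ) : ℤ) = a + m + k := by push_cast; ring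
    have e' : a + (((m + k : ℕ) : ℤ) + 1) = a + m + k + 1 := by push_cast; ring
    rw [e, e', hγ.billiardMap_phase_iff
      ((hs _).ne _ _ (hMs _ (by omega)) (hMs _ (by omega))).symm
      ((hs _).ne _ _ (hMs _ (by omega)) (hMs _ (by omega)))] at h2
    simp only [forwardEq, localEq, add_sub_cancel_right]
    exact h2
  have hG : ∀ m k, Contracts (forwardEq γ X w (a + m) k) s := fun m k => (hs _).contracts
  -- Comparison with the zero solution, the periodic orbit itself. A vanishing displacement would
  -- force the next one to vanish, and the point to lie on that orbit.
  have hdecay : ∀ m, M ≤ m → |η (m + 1)| ≤ (1 - s) * |η m| := fun m hm => by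
    have := (hsol m hm).decay hs0 hs1 (hG m) (isForwardSol_zero hs0 (hG m)) 0
    simpa using this
  have hne : ∀ m, M ≤ m → η m ≠ 0 := fun m hm h0 => by
    have h1 := hdecay m hm
    rw [h0, abs_zero, mul_zero, abs_nonpos_iff] at h1
    refine hQne m ?_
    rw [hphase m hm, solPhase, h0, h1]
    simp [displaced]
  refine ⟨η, M, ⟨fun m _ => hcoe m, hdist, hlim, hne, fun m hm => ?_⟩, fun m hm => ?_⟩
  · have := mul_pos hs0 (abs_pos.2 (hne m hm))
    linarith [hdecay m hm]
  · have h1 := hr (a + m) _ (hsol m hm) ((hM m hm).trans_le (min_le_right _ _))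
    have h2 : solPhase γ X w (a + m) (fun k => η (m + k)) 0 = iter γ m Q := by
      rw [hphase m hm, solPhase, solPhase]
      simp
    rwa [h2] at h1

omit hγ in
/-- If the points of a track are not isolated from the rest of the bi-infinite sequence, then they
coincide with points of the opposite track. -/
lemma _root_.Billiard.HyperbolicConfig.eventually_exists_match (hX : HyperbolicConfig γ X w q)
    {r : ℝ} (hsep : ∀ i j u v, |u| ≤ r → |v| ≤ r →
      (displaced X w i u : UnitAddCircle) = displaced X w j v → (q : ℤ) ∣ i - j ∧ u = v)
    {x : ℤ → UnitAddCircle} {i₁ i₂ : ℕ → ℤ} {η₁ η₂ : ℕ → ℝ} {M : ℕ}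
    (h₁ : Track X w i₁ (fun m => x m) η₁ M) (h₂ : Track X w i₂ (fun m => x (-m)) η₂ M)
    (hr₁ : ∀ m, M ≤ m → |η₁ m| ≤ r) (hr₂ : ∀ m, M ≤ m → |η₂ m| ≤ r)
    (hnot : ∀ m : ℕ, M ≤ m → ∀ U : Set UnitAddCircle, IsClosed U → U ∈ 𝓝 (x m) →
      ∃ j : ℤ, j ≠ m ∧ x j ∈ U) :
    ∀ᶠ m : ℕ in atTop, ∃ n, M ≤ n ∧ (q : ℤ) ∣ i₁ m - i₂ n ∧ η₁ m = η₂ n := by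
  have hinj : ∀ m n : ℕ, M ≤ m → M ≤ n → x m = x n → m = n := by
    intro m n hm hn h
    rw [h₁.coe m hm, h₁.coe n hn] at h
    have h' := (hsep _ _ _ _ (hr₁ m hm) (hr₁ n hn) h).2
    have a1 := h₁.abs_lt_iff hm hn
    have a2 := h₁.abs_lt_iff hn hm
    rw [h'] at a1 a2
    simp only [lt_irrefl, false_iff, not_lt] at a1 a2
    omega
  -- The point x m has a distance d > 0 from all bounces, whereas far points of both tails are
  -- within d / 2 of them. Only finitely many indices come near x m, so a partner in every closed
  -- neighbourhood must be an exact one.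
  have hcoinc : ∀ m : ℕ, M ≤ m → ∃ j : ℤ, j ≠ m ∧ x j = x m := by
    intro m hm
    by_contra! hno
    obtain ⟨d, hd0, -, hd⟩ := exists_uniform_size
      (R := fun i s => s ≤ dist (X i : UnitAddCircle) (x m)) hX.pos
      (fun i s => by
        have := hX.coe_displaced_add_period i 0
        simp only [displaced, mul_zero, add_zero] at this
        simp only [this])
      (fun i s s' _ h h' => h.trans h')
      (fun i => ⟨dist (X i : UnitAddCircle) (x m), dist_pos.2 fun h => by
        have e : (displaced X w i 0 : UnitAddCircle) = displaced X w (i₁ m) (η₁ m) := by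
          rw [← h₁.coe m hm, ← h, displaced, mul_zero, add_zero]
        exact h₁.ne_zero m hm (hsep _ _ _ _ (by
          rw [abs_zero]; exact (abs_nonneg _).trans (hr₁ m hm)) (hr₁ m hm) e).2.symm, le_rfl⟩)
    have hfar : ∀ {y : ℕ → UnitAddCircle} {i : ℕ → ℤ},
        Tendsto (fun n => dist (y n) (X (i n) : UnitAddCircle)) atTop (𝓝 0) →
        ∀ᶠ n in atTop, d / 2 ≤ dist (y n) (x m) := by
      intro y i hy
      filter_upwards [hy.eventually (gt_mem_nhds (half_pos hd0))] with n hn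
      have := dist_triangle_left (X (i n) : UnitAddCircle) (x m) (y n)
      linarith [hd (i n)]
    obtain ⟨N, hN⟩ := eventually_atTop.1 ((hfar h₁.tendsto_dist).and (hfar h₂.tendsto_dist))
    have hfin : {j : ℤ | j ≠ m ∧ dist (x j) (x m) < d / 2}.Finite := by
      refine (finite_Ioo (-(N : ℤ)) N).subset fun j hj => ?_
      by_contra hout
      rw [mem_Ioo, not_and_or, not_lt, not_lt] at hout
      rcases hout with h | h
      · have := (hN j.natAbs (by omega)).2
        rw [show -((j.natAbs : ℕ) : ℤ) = j by omega] at this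
        exact absurd hj.2 (not_lt.2 this)
      · have := (hN j.natAbs (by omega)).1
        rw [show ((j.natAbs : ℕ) : ℤ) = j by omega] at this
        exact absurd hj.2 (not_lt.2 this)
    have hnhds : (x '' {j : ℤ | j ≠ m ∧ dist (x j) (x m) < d / 2})ᶜ ∩ Metric.ball (x m) (d / 2)
        ∈ 𝓝 (x m) := by
      refine inter_mem ((hfin.image x).isClosed.isOpen_compl.mem_nhds ?_)
        (Metric.ball_mem_nhds _ (half_pos hd0))
      rintro ⟨j, hj, hjm⟩
      exact hno j hj.1 hjm
    obtain ⟨U, hU, hUc, hUs⟩ := exists_mem_nhds_isClosed_subset hnhds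
    obtain ⟨j, hj, hjU⟩ := hnot m hm U hUc hU
    exact (hUs hjU).1 ⟨j, ⟨hj, (hUs hjU).2⟩, rfl⟩
  -- By injectivity on the forward tail each of the finitely many middle points is met there at most
  -- once.
  have hmid : ∀ᶠ m : ℕ in atTop, ∀ j ∈ Ioo (-(M : ℤ)) M, x m ≠ x j := by
    rw [Filter.eventually_all_finite (finite_Ioo _ _)]
    intro j _
    by_cases h : ∃ n : ℕ, M ≤ n ∧ x n = x j
    · obtain ⟨n, hn, hnj⟩ := h
      filter_upwards [eventually_gt_atTop n] with m hm hmj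
      have := hinj m n (by omega) hn (hmj.trans hnj.symm)
      omega
    · push Not at h
      filter_upwards [eventually_ge_atTop M] with m hm using h m hm
  filter_upwards [hmid, eventually_ge_atTop M] with m hm hmM
  obtain ⟨j, hj, hjx⟩ := hcoinc m hmM
  have hjneg : j ≤ -(M : ℤ) := by
    by_contra! hlt
    rcases lt_or_ge j M with h | h
    · exact hm j ⟨hlt, h⟩ hjx.symm
    · have e : ((j.natAbs : ℕ) : ℤ) = j := by omega
      have := hinj j.natAbs m (by omega) hmM (by rw [e, hjx])
      omega
  have e : -((j.natAbs : ℕ) : ℤ) = j := by omega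
  refine ⟨j.natAbs, by omega, ?_⟩
  have h := h₂.coe j.natAbs (by omega)
  rw [e, hjx] at h
  rw [h₁.coe m hmM] at h
  exact hsep _ _ _ _ (hr₁ m hmM) (hr₂ _ (by omega)) h

omit hγ in
/-- Two tracks in opposite directions whose points coincide force the period to divide two. -/
lemma _root_.Billiard.dvd_two_of_match {x₁ x₂ : ℕ → UnitAddCircle} {a b : ℤ} {η₁ η₂ : ℕ → ℝ} {M : ℕ}
    (h₁ : Track X w (fun m => a + m) x₁ η₁ M) (h₂ : Track X w (fun m => b - m) x₂ η₂ M)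
    (hm₁ : ∀ᶠ m : ℕ in atTop, ∃ n : ℕ, M ≤ n ∧ (q : ℤ) ∣ (a + m) - (b - n) ∧ η₁ m = η₂ n)
    (hm₂ : ∀ᶠ n : ℕ in atTop, ∃ m : ℕ, M ≤ m ∧ (q : ℤ) ∣ (b - n) - (a + m) ∧ η₂ n = η₁ m) :
    (q : ℤ) ∣ 2 := by
  obtain ⟨N, hN⟩ := eventually_atTop.1 hm₂
  -- The forward time l is taken so late that its partner n₀ exceeds both M and N; then the backward
  -- time n₀ + 1 also has a partner l'.
  have hsmall := eventually_abs_lt h₁.tendsto (abs_pos.2 (h₂.ne_zero _ (le_max_left M N)))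
  obtain ⟨l, hl⟩ := eventually_atTop.1 ((hm₁.and hsmall).and (eventually_ge_atTop M))
  obtain ⟨⟨⟨n₀, hn₀, hd₀, he₀⟩, hs₀⟩, hlM⟩ := hl l le_rfl
  obtain ⟨⟨⟨n₁, hn₁, hd₁, he₁⟩, -⟩, -⟩ := hl (l + 1) (by omega)
  rw [he₀, h₂.abs_lt_iff hn₀ (le_max_left _ _)] at hs₀
  have hNn : N ≤ n₀ + 1 := by have := le_max_right M N; omega
  obtain ⟨l', hl', hd', he'⟩ := hN (n₀ + 1) hNn
  have h3 : n₀ < n₁ := by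
    rw [← h₂.abs_lt_iff hn₁ hn₀, ← he₁, ← he₀]
    exact h₁.lt l hlM
  have h4 : l < l' := by
    rw [← h₁.abs_lt_iff hl' hlM, ← he', he₀]
    exact h₂.lt n₀ hn₀
  -- Otherwise n₀ + 1 would lie strictly between n₀ and n₁, and its partner l' strictly between l
  -- and l + 1.
  have h5 : n₁ ≤ n₀ + 1 := by
    by_contra! hlt
    rw [← h₂.abs_lt_iff hn₁ (by omega), he', ← he₁, h₁.abs_lt_iff (by omega) hl'] at hlt
    omega
  obtain rfl : n₁ = n₀ + 1 := by omega
  have h6 := dvd_sub hd₁ hd₀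
  rw [show a + ((l + 1 : ℕ) : ℤ) - (b - ((n₀ + 1 : ℕ) : ℤ)) - (a + l - (b - n₀)) = 2 by
    push_cast; ring] at h6
  exact h6

/-- Time reversal exchanges the local invariant manifolds. -/
lemma flip_mem_localAsymptoticSet {x p : Annulus} {ρ : ℝ}
    (h : x ∈ localAsymptoticSet (fun n => iter γ (n : ℤ)) (flip p) ρ) :
    flip x ∈ localAsymptoticSet (fun n => iter γ (-(n : ℤ))) p ρ := by
  have hdist : ∀ (y : Annulus) (m : ℕ), dist (iter γ (-(m : ℤ)) (flip y)) (iter γ (-(m : ℤ)) p)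
      = dist (iter γ m y) (iter γ m (flip p)) := fun y m => by
    rw [hγ.iter_flip, neg_neg, ← dist_flip, flip_flip, hγ.iter_flip]
  refine ⟨?_, lt_of_le_of_lt ?_ h.2⟩
  · have h1 := h.1
    change Tendsto _ _ _ at h1
    change Tendsto _ _ _
    simpa only [hdist] using h1
  · refine le_iInf₂ fun c hc => ?_
    refine iInf₂_le_of_le (fun t => flip (c t)) ?_ (curveLength_flip c).le
    obtain ⟨⟨hc1, hc2⟩, h0, h1⟩ := hc
    refine ⟨⟨continuous_flip.comp_continuousOn hc1, ?_⟩, by simp [h0], by simp [h1]⟩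
    simpa only [hdist] using hc2

/-- If the orbit of a point homoclinic to a hyperbolic Aubry-Mather periodic orbit is not localised
one-fibered, then the period divides two. -/
lemma dvd_two_of_not_isLocalisedOneFibered {α : ℝ} {P Q : Annulus} (hP : P ∈ aubryMatherSet γ α)
    (hhyp : IsHyperbolicPeriodicPoint γ q P) (hQ : IsHomoclinic γ P Q) {ρ : ℝ} (hρ : 0 < ρ)
    (hnot : ¬ IsLocalisedOneFibered γ P Q ρ) : (q : ℤ) ∣ 2 := by
  obtain ⟨X, hXP, hmin, -⟩ := hP
  obtain ⟨w, hX, hphase⟩ := hγ.exists_hyperbolicConfig hhyp hXP hmin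
  obtain ⟨hQP, ⟨_, ⟨a, rfl⟩, hs⟩, _, ⟨b, rfl⟩, hu⟩ := hQ
  change Tendsto _ _ _ at hs hu
  have hout : ∀ l : ℤ, iter γ l Q ∉ orbit γ P := by
    rintro l ⟨n, hn⟩
    refine hQP ⟨n - l, hγ.iter_injective l ?_⟩
    change iter γ l (iter γ (n - l) P) = _
    rw [← hγ.iter_add, add_sub_cancel]
    exact hn
  -- the forward orbit
  have hs' : ∀ m : ℕ, iter γ m (iter γ a P) = phase γ (X (a + m)) (X (a + m + 1)) := fun m => by
    rw [← hγ.iter_add, add_comm, hphase]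
  obtain ⟨η₁, M₁, ht₁, hloc₁⟩ := hγ.exists_track hX (a := a) (Q := Q) (by simpa only [hs'] using hs)
    (fun m h => hout m ⟨m + a, by rw [← hs', ← hγ.iter_add] at h; exact h.symm⟩) hρ
  -- the backward orbit is the forward orbit of the reversed configuration
  have hflip : ∀ i : ℤ, flip (iter γ i P) = phase γ (X i) (X (i - 1)) := fun i => by
    have h1 := (hX.ne (i - 1)).symm
    rw [sub_add_cancel] at h1
    rw [hphase, hγ.phase_eq_flip_iff (hX.ne i) h1, add_comm]
    exact hX.el i
  have hrev : ∀ m : ℕ, phase γ (X (-(-b + (m : ℤ)))) (X (-(-b + (m : ℤ) + 1)))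
      = flip (iter γ (-(m : ℤ)) (iter γ b P)) := fun m => by
    rw [← hγ.iter_add, hflip]
    ring_nf
  obtain ⟨η₂, M₂, ht₂, hloc₂⟩ := hγ.exists_track hX.reverse (a := -b) (Q := flip Q)
    (by simpa only [hrev, hγ.iter_flip, dist_flip] using hu)
    (fun m h => by
      rw [hrev, hγ.iter_flip] at h
      refine hout (-m) ⟨-m + b, ?_⟩
      rw [flip_injective h, ← hγ.iter_add]) hρ
  -- Negation of one-fiberedness for iterates on local manifolds, with indices counted from Q
  -- instead of from the iterate.
  have hfib : ∀ l : ℤ, (∃ P' ∈ orbit γ P,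
      iter γ l Q ∈ localStableManifold γ P' ρ ∪ localUnstableManifold γ P' ρ) →
      ∀ U : Set UnitAddCircle, IsClosed U → U ∈ 𝓝 (iter γ l Q).1 →
        ∃ j : ℤ, j ≠ l ∧ (iter γ j Q).1 ∈ U := by
    intro l hl U hU hU'
    by_contra! hno
    refine hnot ⟨l, ⟨U, hU, hU', fun j hj => ?_⟩, hout l, hl⟩
    rw [← hγ.iter_add]
    exact hno (j + l) (by omega)
  obtain ⟨r, hr0, hsep⟩ := hX.exists_separation
  obtain ⟨M₃, hM₃⟩ := eventually_atTop.1 ((eventually_abs_lt ht₁.tendsto hr0).and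
    (eventually_abs_lt ht₂.tendsto hr0))
  set M := max (max M₁ M₂) M₃
  have m1 : M₁ ≤ M := (le_max_left _ _).trans (le_max_left _ _)
  have m2 : M₂ ≤ M := (le_max_right _ _).trans (le_max_left _ _)
  have m3 : M₃ ≤ M := le_max_right _ _
  have t₁ : Track X w (fun m => a + m) (fun m => (iter γ (m : ℤ) Q).1) η₁ M := ht₁.mono m1
  have t₂ : Track X w (fun m => b - m) (fun m => (iter γ (-(m : ℤ)) Q).1) η₂ M := by
    have e : ∀ m : ℕ, -(-b + (m : ℤ)) = b - m := fun m => by ring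
    obtain ⟨c1, c2, c3, c4, c5⟩ := ht₂.mono m2
    simp only [displaced, e, hγ.iter_flip, flip_fst] at c1 c2
    exact ⟨c1, c2, c3, c4, c5⟩
  have hnot₁ : ∀ m : ℕ, M ≤ m → ∀ U : Set UnitAddCircle, IsClosed U → U ∈ 𝓝 (iter γ m Q).1 →
      ∃ j : ℤ, j ≠ m ∧ (iter γ j Q).1 ∈ U := fun m hm => by
    refine hfib m ⟨iter γ (m + a) P, ⟨m + a, rfl⟩, Or.inl ?_⟩
    rw [hγ.iter_add, hs']
    exact hloc₁ m (m1.trans hm)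
  have hnot₂ : ∀ m : ℕ, M ≤ m → ∀ U : Set UnitAddCircle, IsClosed U →
      U ∈ 𝓝 (iter γ (-(m : ℤ)) Q).1 → ∃ j : ℤ, j ≠ m ∧ (iter γ (-j) Q).1 ∈ U :=
    fun m hm U hU hU' => by
    have hl : ∃ P' ∈ orbit γ P,
        iter γ (-(m : ℤ)) Q ∈ localStableManifold γ P' ρ ∪ localUnstableManifold γ P' ρ := by
      refine ⟨iter γ (-m + b) P, ⟨-m + b, rfl⟩, Or.inr ?_⟩
      have h1 := hloc₂ m (m2.trans hm)
      rw [hrev, ← hγ.iter_add] at h1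
      have h2 := hγ.flip_mem_localAsymptoticSet h1
      rwa [hγ.iter_flip, flip_flip] at h2
    obtain ⟨j, hj, hjU⟩ := hfib (-m) hl U hU hU'
    exact ⟨-j, by omega, by rwa [neg_neg]⟩
  have hr₁ : ∀ m, M ≤ m → |η₁ m| ≤ r := fun m hm => (hM₃ m (m3.trans hm)).1.le
  have hr₂ : ∀ m, M ≤ m → |η₂ m| ≤ r := fun m hm => (hM₃ m (m3.trans hm)).2.le
  exact dvd_two_of_match t₁ t₂
    (hX.eventually_exists_match hsep (x := fun l => (iter γ l Q).1) t₁ t₂ hr₁ hr₂ hnot₁)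
    (hX.eventually_exists_match hsep (x := fun l => (iter γ (-l) Q).1) t₂
      (by simpa only [neg_neg] using t₁) hr₂ hr₁ hnot₂)

end IsStronglyConvexTable

end Billiard

end

theorem proposition3p6 (γ : UnitAddCircle → Billiard.Plane)
    (hγ : Billiard.IsStronglyConvexTable γ)
    (p q : ℕ) (hp : 0 < p) (hpq : p < q) (hcop : Nat.Coprime p q)
    (P : Billiard.Annulus)
    (hP : P ∈ Billiard.aubryMatherSet γ ((p : ℝ) / (q : ℝ)))
    (hhyp : Billiard.IsHyperbolicPeriodicPoint γ q P)
    (huniq : ∀ P' ∈ Billiard.aubryMatherSet γ ((p : ℝ) / (q : ℝ)),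
      P' ∈ Function.periodicPts (Billiard.billiardMap γ) → P' ∈ Billiard.orbit γ P)
    (Q : Billiard.Annulus) (hQ : Billiard.IsHomoclinic γ P Q)
    (ρ : ℝ) (hρ : 0 < ρ)
    (hnot : ¬ Billiard.IsLocalisedOneFibered γ P Q ρ) :
    q = 2 ∧ P ∈ Billiard.aubryMatherSet γ (1 / 2) := by
  have hdvd : (q : ℤ) ∣ 2 := hγ.dvd_two_of_not_isLocalisedOneFibered hP hhyp hQ hρ hnot
  have h2 : q ≤ 2 := Nat.le_of_dvd two_pos (by exact_mod_cast hdvd)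
  -- The inequalities 0 < p < q exclude q = 1, and then leave p = 1.
  obtain rfl : q = 2 := by omega
  obtain rfl : p = 1 := by omega
  exact ⟨rfl, by simpa using hP⟩
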